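/- **Setting.** Let $n\ge 1$, $m=\lfloor n/2\rfloor$. A Riemannian structure on a bounded open set $U\subset\mathbb R^n$ is a (Lebesgue-)measurable field $A$ of positive definite symmetric matrices, $g(x)(X,X)=\langle A(x)X,X\rangle$, taken up to equality almost everywhere. $\Omega^k(U,g)$ is the Hilbert space of measurable complex $k$-forms $\omega$ on $U$ with $\|\omega\|_g^2=\int_U\lambda^k(g)(\omega,\omega)\,\mu_g=\int_U\langle\lambda^k(A^{-1})\omega,\omega\rangle\sqrt{\det A}\,dx<\infty$. $\mathcal R(U)$ is the set of those $g$ for which there are, for $k=m,m+1$, exponents $1\le q_k\le2\le p_k\le+\infty$ with $L^{p_k}(U,\Lambda^k_{\mathbb C})\subset\Omega^k(U,g)\subset L^{q_k}(U,\Lambda^k_{\mathbb C})$ and $\frac1{p_m}+\frac1n>\frac1{q_{m+1}}$, and a constant $B>1$ with $g>B$ almost everywhere. Let $p_k(g)$ be the infimum of the $p\in[2,\infty]$ with $L^p\subset\Omega^k(U,g)$ and $q_k(g)$ the supremum of the $q\in[1,2]$ with $\Omega^k(U,g)\subset L^q$. Let $V$ be a compact topological manifold of dimension $n$ that is derivable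 of order $p\ge1$: its chart changes are differentiable almost everywhere with derivative in $L^p$. Let $\mathcal O=(\mathcal O_i)_{i\in I}$ be a cover of $V$ by domains of charts $\theta_i:\mathcal O_i\to U_i\subset\mathbb R^n$ with bounded images. $\mathcal R(\mathcal O)$ is the set of measurable Riemannian structures $g$ on $V$, i.e. of families $(g_i)_{i\in I}$ of structures on the $U_i$ with $(\theta_j\circ\theta_i^{-1})^*g_j=g_i$ almost everywhere, such that $g_i\in\mathcal R(U_i)$ for all $i$. It carries the coarsest topology that makes continuous all functions $g\mapsto\|\omega\|_{g_i}^2$ with $\omega\in C_0(U_i,\Lambda^k_{\mathbb C})$ (continuous forms vanishing at infinity), $g\mapsto p_k(g_i)$ and $g\mapsto q_k(g_i)$ (with values in $[1,\infty]$), for $k=m,m+1$ and $i\in I$. **Proposition 2.2.** (a) If $\mathcal R(\mathcal O)$ is non-empty, it is path-connected. (b) More precisely, any $g_0,g_1\in\mathcal R(\mathcal O)$ are joined by a continuous path $(g_t)_{t\in[0,1]}$ in $\mathcal R(\mathcal O)$ such that, for all $t$ and $i$, if $A_0,A_1$ denote the matrix fields of $g_0,g_1$ on $U_i$, then the matrix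 field of $g_t$ on $U_i$ is almost everywhere $$A_t=A_0^{1/2}\bigl(A_0^{-1/2}A_1A_0^{-1/2}\bigr)^tA_0^{1/2};$$ and, for $0<t<1$, every $i\in I$ and every $k$, the complex (Calderón) interpolation space $(\Omega^k(U_i,g_0),\Omega^k(U_i,g_1))_t$ is equal, with the same norm, to $\Omega^k(U_i,g_t)$. (c) If $I$ is countable, then $\mathcal R(\mathcal O)$ is metrizable for the topology defined in the same way with the forms $\omega\in C_c(U_i,\Lambda^k_{\mathbb C})$ of compact support. -/

import Mathlib

open MeasureTheory Filter Topology Set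
open scoped ENNReal NNReal

noncomputable section

namespace LpRiemann

/-- The model space `ℝⁿ` with its Euclidean norm and Lebesgue measure. -/
abbrev Model (n : ℕ) : Type := EuclideanSpace ℝ (Fin n)

/-- `Λᵏ_ℂ(ℝⁿ*)`: alternating `ℝ`-multilinear `k`-forms on `ℝⁿ` with complex values. -/
abbrev Form (n k : ℕ) : Type := (Model n) [⋀^Fin k]→L[ℝ] ℂ

/-- Real `n × n` matrices; a Euclidean structure on `ℝⁿ` is a positive definite one,
`g(X, X) = ⟨A X, X⟩`. -/
abbrev Mat (n : ℕ) : Type := Matrix (Fin n) (Fin n) ℝ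

/-! ### Powers and geometric means of positive definite matrices -/

/-- The real power `Aˢ` of a positive definite symmetric matrix (functional calculus). -/
def matPow {n : ℕ} (A : Mat n) (s : ℝ) : Mat n := cfc (fun x : ℝ => x ^ s) A

/-- `A₀^{1/2} (A₀^{-1/2} A₁ A₀^{-1/2})ᵗ A₀^{1/2}`. -/
def geomMean {n : ℕ} (A₀ A₁ : Mat n) (t : ℝ) : Mat n :=
  matPow A₀ (1 / 2) * matPow (matPow A₀ (-1 / 2) * A₁ * matPow A₀ (-1 / 2)) t * matPow A₀ (1 / 2)

/-! ### The spaces `Ωᵏ(U, g)` -/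

/-- `λᵏ(g)(ω, ω)` for the Euclidean structure `g` of matrix `A`: the columns `f₁, …, fₙ` of
`A^{-1/2}` are an orthonormal basis for `g`, and the value is the sum of
`|ω(f_{i₁}, …, f_{iₖ})|²` over `i₁ < ⋯ < iₖ`, that is `1 / k!` times the sum over all indices. -/
def formNormSq {n k : ℕ} (A : Mat n) (ω : Form n k) : ℝ :=
  ((k.factorial : ℝ))⁻¹ * ∑ v : Fin k → Fin n,
    ‖ω (fun j => WithLp.toLp 2 (fun a => matPow A (-1 / 2) a (v j)))‖ ^ 2

/-- `‖ω‖²_g = ∫_U λᵏ(g)(ω, ω) μ_g`, where `μ_g = √(det A) dx`; possibly infinite. -/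
def normSq {n : ℕ} (k : ℕ) (U : Set (Model n)) (A : Model n → Mat n) (ω : Model n → Form n k) :
    ℝ≥0∞ :=
  ∫⁻ x in U, ENNReal.ofReal (formNormSq (A x) (ω x)) * ENNReal.ofReal (Real.sqrt (A x).det)

/-- `ω ∈ Ωᵏ(U, g)`. -/
def MemOmega {n : ℕ} (k : ℕ) (U : Set (Model n)) (A : Model n → Mat n) (ω : Model n → Form n k) :
    Prop :=
  AEStronglyMeasurable ω (volume.restrict U) ∧ normSq k U A ω < ∞

/-- `Lᵖ(U, Λᵏ) ⊂ Ωᵏ(U, g)`. -/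
def LpSubOmega {n : ℕ} (k : ℕ) (U : Set (Model n)) (A : Model n → Mat n) (p : ℝ≥0∞) : Prop :=
  ∀ ω : Model n → Form n k, MemLp ω p (volume.restrict U) → MemOmega k U A ω

/-- `Ωᵏ(U, g) ⊂ L^q(U, Λᵏ)`. -/
def OmegaSubLp {n : ℕ} (k : ℕ) (U : Set (Model n)) (A : Model n → Mat n) (q : ℝ≥0∞) : Prop :=
  ∀ ω : Model n → Form n k, MemOmega k U A ω → MemLp ω q (volume.restrict U)

/-- `g ∈ 𝓡(U)` for the measurable field `A` of positive definite matrices; here `m = ⌊n/2⌋`. -/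
def IsAdmissible {n : ℕ} (U : Set (Model n)) (A : Model n → Mat n) : Prop :=
  ∃ p q : ℕ → ℝ≥0∞,
    (∀ k, k = n / 2 ∨ k = n / 2 + 1 →
      1 ≤ q k ∧ q k ≤ 2 ∧ 2 ≤ p k ∧ LpSubOmega k U A (p k) ∧ OmegaSubLp k U A (q k)) ∧
    (q (n / 2 + 1))⁻¹ < (p (n / 2))⁻¹ + (n : ℝ≥0∞)⁻¹ ∧
    ∃ B : ℝ, 1 < B ∧ ∀ᵐ x ∂volume.restrict U, (A x - B • (1 : Mat n)).PosDef

/-- `p_k(g)`: the optimal `p ∈ [2, ∞]` with `Lᵖ ⊂ Ωᵏ(U, g)`. -/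
def pExp {n : ℕ} (k : ℕ) (U : Set (Model n)) (A : Model n → Mat n) : ℝ≥0∞ :=
  sInf {p | 2 ≤ p ∧ LpSubOmega k U A p}

/-- `q_k(g)`: the optimal `q ∈ [1, 2]` with `Ωᵏ(U, g) ⊂ L^q`. -/
def qExp {n : ℕ} (k : ℕ) (U : Set (Model n)) (A : Model n → Mat n) : ℝ≥0∞ :=
  sSup {q | 1 ≤ q ∧ q ≤ 2 ∧ OmegaSubLp k U A q}

/-- `C₀(U, Λᵏ)`, extended by zero: for a bounded open `U` the continuous forms on `U` vanishing at
infinity are those that extend to continuous forms on `ℝⁿ` vanishing outside `U`. -/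
def testC0 {n : ℕ} (k : ℕ) (U : Set (Model n)) : Set (Model n → Form n k) :=
  {ω | Continuous ω ∧ ∀ x, x ∉ U → ω x = 0}

/-- `C_c(U, Λᵏ)`, extended by zero. -/
def testCc {n : ℕ} (k : ℕ) (U : Set (Model n)) : Set (Model n → Form n k) :=
  {ω | Continuous ω ∧ HasCompactSupport ω ∧ tsupport ω ⊆ U}

/-! ### Topological manifolds with an `Lᵖ` structure -/

/-- A homeomorphism `φ : U → W` between open sets of `ℝⁿ` that is differentiable almost everywhere
and whose derivative is in `Lᵖ(U, End ℝⁿ)`. -/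
structure IsDerivable {n : ℕ} (p : ℝ≥0∞) (φ : OpenPartialHomeomorph (Model n) (Model n)) :
    Prop where
  differentiableAt : ∀ᵐ x ∂volume.restrict φ.source, DifferentiableAt ℝ φ x
  memLp_fderiv : MemLp (fun x => fderiv ℝ φ x) p (volume.restrict φ.source)

/-- The manifold `V` is derivable of order `p`: the chart changes of its atlas are. -/
def IsDerivableManifold (n : ℕ) (p : ℝ≥0∞) (V : Type*) [TopologicalSpace V]
    [ChartedSpace (Model n) V] : Prop :=
  ∀ e ∈ atlas (Model n) V, ∀ e' ∈ atlas (Model n) V, IsDerivable p (e.symm.trans e')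

/-- `θ` is a family of charts `θ_i : O_i → U_i` (charts of the atlas or restrictions of such charts
to open subsets) with bounded images `U_i`, whose domains `O_i` cover `V`. -/
structure IsChartCover {n : ℕ} {V : Type*} [TopologicalSpace V] [ChartedSpace (Model n) V]
    {ι : Type*} (θ : ι → OpenPartialHomeomorph V (Model n)) : Prop where
  chart : ∀ i, ∃ e ∈ atlas (Model n) V,
    (θ i).source ⊆ e.source ∧ EqOn (θ i) e (θ i).source
  bounded : ∀ i, Bornology.IsBounded (θ i).target
  cover : (⋃ i, (θ i).source) = univ

/-- The Jacobian matrix of `φ` at `x`. -/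
def jacobian {n : ℕ} (φ : Model n → Model n) (x : Model n) : Mat n :=
  Matrix.of fun a b => (fderiv ℝ φ x (EuclideanSpace.single b 1)) a

/-- `𝓡(O)`: measurable Riemannian structures on `V`, up to equality almost everywhere, given by
their images `g_i` in the charts (so `(θ_j ∘ θ_i⁻¹)^* g_j = g_i` almost everywhere), such that
`g_i ∈ 𝓡(U_i)` for every `i`. -/
structure RiemStructure {n : ℕ} {V : Type*} [TopologicalSpace V] {ι : Type*}
    (θ : ι → OpenPartialHomeomorph V (Model n)) where
  /-- the matrix field of `g_i` on `U_i` -/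
  field : ∀ i, Model n →ₘ[volume.restrict (θ i).target] Mat n
  posDef : ∀ i, ∀ᵐ x ∂volume.restrict (θ i).target, (field i x).PosDef
  compat : ∃ A : ι → Model n → Mat n,
    (∀ i, field i =ᵐ[volume.restrict (θ i).target] A i) ∧
    ∀ i j, ∀ᵐ x ∂volume.restrict ((θ i).symm.trans (θ j)).source,
      A i x = (jacobian ((θ i).symm.trans (θ j)) x).transpose *
        A j (((θ i).symm.trans (θ j)) x) * jacobian ((θ i).symm.trans (θ j)) x
  admissible : ∀ i, IsAdmissible (θ i).target (field i)

/-- The coarsest topology on `𝓡(O)` for which the functions `g ↦ ‖ω‖²_g`, `g ↦ p_k(g_i)` and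
`g ↦ q_k(g_i)` are continuous, where `k = m, m + 1` and `ω` runs through the test forms
`T k U_i`; it is the topology of the semi-distances `|f(g) - f(g')|` of these functions. -/
@[reducible] def structTopology {n : ℕ} {V : Type*} [TopologicalSpace V] {ι : Type*}
    (T : ∀ k : ℕ, Set (Model n) → Set (Model n → Form n k))
    (θ : ι → OpenPartialHomeomorph V (Model n)) : TopologicalSpace (RiemStructure θ) :=
  ⨅ (i : ι) (k : ℕ) (_ : k = n / 2 ∨ k = n / 2 + 1),
    (⨅ ω ∈ T k (θ i).target,
      TopologicalSpace.induced (fun g : RiemStructure θ => normSq k (θ i).target (g.field i) ω)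
        inferInstance) ⊓
    (TopologicalSpace.induced (fun g : RiemStructure θ => pExp k (θ i).target (g.field i))
        inferInstance ⊓
      TopologicalSpace.induced (fun g : RiemStructure θ => qExp k (θ i).target (g.field i))
        inferInstance)

/-- The topology of `𝓡(O)`, with test forms in `C₀(U_i, Λᵏ)`. -/
instance {n : ℕ} {V : Type*} [TopologicalSpace V] {ι : Type*}
    (θ : ι → OpenPartialHomeomorph V (Model n)) : TopologicalSpace (RiemStructure θ) :=
  structTopology (fun k U => testC0 k U) θ

/-! ### Complex interpolation

A Banach couple is given by its two norms `N₀`, `N₁` on a common ambient complex vector space `X`,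
with values in `[0, ∞]`: the space `X_j` consists of the vectors on which `N_j` is finite. -/

section Interpolation

variable {X : Type*} [AddCommGroup X] [Module ℂ X]

/-- The norm of `X₀ + X₁`. -/
def sumNorm (N₀ N₁ : X → ℝ≥0∞) (x : X) : ℝ≥0∞ :=
  ⨅ (a : X) (b : X) (_ : a + b = x), N₀ a + N₁ b

/-- The closed strip `0 ≤ Re z ≤ 1`. -/
def closedStrip : Set ℂ := {z | 0 ≤ z.re ∧ z.re ≤ 1}

/-- Calderón's class of functions on the strip: bounded and continuous on the closed strip with
values in `X₀ + X₁`, holomorphic inside, and restricting on the two boundary lines to continuous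
functions with values in `X₀` and in `X₁` respectively that tend to zero at infinity. -/
structure IsCalderon (N₀ N₁ : X → ℝ≥0∞) (f : ℂ → X) : Prop where
  bounded : ∃ C : ℝ≥0, ∀ z ∈ closedStrip, sumNorm N₀ N₁ (f z) ≤ C
  continuous : ∀ z ∈ closedStrip,
    Tendsto (fun w => sumNorm N₀ N₁ (f w - f z)) (𝓝[closedStrip] z) (𝓝 0)
  holomorphic : ∀ z : ℂ, 0 < z.re → z.re < 1 → ∃ d : X, sumNorm N₀ N₁ d < ∞ ∧
    Tendsto (fun w => sumNorm N₀ N₁ ((w - z)⁻¹ • (f w - f z) - d)) (𝓝[≠] z) (𝓝 0)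
  left_mem : ∀ y : ℝ, N₀ (f (y * Complex.I)) < ∞
  left_continuous : ∀ y : ℝ,
    Tendsto (fun s : ℝ => N₀ (f (s * Complex.I) - f (y * Complex.I))) (𝓝 y) (𝓝 0)
  left_zero : Tendsto (fun s : ℝ => N₀ (f (s * Complex.I))) (cocompact ℝ) (𝓝 0)
  right_mem : ∀ y : ℝ, N₁ (f (1 + y * Complex.I)) < ∞
  right_continuous : ∀ y : ℝ,
    Tendsto (fun s : ℝ => N₁ (f (1 + s * Complex.I) - f (1 + y * Complex.I))) (𝓝 y) (𝓝 0)
  right_zero : Tendsto (fun s : ℝ => N₁ (f (1 + s * Complex.I))) (cocompact ℝ) (𝓝 0)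

/-- The norm of the complex interpolation space `(X₀, X₁)_t`, equal to `∞` off that space. -/
def interpNorm (N₀ N₁ : X → ℝ≥0∞) (t : ℝ) (x : X) : ℝ≥0∞ :=
  ⨅ (f : ℂ → X) (_ : IsCalderon N₀ N₁ f) (_ : f t = x),
    max (⨆ y : ℝ, N₀ (f (y * Complex.I))) (⨆ y : ℝ, N₁ (f (1 + y * Complex.I)))

end Interpolation

/-- The Hilbert norm of `Ωᵏ(U, g)` on classes of measurable `k`-forms on `U`, equal to `∞` off
that space. -/
def omegaNorm {n : ℕ} (k : ℕ) (U : Set (Model n)) (A : Model n → Mat n)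
    (ω : Model n →ₘ[volume.restrict U] Form n k) : ℝ≥0∞ :=
  (normSq k U A ω) ^ (1 / 2 : ℝ)

end LpRiemann

end

noncomputable section

set_option linter.unusedSectionVars false
set_option linter.unusedVariables false
set_option linter.style.haveILetI false
set_option linter.unusedSimpArgs false

namespace LpRiemann

/-! Two positive definite matrices are simultaneously diagonal: A₀ = PᵀP and A₁ = Pᵀ D P, so the
geometric mean is A_t = Pᵀ Dᵗ P. In the corresponding frame the density λᵏ(g_t) μ_{g_t} is a
diagonal Hermitian form on k-forms whose weights are pure powers fᵗ. All that depends on t is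
therefore multiplication by a power of a positive function, and Ωᵏ(U, g_t) is a field of weighted ℂᴺ
with weights fᵗ. `SpectralField` records this abstractly; `exists_coord_formDensity` and
`exists_spectralField` produce it. The diagonalizing coordinates are not chosen measurably: only the
operators fˢ and the norms are, because they have expressions in A₀ and A₁ alone.

Interpolation (`SpectralField.interpNorm_eq`). The function f^((t-z)/2) ω, damped by a Gaussian
factor, bounds the interpolation norm from above. From below, the pairing of a Calderón function
with f^(z/2) ξ is holomorphic, and Phragmén–Lindelöf in the strip bounds it by its values on the two
boundary lines. This is done on sets where the weights are bounded, and these sets exhaust U.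

Exponents. Let `upper` and `lower` be the (nearly) optimal constants in energy ≤ U·|ω|² and |ω|² ≤
L·energy. The inclusions Lᵖ ⊂ Ωᵏ and Ωᵏ ⊂ L^q amount, up to an endpoint, to integrability of powers
of U and L. Inclusions interpolate with reciprocal exponents affine in t, which keeps g_t admissible
and makes 1 - 2/p_k and 2/q_k - 1 convex functions of t. A convex function on [0, 1] can only jump
at the endpoints, and a quantitative extrapolation (`LpSub.extrap`, `SubLp.extrap`) forbids that.
The norms of test forms are continuous in t by dominated convergence. Since the geometric mean is
covariant under congruence (`geomMean_congr`), the charts stay compatible, and the geodesic is a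
continuous path in the space of structures.

Metrizability. The densities in the degrees m and m + 1 determine the matrix
(`eq_of_formDensity_eq`), so the functions separate structures. In each chart a countable family of
test forms already defines the topology (`continuous_normSq_of_testFamily`), so the space embeds in
a countable product of copies of [0, ∞]. -/

/-! ### Simultaneous diagonalization and geometric means of positive definite matrices. -/

open Matrix in
theorem exists_diag_matPow {n : ℕ} {A : Mat n} (hA : A.PosDef) :
    ∃ (O : Mat n) (d : Fin n → ℝ), O * Oᵀ = 1 ∧ Oᵀ * O = 1 ∧ (∀ i, 0 < d i) ∧
      A = O * diagonal d * Oᵀ ∧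
      (∀ s : ℝ, matPow A s = O * diagonal (fun i => d i ^ s) * Oᵀ) := by
  have key : ∀ f : ℝ → ℝ, cfc f A = (hA.1.eigenvectorUnitary : Mat n) *
      diagonal (fun i => f (hA.1.eigenvalues i)) * (hA.1.eigenvectorUnitary : Mat n)ᵀ := by
    intro f
    rw [hA.1.cfc_eq, Matrix.IsHermitian.cfc, Unitary.conjStarAlgAut_apply]
    rfl
  refine ⟨hA.1.eigenvectorUnitary, hA.1.eigenvalues, ?_, ?_, hA.eigenvalues_pos, ?_, ?_⟩
  · exact Unitary.coe_mul_star_self hA.1.eigenvectorUnitary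
  · exact Unitary.coe_star_mul_self hA.1.eigenvectorUnitary
  · have := key id
    rwa [cfc_id ℝ A hA.1.isSelfAdjoint] at this
  · intro s
    exact key _

open Matrix in
theorem matPow_mul {n : ℕ} {A : Mat n} (hA : A.PosDef) (s r : ℝ) :
    matPow A s * matPow A r = matPow A (s + r) := by
  obtain ⟨O, d, h1, h2, hd, -, h⟩ := exists_diag_matPow hA
  rw [h, h, h]
  calc O * diagonal (fun i => d i ^ s) * Oᵀ * (O * diagonal (fun i => d i ^ r) * Oᵀ)
      = O * diagonal (fun i => d i ^ s) * (Oᵀ * O) * diagonal (fun i => d i ^ r) * Oᵀ := by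
        simp only [Matrix.mul_assoc]
    _ = _ := by
        rw [h2, Matrix.mul_one, Matrix.mul_assoc O, diagonal_mul_diagonal]
        congr 3
        ext i
        rw [Real.rpow_add (hd i)]

open Matrix in
theorem matPow_zero {n : ℕ} {A : Mat n} (hA : A.PosDef) : matPow A 0 = 1 := by
  obtain ⟨O, d, h1, h2, hd, -, h⟩ := exists_diag_matPow hA
  simp [h, h1]

open Matrix in
theorem matPow_one {n : ℕ} {A : Mat n} (hA : A.PosDef) : matPow A 1 = A := by
  obtain ⟨O, d, h1, h2, hd, hA', h⟩ := exists_diag_matPow hA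
  rw [h]
  simpa using hA'.symm

open Matrix in
theorem matPow_transpose {n : ℕ} {A : Mat n} (hA : A.PosDef) (s : ℝ) :
    (matPow A s)ᵀ = matPow A s := by
  obtain ⟨O, d, h1, h2, hd, -, h⟩ := exists_diag_matPow hA
  simp [h, Matrix.mul_assoc]

open Matrix in
theorem posDef_transpose_mul_diagonal_mul {n : ℕ} {P : Mat n} (hP : IsUnit P.det)
    {d : Fin n → ℝ} (hd : ∀ i, 0 < d i) : (Pᵀ * diagonal d * P).PosDef := by
  have := (PosDef.diagonal hd).conjTranspose_mul_mul_same (B := P)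
    (Matrix.mulVec_injective_iff_isUnit.2 ((Matrix.isUnit_iff_isUnit_det P).2 hP))
  simpa using this

open Matrix in
theorem isUnit_det_of_mul_eq_one {n : ℕ} {P Q : Mat n} (h : P * Q = 1) : IsUnit P.det :=
  (Matrix.isUnit_iff_isUnit_det P).1 (IsUnit.of_mul_eq_one _ h)

-- Take P = Oᵀ A^{1/2}, where the orthogonal matrix O diagonalizes A^{-1/2} B A^{-1/2}. The
-- definition of the geometric mean is then literally a conjugate of a power of the diagonal.
open Matrix in
theorem exists_simultaneous_diag {n : ℕ} {A B : Mat n} (hA : A.PosDef) (hB : B.PosDef) :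
    ∃ (P : Mat n) (d : Fin n → ℝ), IsUnit P.det ∧ (∀ i, 0 < d i) ∧ A = Pᵀ * P ∧
      B = Pᵀ * diagonal d * P ∧
      ∀ t : ℝ, geomMean A B t = Pᵀ * diagonal (fun i => d i ^ t) * P := by
  have hS : matPow A (1 / 2) * matPow A (-1 / 2) = 1 := by
    rw [matPow_mul hA]; norm_num [matPow_zero hA]
  have hS' : matPow A (-1 / 2) * matPow A (1 / 2) = 1 := by
    rw [matPow_mul hA]; norm_num [matPow_zero hA]
  have hG : (matPow A (-1 / 2) * B * matPow A (-1 / 2)).PosDef := by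
    have := hB.conjTranspose_mul_mul_same (B := matPow A (-1 / 2))
      (Matrix.mulVec_injective_iff_isUnit.2 (IsUnit.of_mul_eq_one _ hS'))
    simpa [matPow_transpose hA] using this
  obtain ⟨O, d, h1, h2, hd, hG', h⟩ := exists_diag_matPow hG
  refine ⟨Oᵀ * matPow A (1 / 2), d, ?_, hd, ?_, ?_, ?_⟩
  · refine isUnit_det_of_mul_eq_one (Q := matPow A (-1 / 2) * O) ?_
    calc Oᵀ * matPow A (1 / 2) * (matPow A (-1 / 2) * O)
        = Oᵀ * (matPow A (1 / 2) * matPow A (-1 / 2)) * O := by simp only [Matrix.mul_assoc]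
      _ = 1 := by rw [hS, Matrix.mul_one, h2]
  · rw [transpose_mul, transpose_transpose, matPow_transpose hA]
    calc A = matPow A (1 / 2) * matPow A (1 / 2) := by
          rw [matPow_mul hA]; norm_num [matPow_one hA]
      _ = matPow A (1 / 2) * (O * Oᵀ) * matPow A (1 / 2) := by rw [h1, Matrix.mul_one]
      _ = _ := by simp only [Matrix.mul_assoc]
  · rw [transpose_mul, transpose_transpose, matPow_transpose hA]
    calc B = (matPow A (1 / 2) * matPow A (-1 / 2)) * B *
          (matPow A (-1 / 2) * matPow A (1 / 2)) := by rw [hS, hS']; simp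
      _ = matPow A (1 / 2) * (matPow A (-1 / 2) * B * matPow A (-1 / 2)) * matPow A (1 / 2) := by
          simp only [Matrix.mul_assoc]
      _ = _ := by rw [hG']; simp only [Matrix.mul_assoc]
  · intro t
    rw [geomMean, h, transpose_mul, transpose_transpose, matPow_transpose hA]
    simp only [Matrix.mul_assoc]

open Matrix in
/-- The value of the geometric mean in any basis that diagonalizes both forms. -/
theorem geomMean_eq_of_diag {n : ℕ} {P : Mat n} {d : Fin n → ℝ} (hP : IsUnit P.det)
    (hd : ∀ i, 0 < d i) (t : ℝ) :
    geomMean (Pᵀ * P) (Pᵀ * diagonal d * P) t = Pᵀ * diagonal (fun i => d i ^ t) * P := by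
  have hA : (Pᵀ * P).PosDef := by
    have := posDef_transpose_mul_diagonal_mul hP (d := fun _ => 1) (fun _ => one_pos)
    simpa using this
  obtain ⟨Q, f, hQ, hf, hAQ, hBQ, h⟩ :=
    exists_simultaneous_diag hA (posDef_transpose_mul_diagonal_mul hP hd)
  rw [h]
  have hPT : IsUnit Pᵀ.det := by rwa [det_transpose]
  -- W compares two bases that diagonalize both forms. It is orthogonal because both are orthonormal
  -- for the first form, and it intertwines the two diagonal matrices.
  set W := Q * P⁻¹ with hW
  have hQW : Q = W * P := by rw [hW, Matrix.mul_assoc, nonsing_inv_mul _ hP, Matrix.mul_one]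
  have hcancel : ∀ X Y : Mat n, Pᵀ * X * P = Pᵀ * Y * P → X = Y := by
    intro X Y hXY
    have h1 := congrArg (fun Z => Z * P⁻¹) hXY
    simp only [mul_nonsing_inv_cancel_right _ _ hP] at h1
    have h2 := congrArg (fun Z => Pᵀ⁻¹ * Z) h1
    simpa only [nonsing_inv_mul_cancel_left _ _ hPT] using h2
  have hWW : Wᵀ * W = 1 := by
    apply hcancel
    rw [Matrix.mul_one, hAQ]
    conv_rhs => rw [hQW, transpose_mul]
    simp only [Matrix.mul_assoc]
  have hWW' : W * Wᵀ = 1 := mul_eq_one_comm.1 hWW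
  have hD : Wᵀ * diagonal f * W = diagonal d := by
    apply hcancel
    rw [hBQ]
    conv_rhs => rw [hQW, transpose_mul]
    simp only [Matrix.mul_assoc]
  have hcomm : diagonal f * W = W * diagonal d := by
    rw [← hD]
    simp only [← Matrix.mul_assoc]
    rw [hWW', Matrix.one_mul]
  -- An entry of W can be nonzero only where the two eigenvalues agree, so W intertwines every
  -- function of the eigenvalues.
  have hcomm' : diagonal (fun i => f i ^ t) * W = W * diagonal (fun i => d i ^ t) := by
    ext i j
    have := congrFun (congrFun hcomm i) j
    rw [diagonal_mul, mul_diagonal] at this ⊢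
    rcases eq_or_ne (W i j) 0 with h0 | h0
    · simp [h0]
    · have : f i = d j := mul_right_cancel₀ h0 (by rw [this, mul_comm])
      rw [this, mul_comm]
  rw [hQW, transpose_mul]
  calc Pᵀ * Wᵀ * diagonal (fun i => f i ^ t) * (W * P)
      = Pᵀ * (Wᵀ * (diagonal (fun i => f i ^ t) * W)) * P := by simp only [Matrix.mul_assoc]
    _ = Pᵀ * ((Wᵀ * W) * diagonal (fun i => d i ^ t)) * P := by
        rw [hcomm']; simp only [Matrix.mul_assoc]
    _ = _ := by rw [hWW, Matrix.one_mul]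

open Matrix in
theorem geomMean_posDef {n : ℕ} {A B : Mat n} (hA : A.PosDef) (hB : B.PosDef) (t : ℝ) :
    (geomMean A B t).PosDef := by
  obtain ⟨P, d, hP, hd, -, -, h⟩ := exists_simultaneous_diag hA hB
  rw [h]
  exact posDef_transpose_mul_diagonal_mul hP fun i => Real.rpow_pos_of_pos (hd i) t

open Matrix in
theorem geomMean_zero {n : ℕ} {A B : Mat n} (hA : A.PosDef) (hB : B.PosDef) :
    geomMean A B 0 = A := by
  obtain ⟨P, d, hP, hd, hA', -, h⟩ := exists_simultaneous_diag hA hB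
  rw [h, hA']
  simp

open Matrix in
theorem geomMean_one {n : ℕ} {A B : Mat n} (hA : A.PosDef) (hB : B.PosDef) :
    geomMean A B 1 = B := by
  obtain ⟨P, d, hP, hd, -, hB', h⟩ := exists_simultaneous_diag hA hB
  rw [h, hB']
  simp

-- If P diagonalizes the pair, then P J diagonalizes the transformed pair with the same eigenvalues.
-- With J a Jacobian matrix, this is the compatibility of geodesics with chart changes.
open Matrix in
theorem geomMean_congr {n : ℕ} {A B J : Mat n} (hA : A.PosDef) (hB : B.PosDef)
    (hJ : IsUnit J.det) (t : ℝ) :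
    geomMean (Jᵀ * A * J) (Jᵀ * B * J) t = Jᵀ * geomMean A B t * J := by
  obtain ⟨P, d, hP, hd, hA', hB', h⟩ := exists_simultaneous_diag hA hB
  have hPJ : IsUnit (P * J).det := by rw [det_mul]; exact hP.mul hJ
  have := geomMean_eq_of_diag hPJ hd t
  rw [h]
  rw [transpose_mul] at this
  rw [hA', hB']
  simpa only [Matrix.mul_assoc] using this

/-! ### Hölder's inequality for weighted sums, and measurability of matrix powers. -/

/-- Weighted Hölder inequality for finite sums. -/
theorem sum_rpow_mul_rpow_le {ι : Type*} (s : Finset ι) {u v : ι → ℝ} (hu : ∀ i ∈ s, 0 ≤ u i)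
    (hv : ∀ i ∈ s, 0 ≤ v i) {t : ℝ} (h0 : 0 ≤ t) (h1 : t ≤ 1) :
    ∑ i ∈ s, u i ^ (1 - t) * v i ^ t ≤ (∑ i ∈ s, u i) ^ (1 - t) * (∑ i ∈ s, v i) ^ t := by
  rcases h0.eq_or_lt with rfl | h0
  · simp
  rcases h1.eq_or_lt with rfl | h1
  · simp
  have := Real.inner_le_Lp_mul_Lq_of_nonneg s (f := fun i => u i ^ (1 - t))
    (g := fun i => v i ^ t) (p := (1 - t)⁻¹) (q := t⁻¹)
    (by constructor <;> first | (simp; done) | (simp; linarith))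
    (fun i hi => Real.rpow_nonneg (hu i hi) _) (fun i hi => Real.rpow_nonneg (hv i hi) _)
  simp only [one_div, inv_inv] at this
  convert this using 3
  · refine Finset.sum_congr rfl fun i hi => ?_
    rw [← Real.rpow_mul (hu i hi), mul_inv_cancel₀ (by linarith), Real.rpow_one]
  · refine Finset.sum_congr rfl fun i hi => ?_
    rw [← Real.rpow_mul (hv i hi), mul_inv_cancel₀ h0.ne', Real.rpow_one]

/-- The matrix powers are pointwise limits, on positive definite matrices, of polynomials. -/
theorem exists_polynomial_tendsto_matPow (s : ℝ) : ∃ p : ℕ → Polynomial ℝ,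
    ∀ {n : ℕ} {A : Mat n}, A.PosDef →
      Tendsto (fun j => Polynomial.aeval A (p j)) atTop (𝓝 (matPow A s)) := by
  -- Weierstrass approximation on intervals that exhaust (0, ∞). The polynomials do not depend on
  -- the matrix, so measurability passes to the limit.
  have hex : ∀ j : ℕ, ∃ p : Polynomial ℝ, ∀ x ∈ Icc (1 / ((j : ℝ) + 1)) ((j : ℝ) + 1),
      |p.eval x - x ^ s| < 1 / ((j : ℝ) + 1) := by
    intro j
    refine exists_polynomial_near_of_continuousOn _ _ (fun x => x ^ s) ?_ _ (by positivity)
    intro x hx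
    exact (Real.continuousAt_rpow_const _ _
      (Or.inl (lt_of_lt_of_le (by positivity) hx.1).ne')).continuousWithinAt
  choose p hp using hex
  have hlim : ∀ x : ℝ, 0 < x → Tendsto (fun j => (p j).eval x) atTop (𝓝 (x ^ s)) := by
    intro x hx
    rw [tendsto_iff_norm_sub_tendsto_zero]
    refine squeeze_zero' (Eventually.of_forall fun _ => norm_nonneg _) ?_
      tendsto_one_div_add_atTop_nhds_zero_nat
    have h1 : ∀ᶠ j : ℕ in atTop, 1 / ((j : ℝ) + 1) ≤ x :=
      (tendsto_one_div_add_atTop_nhds_zero_nat.eventually (Iio_mem_nhds hx)).mono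
        fun j hj => le_of_lt hj
    have h2 : ∀ᶠ j : ℕ in atTop, x ≤ (j : ℝ) + 1 :=
      ((tendsto_natCast_atTop_atTop (R := ℝ)).eventually_ge_atTop x).mono fun j hj => by linarith
    filter_upwards [h1, h2] with j h1 h2
    exact (hp j x ⟨h1, h2⟩).le
  refine ⟨p, fun {n A} hA => ?_⟩
  obtain ⟨O, d, h1, h2, hd, hA', h⟩ := exists_diag_matPow hA
  have hpoly : ∀ q : Polynomial ℝ, Polynomial.aeval A q =
      O * Matrix.diagonal (fun i => q.eval (d i)) * O.transpose := by
    intro q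
    induction q using Polynomial.induction_on' with
    | add q r hq hr =>
      rw [map_add, hq, hr, ← Matrix.add_mul, ← Matrix.mul_add, Matrix.diagonal_add]
      simp
    | monomial m a =>
      have hpow : ∀ m : ℕ, A ^ m = O * Matrix.diagonal (fun i => d i ^ m) * O.transpose := by
        intro m
        induction m with
        | zero => simp [h1]
        | succ m ih =>
          rw [pow_succ, ih]
          conv_lhs => rw [hA']
          calc O * Matrix.diagonal (fun i => d i ^ m) * O.transpose *
                (O * Matrix.diagonal d * O.transpose)
              = O * Matrix.diagonal (fun i => d i ^ m) * (O.transpose * O) *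
                Matrix.diagonal d * O.transpose := by simp only [Matrix.mul_assoc]
            _ = _ := by
              rw [h2, Matrix.mul_one, Matrix.mul_assoc O, Matrix.diagonal_mul_diagonal]
              simp [pow_succ]
      rw [Polynomial.aeval_monomial, hpow, ← Algebra.smul_def]
      have : (fun i => Polynomial.eval (d i) (Polynomial.monomial m a)) =
          a • fun i => d i ^ m := by ext i; simp
      rw [this, Matrix.diagonal_smul]
      simp
  simp only [hpoly, h]
  have hdiag : Tendsto (fun j => Matrix.diagonal (fun i => (p j).eval (d i))) atTop
      (𝓝 (Matrix.diagonal (fun i => d i ^ s))) :=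
    (Continuous.matrix_diagonal continuous_id).continuousAt.tendsto.comp
      (tendsto_pi_nhds.2 fun i => hlim _ (hd i))
  exact (((continuous_const.matrix_mul continuous_id).matrix_mul
    continuous_const).continuousAt.tendsto).comp hdiag

instance {n : ℕ} : TopologicalSpace.PseudoMetrizableSpace (Mat n) :=
  inferInstanceAs (TopologicalSpace.PseudoMetrizableSpace (Fin n → Fin n → ℝ))

theorem aestronglyMeasurable_matPow {X : Type*} [MeasurableSpace X] {μ : Measure X} {n : ℕ}
    {A : X → Mat n} (hA : AEStronglyMeasurable A μ) (hpos : ∀ᵐ x ∂μ, (A x).PosDef) (s : ℝ) :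
    AEStronglyMeasurable (fun x => matPow (A x) s) μ := by
  obtain ⟨p, hp⟩ := exists_polynomial_tendsto_matPow s
  refine aestronglyMeasurable_of_tendsto_ae atTop
    (f := fun j x => Polynomial.aeval (A x) (p j)) (fun j => ?_)
    (hpos.mono fun x hx => hp hx)
  have hc : Continuous fun M : Mat n => Polynomial.aeval M (p j) := by
    simp only [Polynomial.aeval_eq_sum_range]
    exact continuous_finsetSum _ fun i _ => (continuous_pow i).const_smul ((p j).coeff i)
  exact hc.comp_aestronglyMeasurable hA

theorem aestronglyMeasurable_mat_mul {X : Type*} [MeasurableSpace X] {μ : Measure X} {n : ℕ}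
    {A B : X → Mat n} (hA : AEStronglyMeasurable A μ) (hB : AEStronglyMeasurable B μ) :
    AEStronglyMeasurable (fun x => A x * B x) μ :=
  (continuous_fst.matrix_mul continuous_snd).comp_aestronglyMeasurable (hA.prodMk hB)

open Matrix in
theorem aestronglyMeasurable_geomMean {X : Type*} [MeasurableSpace X] {μ : Measure X} {n : ℕ}
    {A B : X → Mat n} (hA : AEStronglyMeasurable A μ) (hB : AEStronglyMeasurable B μ)
    (hApos : ∀ᵐ x ∂μ, (A x).PosDef) (hBpos : ∀ᵐ x ∂μ, (B x).PosDef) (t : ℝ) :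
    AEStronglyMeasurable (fun x => geomMean (A x) (B x) t) μ := by
  unfold geomMean
  have h1 := aestronglyMeasurable_matPow hA hApos (1 / 2)
  have h2 := aestronglyMeasurable_matPow hA hApos (-1 / 2)
  refine aestronglyMeasurable_mat_mul (aestronglyMeasurable_mat_mul h1
    (aestronglyMeasurable_matPow
      (aestronglyMeasurable_mat_mul (aestronglyMeasurable_mat_mul h2 hB) h2) ?_ t)) h1
  filter_upwards [hApos, hBpos] with x hAx hBx
  have hS' : matPow (A x) (-1 / 2) * matPow (A x) (1 / 2) = 1 := by
    rw [matPow_mul hAx]; norm_num [matPow_zero hAx]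
  have := hBx.conjTranspose_mul_mul_same (B := matPow (A x) (-1 / 2))
    (Matrix.mulVec_injective_iff_isUnit.2 (IsUnit.of_mul_eq_one _ hS'))
  simpa [matPow_transpose hAx] using this

/-! ### Coordinates of forms -/

/-- The values of a form on the tuples of columns of a matrix. -/
def formCoord {n k : ℕ} (P : Mat n) : Form n k →ₗ[ℂ] EuclideanSpace ℂ (Fin k → Fin n) where
  toFun ω := WithLp.toLp 2 fun v => ω fun j => WithLp.toLp 2 fun a => P a (v j)
  map_add' _ _ := rfl
  map_smul' _ _ := rfl

theorem formCoord_apply {n k : ℕ} (P : Mat n) (ω : Form n k) (v : Fin k → Fin n) :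
    formCoord P ω v = ω fun j => WithLp.toLp 2 fun a => P a (v j) := rfl

theorem formNormSq_eq {n k : ℕ} (A : Mat n) (ω : Form n k) :
    formNormSq A ω = ((k.factorial : ℝ))⁻¹ * ∑ v, ‖formCoord (matPow A (-1 / 2)) ω v‖ ^ 2 := rfl

theorem formCoord_mul {n k : ℕ} (P W : Mat n) (ω : Form n k) (v : Fin k → Fin n) :
    formCoord (P * W) ω v =
      ∑ u : Fin k → Fin n, ((∏ j, W (u j) (v j) : ℝ) : ℂ) * formCoord P ω u := by
  have h : (fun j => WithLp.toLp 2 fun a => (P * W) a (v j) : Fin k → Model n) =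
      fun j => ∑ b : Fin n, W b (v j) • (WithLp.toLp 2 fun a => P a b : Model n) := by
    funext j
    ext a
    simp [Matrix.mul_apply, mul_comm]
  rw [formCoord_apply, h]
  have h2 := (ω.toContinuousMultilinearMap.toMultilinearMap).map_sum
    (fun (j : Fin k) (b : Fin n) => W b (v j) • (WithLp.toLp 2 fun a => P a b : Model n))
  refine h2.trans (Finset.sum_congr rfl fun u _ => ?_)
  rw [MultilinearMap.map_smul_univ]
  rw [Complex.real_smul]
  rfl

theorem formCoord_mul_diagonal {n k : ℕ} (P : Mat n) (c : Fin n → ℝ) (ω : Form n k)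
    (v : Fin k → Fin n) :
    formCoord (P * Matrix.diagonal c) ω v = ((∏ j, c (v j) : ℝ) : ℂ) * formCoord P ω v := by
  have h : (fun j => WithLp.toLp 2 fun a => (P * Matrix.diagonal c) a (v j) : Fin k → Model n) =
      fun j => c (v j) • (WithLp.toLp 2 fun a => P a (v j) : Model n) := by
    funext j
    ext a
    simp [Matrix.mul_diagonal, mul_comm]
  rw [formCoord_apply, h]
  refine ((ω.toContinuousMultilinearMap.toMultilinearMap).map_smul_univ
    (fun j => c (v j)) _).trans ?_
  rw [Complex.real_smul]
  rfl

/-- The k-th tensor power of an orthogonal matrix is orthogonal, so the sum of squares does not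
change when the frame is rotated. -/
theorem sum_norm_sq_formCoord_mul {n k : ℕ} (P : Mat n) {W : Mat n} (hW : W * W.transpose = 1)
    (ω : Form n k) :
    ∑ v, ‖formCoord (P * W) ω v‖ ^ 2 = ∑ v, ‖formCoord P ω v‖ ^ 2 := by
  have hprod : ∀ u u' : Fin k → Fin n,
      ∑ v : Fin k → Fin n, (∏ j, W (u j) (v j)) * (∏ j, W (u' j) (v j)) =
        if u = u' then (1 : ℝ) else 0 := by
    intro u u'
    calc ∑ v : Fin k → Fin n, (∏ j, W (u j) (v j)) * (∏ j, W (u' j) (v j))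
        = ∑ v : Fin k → Fin n, ∏ j, (W (u j) (v j) * W (u' j) (v j)) := by
          simp only [Finset.prod_mul_distrib]
      _ = ∏ j, ∑ b, W (u j) b * W (u' j) b := by
          rw [Finset.prod_univ_sum, Fintype.piFinset_univ]
      _ = ∏ j, (W * W.transpose) (u j) (u' j) := by simp [Matrix.mul_apply]
      _ = ∏ j, if u j = u' j then (1 : ℝ) else 0 := by simp [hW, Matrix.one_apply]
      _ = _ := by
          split_ifs with h
          · simp [h]
          · obtain ⟨j, hj⟩ := Function.ne_iff.1 h
            exact Finset.prod_eq_zero (Finset.mem_univ j) (by simp [hj])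
  have hsq : ∀ z : ℂ, ((‖z‖ ^ 2 : ℝ) : ℂ) = z * (starRingEnd ℂ) z := fun z => by
    rw [Complex.mul_conj, Complex.normSq_eq_norm_sq]
  rw [← Complex.ofReal_inj]
  simp only [Complex.ofReal_sum, hsq, formCoord_mul, map_sum, map_mul, Complex.conj_ofReal,
    Finset.sum_mul_sum]
  rw [Finset.sum_comm]
  refine Finset.sum_congr rfl fun u _ => ?_
  rw [Finset.sum_comm]
  have : ∀ u' : Fin k → Fin n, ∑ v : Fin k → Fin n,
      ((∏ j, W (u j) (v j) : ℝ) : ℂ) * formCoord P ω u *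
        (((∏ j, W (u' j) (v j) : ℝ) : ℂ) * (starRingEnd ℂ) (formCoord P ω u')) =
      ((if u = u' then (1 : ℝ) else 0 : ℝ) : ℂ) *
        (formCoord P ω u * (starRingEnd ℂ) (formCoord P ω u')) := by
    intro u'
    rw [← hprod u u', Complex.ofReal_sum, Finset.sum_mul]
    refine Finset.sum_congr rfl fun v _ => ?_
    rw [Complex.ofReal_mul]
    ring
  rw [Finset.sum_congr rfl fun u' _ => this u', Finset.sum_eq_single u]
  · rw [if_pos rfl, Complex.ofReal_one, one_mul]
  · intro u' _ hu'
    rw [if_neg (Ne.symm hu'), Complex.ofReal_zero, zero_mul]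
  · simp

/-- The pull-back of forms by a matrix. -/
def pullForm {n k : ℕ} (R : Mat n) : Form n k →ₗ[ℂ] Form n k where
  toFun ω := ω.compContinuousLinearMap (Matrix.toEuclideanCLM (n := Fin n) (𝕜 := ℝ) R)
  map_add' _ _ := rfl
  map_smul' _ _ := rfl

theorem formCoord_pullForm {n k : ℕ} (P R : Mat n) (ω : Form n k) :
    formCoord P (pullForm R ω) = formCoord (R * P) ω := by
  ext v
  rw [formCoord_apply, formCoord_apply]
  change ω _ = ω _
  congr 1

theorem formCoord_injective {n k : ℕ} {P : Mat n} (hP : IsUnit P.det) :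
    Function.Injective (formCoord (k := k) P) := by
  rw [← LinearMap.ker_eq_bot, LinearMap.ker_eq_bot']
  intro ω h
  have h1 : formCoord (P * P⁻¹) ω = 0 := by
    ext v
    rw [formCoord_mul]
    simp [h]
  rw [Matrix.mul_nonsing_inv _ hP] at h1
  have h2 : ω.toAlternatingMap = 0 := by
    refine Module.Basis.ext_alternating (EuclideanSpace.basisFun (Fin n) ℝ).toBasis fun v _ => ?_
    have := congrArg (fun f => f v) h1
    simp only [formCoord_apply] at this
    refine Eq.trans ?_ this
    change ω _ = ω _
    congr 1
    funext j
    ext a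
    simp [Matrix.one_apply]
  ext w
  exact congrArg (fun f => f w) h2

instance {n k : ℕ} : FiniteDimensional ℂ (Form n k) :=
  FiniteDimensional.of_injective (formCoord (n := n) (k := k) 1)
    (formCoord_injective (by simp))

/-- The density of `‖ω‖²_g` with respect to Lebesgue measure. -/
def formDensity {n k : ℕ} (A : Mat n) (ω : Form n k) : ℝ :=
  formNormSq A ω * Real.sqrt A.det

/-- The columns of R⁻¹ form another orthonormal frame for RᵀR: they differ from those of
(RᵀR)^{-1/2} by the orthogonal matrix R (RᵀR)^{-1/2}. This frees the norm from the square root in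
its definition. -/
theorem formNormSq_transpose_mul_self {n k : ℕ} {R : Mat n} (hR : IsUnit R.det) (ω : Form n k) :
    formNormSq (R.transpose * R) ω =
      ((k.factorial : ℝ))⁻¹ * ∑ v, ‖formCoord R⁻¹ ω v‖ ^ 2 := by
  have hA : (R.transpose * R).PosDef := by
    have := posDef_transpose_mul_diagonal_mul hR (d := fun _ => 1) (fun _ => one_pos)
    simpa using this
  set S := matPow (R.transpose * R) (-1 / 2) with hS
  have hSAS : S * (R.transpose * R) * S = 1 := by
    have h1 : S * (R.transpose * R) = matPow (R.transpose * R) (1 / 2) := by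
      conv_lhs => rw [hS]
      nth_rewrite 2 [← matPow_one hA]
      rw [matPow_mul hA]
      norm_num
    rw [h1, hS, matPow_mul hA]
    norm_num [matPow_zero hA]
  have hW : (R * S) * (R * S).transpose = 1 := by
    rw [mul_eq_one_comm, Matrix.transpose_mul, hS, matPow_transpose hA, ← hS]
    simpa only [Matrix.mul_assoc] using hSAS
  rw [formNormSq_eq, ← hS]
  have h : S = R⁻¹ * (R * S) := by
    rw [← Matrix.mul_assoc, Matrix.nonsing_inv_mul _ hR, Matrix.one_mul]
  conv_lhs => rw [h]
  rw [sum_norm_sq_formCoord_mul _ hW]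

/-- Use R = D^{t/2} P as square root of the matrix. The frame contributes the inverse product of the
d's in v and the volume contributes the square root of the full product, both to the power t. The
dependence on t is thus a pure power of one weight per multi-index. -/
theorem formDensity_transpose_diagonal {n k : ℕ} {P : Mat n} {d : Fin n → ℝ}
    (hP : IsUnit P.det) (hd : ∀ i, 0 < d i) (t : ℝ) (ω : Form n k) :
    formDensity (P.transpose * Matrix.diagonal (fun i => d i ^ t) * P) ω =
      ∑ v : Fin k → Fin n, ((∏ j, d (v j))⁻¹ * (∏ i, d i) ^ (1 / 2 : ℝ)) ^ t *
        ‖(Real.sqrt (((k.factorial : ℝ))⁻¹ * |P.det|) : ℂ) * formCoord P⁻¹ ω v‖ ^ 2 := by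
  set R : Mat n := Matrix.diagonal (fun i => d i ^ (t / 2)) * P with hRdef
  have hdet : (Matrix.diagonal (fun i => d i ^ (t / 2))).det = (∏ i, d i) ^ (t / 2) := by
    rw [Matrix.det_diagonal, Real.finsetProd_rpow _ _ fun i _ => (hd i).le]
  have hprod : 0 < ∏ i, d i := Finset.prod_pos fun i _ => hd i
  have hR : IsUnit R.det := by
    rw [hRdef, Matrix.det_mul, hdet]
    exact (Ne.isUnit (Real.rpow_pos_of_pos hprod _).ne').mul hP
  have hA : P.transpose * Matrix.diagonal (fun i => d i ^ t) * P = R.transpose * R := by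
    rw [hRdef, Matrix.transpose_mul, Matrix.diagonal_transpose]
    calc P.transpose * Matrix.diagonal (fun i => d i ^ t) * P
        = P.transpose * (Matrix.diagonal (fun i => d i ^ (t / 2)) *
            Matrix.diagonal (fun i => d i ^ (t / 2))) * P := by
          rw [Matrix.diagonal_mul_diagonal]
          congr 3
          funext i
          rw [← Real.rpow_add (hd i), add_halves]
      _ = _ := by simp only [Matrix.mul_assoc]
  have hRinv : R⁻¹ = P⁻¹ * Matrix.diagonal (fun i => d i ^ (-(t / 2))) := by
    refine Matrix.inv_eq_left_inv ?_
    calc P⁻¹ * Matrix.diagonal (fun i => d i ^ (-(t / 2))) * R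
        = P⁻¹ * (Matrix.diagonal (fun i => d i ^ (-(t / 2))) *
          Matrix.diagonal (fun i => d i ^ (t / 2))) * P := by
          rw [hRdef]; simp only [Matrix.mul_assoc]
      _ = 1 := by
        rw [Matrix.diagonal_mul_diagonal]
        simp only [← Real.rpow_add (hd _), neg_add_cancel, Real.rpow_zero]
        rw [Matrix.diagonal_one, Matrix.mul_one, Matrix.nonsing_inv_mul _ hP]
  have hsqrt : Real.sqrt (R.transpose * R).det = |P.det| * (∏ i, d i) ^ (t / 2) := by
    rw [Matrix.det_mul, Matrix.det_transpose, Real.sqrt_mul_self_eq_abs, hRdef, Matrix.det_mul,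
      hdet, abs_mul, abs_of_pos (Real.rpow_pos_of_pos hprod _), mul_comm]
  rw [formDensity, hA, formNormSq_transpose_mul_self hR, hsqrt, Finset.mul_sum, Finset.sum_mul]
  refine Finset.sum_congr rfl fun v _ => ?_
  have hv : 0 < ∏ j, d (v j) := Finset.prod_pos fun i _ => hd _
  rw [hRinv, formCoord_mul_diagonal, norm_mul, norm_mul, Complex.norm_real, Complex.norm_real,
    mul_pow, mul_pow, Real.norm_eq_abs, Real.norm_eq_abs, sq_abs, sq_abs, Real.sq_sqrt (by positivity),
    Real.finsetProd_rpow _ _ fun i _ => (hd _).le,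
    Real.mul_rpow (by positivity) (by positivity), ← Real.rpow_mul hprod.le,
    Real.inv_rpow hv.le, ← Real.rpow_neg hv.le, ← Real.rpow_natCast, ← Real.rpow_mul hv.le]
  have h1 : -(t / 2) * ((2 : ℕ) : ℝ) = -t := by push_cast; ring
  have h2 : 1 / 2 * t = t / 2 := by ring
  rw [h1, h2]
  ring

/-- A multiplier family on a subspace of `ℂᴵ` is diagonal in an orthonormal basis. -/
theorem exists_diagonal_coord {F I : Type*} [AddCommGroup F] [Module ℂ F] [FiniteDimensional ℂ F]
    [Fintype I] (c : F →ₗ[ℂ] EuclideanSpace ℂ I) (hc : Function.Injective c) (e : I → ℝ)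
    (he : ∀ v, 0 < e v) (T : ℝ → F →ₗ[ℂ] F)
    (hT : ∀ s ω v, c (T s ω) v = ((e v ^ s : ℝ) : ℂ) * c ω v) :
    ∃ (b : F ≃ₗ[ℂ] EuclideanSpace ℂ (Fin (Module.finrank ℂ F)))
      (f : Fin (Module.finrank ℂ F) → ℝ), (∀ j, 0 < f j) ∧
      (∀ s ω j, b (T s ω) j = ((f j ^ s : ℝ) : ℂ) * b ω j) ∧ ∀ ω, ‖b ω‖ = ‖c ω‖ := by
  let c' : F ≃ₗ[ℂ] LinearMap.range c := LinearEquiv.ofInjective c hc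
  -- F sits in ℂᴵ as a possibly proper subspace, so the coordinates of ℂᴵ are redundant on it. The
  -- subspace is stable under multiplication by e, whose restriction is symmetric; its eigenvectors
  -- give honest coordinates.
  let S : LinearMap.range c →ₗ[ℂ] LinearMap.range c := c'.toLinearMap ∘ₗ T 1 ∘ₗ c'.symm.toLinearMap
  have hc'coe : ∀ ω, ((c' ω : LinearMap.range c) : EuclideanSpace ℂ I) = c ω := fun ω => rfl
  have hS : ∀ (u : LinearMap.range c) v, (S u : EuclideanSpace ℂ I) v =
      (e v : ℂ) * (u : EuclideanSpace ℂ I) v := by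
    intro u v
    obtain ⟨ω, rfl⟩ := c'.surjective u
    have : S (c' ω) = c' (T 1 ω) := by simp [S]
    rw [this, hc'coe, hc'coe, hT, Real.rpow_one]
  have hsymm : LinearMap.IsSymmetric (𝕜 := ℂ) (E := LinearMap.range c) S := by
    intro u w
    rw [Submodule.coe_inner, Submodule.coe_inner, PiLp.inner_apply, PiLp.inner_apply]
    refine Finset.sum_congr rfl fun v _ => ?_
    rw [hS, hS]
    simp only [RCLike.inner_apply, map_mul, Complex.conj_ofReal]
    ring
  have hfr : Module.finrank ℂ (LinearMap.range c) = Module.finrank ℂ F := c'.symm.finrank_eq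
  let u := hsymm.eigenvectorBasis hfr
  let f := hsymm.eigenvalues hfr
  have hu : ∀ j v, (e v : ℂ) * (u j : EuclideanSpace ℂ I) v =
      (f j : ℂ) * (u j : EuclideanSpace ℂ I) v := by
    intro j v
    rw [← hS, hsymm.apply_eigenvectorBasis hfr j]
    rfl
  -- An eigenvector lives on the indices where e equals its eigenvalue, hence it is an eigenvector
  -- of all the powers at once.
  have hef : ∀ j v, (u j : EuclideanSpace ℂ I) v ≠ 0 → e v = f j := by
    intro j v h
    exact Complex.ofReal_injective (mul_right_cancel₀ h (hu j v))
  refine ⟨c'.trans u.repr.toLinearEquiv, f, ?_, ?_, ?_⟩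
  · intro j
    have hne : (u j : EuclideanSpace ℂ I) ≠ 0 := by
      have := u.orthonormal.ne_zero j
      exact fun h => this (Subtype.ext h)
    obtain ⟨v, hv⟩ : ∃ v, (u j : EuclideanSpace ℂ I) v ≠ 0 := by
      by_contra! h
      exact hne (by ext v; simpa using h v)
    rw [← hef j v hv]
    exact he v
  · intro s ω j
    change u.repr (c' (T s ω)) j = _ * u.repr (c' ω) j
    rw [OrthonormalBasis.repr_apply_apply, OrthonormalBasis.repr_apply_apply,
      Submodule.coe_inner, Submodule.coe_inner, PiLp.inner_apply, PiLp.inner_apply,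
      Finset.mul_sum]
    refine Finset.sum_congr rfl fun v _ => ?_
    rw [hc'coe, hc'coe, hT]
    rcases eq_or_ne ((u j : EuclideanSpace ℂ I) v) 0 with h0 | h0
    · simp [h0]
    · rw [hef j v h0]
      simp only [RCLike.inner_apply]
      ring
  · intro ω
    change ‖u.repr (c' ω)‖ = _
    rw [LinearIsometryEquiv.norm_map]
    rfl

/-- The multiplier taking `g₀` to `g_s`. -/
def formMultiplier {n k : ℕ} (A B : Mat n) (s : ℝ) : Form n k →ₗ[ℂ] Form n k :=
  (((B.det / A.det) ^ (s / 2) : ℝ) : ℂ) • pullForm ((geomMean A B s)⁻¹ * A)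

/-- The forms `λᵏ(g_t) μ_{g_t}` are simultaneously diagonal. -/
theorem exists_coord_formDensity {n k : ℕ} {A B : Mat n} (hA : A.PosDef) (hB : B.PosDef) :
    ∃ (b : Form n k ≃ₗ[ℂ] EuclideanSpace ℂ (Fin (Module.finrank ℂ (Form n k))))
      (f : Fin (Module.finrank ℂ (Form n k)) → ℝ), (∀ j, 0 < f j) ∧
      (∀ s ω j, b (formMultiplier A B s ω) j = ((f j ^ s : ℝ) : ℂ) * b ω j) ∧
      ∀ t ω, formDensity (geomMean A B t) ω = ∑ j, f j ^ t * ‖b ω j‖ ^ 2 := by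
  obtain ⟨P, d, hP, hd, hA', hB', h⟩ := exists_simultaneous_diag hA hB
  have hPT : IsUnit P.transpose.det := by rwa [Matrix.det_transpose]
  have hprod : 0 < ∏ i, d i := Finset.prod_pos fun i _ => hd i
  set κ : ℝ := Real.sqrt (((k.factorial : ℝ))⁻¹ * |P.det|) with hκ
  have hκ0 : (κ : ℂ) ≠ 0 := by
    have : 0 < |P.det| := abs_pos.2 hP.ne_zero
    have : 0 < κ := Real.sqrt_pos.2 (by positivity)
    exact_mod_cast this.ne'
  let e : (Fin k → Fin n) → ℝ := fun v => (∏ j, d (v j))⁻¹ * (∏ i, d i) ^ (1 / 2 : ℝ)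
  have he : ∀ v, 0 < e v := fun v => mul_pos (inv_pos.2 (Finset.prod_pos fun i _ => hd _))
    (Real.rpow_pos_of_pos hprod _)
  let c : Form n k →ₗ[ℂ] EuclideanSpace ℂ (Fin k → Fin n) := (κ : ℂ) • formCoord P⁻¹
  have hPi : IsUnit P⁻¹.det := by
    rw [Matrix.det_nonsing_inv]; simpa using hP
  have hc : Function.Injective c := by
    intro ω ω' hω
    exact formCoord_injective hPi (smul_right_injective _ hκ0 hω)
  have hT : ∀ s ω v, c (formMultiplier A B s ω) v = ((e v ^ s : ℝ) : ℂ) * c ω v := by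
    intro s ω v
    -- In the frame P⁻¹ the matrix A_s⁻¹ A acts as D^{-s}. The multiplier, defined without any
    -- choice of P, is therefore diagonal there.
    have hinv : (geomMean A B s)⁻¹ * A * P⁻¹ =
        P⁻¹ * Matrix.diagonal (fun i => d i ^ (-s)) := by
      have hG : (geomMean A B s)⁻¹ =
          P⁻¹ * Matrix.diagonal (fun i => d i ^ (-s)) * P.transpose⁻¹ := by
        refine Matrix.inv_eq_left_inv ?_
        rw [h]
        calc P⁻¹ * Matrix.diagonal (fun i => d i ^ (-s)) * P.transpose⁻¹ *
              (P.transpose * Matrix.diagonal (fun i => d i ^ s) * P)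
            = P⁻¹ * (Matrix.diagonal (fun i => d i ^ (-s)) * (P.transpose⁻¹ *
              P.transpose) * Matrix.diagonal (fun i => d i ^ s)) * P := by
              simp only [Matrix.mul_assoc]
          _ = 1 := by
            rw [Matrix.nonsing_inv_mul _ hPT, Matrix.mul_one, Matrix.diagonal_mul_diagonal]
            simp only [← Real.rpow_add (hd _), neg_add_cancel, Real.rpow_zero]
            rw [Matrix.diagonal_one, Matrix.mul_one, Matrix.nonsing_inv_mul _ hP]
      rw [hG]
      nth_rewrite 1 [hA']
      calc P⁻¹ * Matrix.diagonal (fun i => d i ^ (-s)) * P.transpose⁻¹ * (P.transpose * P) * P⁻¹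
          = P⁻¹ * Matrix.diagonal (fun i => d i ^ (-s)) * (P.transpose⁻¹ * P.transpose) *
            (P * P⁻¹) := by simp only [Matrix.mul_assoc]
        _ = _ := by
          rw [Matrix.nonsing_inv_mul _ hPT, Matrix.mul_nonsing_inv _ hP, Matrix.mul_one,
            Matrix.mul_one]
    have hdetq : B.det / A.det = ∏ i, d i := by
      rw [hA', hB']
      simp only [Matrix.det_mul, Matrix.det_diagonal, Matrix.det_transpose]
      have := hP.ne_zero
      field_simp
    have h1 : formCoord P⁻¹ (formMultiplier A B s ω) v =
        (((B.det / A.det) ^ (s / 2) : ℝ) : ℂ) *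
          formCoord ((geomMean A B s)⁻¹ * A * P⁻¹) ω v := by
      rw [← formCoord_pullForm, formMultiplier, LinearMap.smul_apply, map_smul]
      rfl
    change (κ : ℂ) * formCoord P⁻¹ (formMultiplier A B s ω) v =
      ((e v ^ s : ℝ) : ℂ) * ((κ : ℂ) * formCoord P⁻¹ ω v)
    rw [h1, hinv, formCoord_mul_diagonal, hdetq]
    have hv : 0 < ∏ j, d (v j) := Finset.prod_pos fun i _ => hd _
    have h2 : e v ^ s = (∏ i, d i) ^ (s / 2) * ∏ j, d (v j) ^ (-s) := by
      rw [Real.finsetProd_rpow _ _ fun i _ => (hd _).le]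
      simp only [e]
      rw [Real.mul_rpow (by positivity) (by positivity), ← Real.rpow_mul hprod.le,
        Real.inv_rpow hv.le, ← Real.rpow_neg hv.le, mul_comm]
      congr 2
      ring
    rw [h2]
    push_cast
    ring
  have hdens : ∀ t ω, formDensity (geomMean A B t) ω = ∑ v, e v ^ t * ‖c ω v‖ ^ 2 := by
    intro t ω
    rw [h]
    exact formDensity_transpose_diagonal hP hd t ω
  obtain ⟨b, f, hf, hbT, hbc⟩ := exists_diagonal_coord c hc e he (formMultiplier A B) hT
  refine ⟨b, f, hf, hbT, fun t ω => ?_⟩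
  -- The density at t is the squared norm after applying the multiplier of exponent t/2. Since b and
  -- c give the same norm, the formula passes from the redundant multi-indices to the coordinates b.
  have h3 := hbc (formMultiplier A B (t / 2) ω)
  have hpow : ∀ x : ℝ, 0 < x → (x ^ (t / 2)) ^ 2 = x ^ t := by
    intro x hx
    rw [← Real.rpow_natCast, ← Real.rpow_mul hx.le]
    congr 1
    push_cast
    ring
  rw [hdens]
  calc ∑ v, e v ^ t * ‖c ω v‖ ^ 2 = ‖c (formMultiplier A B (t / 2) ω)‖ ^ 2 := by
        rw [EuclideanSpace.norm_sq_eq]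
        refine Finset.sum_congr rfl fun v _ => ?_
        rw [hT, norm_mul, mul_pow, Complex.norm_real, Real.norm_eq_abs, sq_abs, hpow _ (he v)]
    _ = ‖b (formMultiplier A B (t / 2) ω)‖ ^ 2 := by rw [hbc]
    _ = _ := by
        rw [EuclideanSpace.norm_sq_eq]
        refine Finset.sum_congr rfl fun v _ => ?_
        rw [hbT, norm_mul, mul_pow, Complex.norm_real, Real.norm_eq_abs, sq_abs, hpow _ (hf v)]

/-! ### Measurable fields of simultaneously diagonal Hermitian forms -/

/-- A measurable field of pairs of Hermitian norms on `E`, given by coordinates in which both are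
diagonal: the first one is the Euclidean norm and the second one has the weights `eig`. -/
structure SpectralField {X : Type*} [MeasurableSpace X] (μ : Measure X) (E : Type*)
    [NormedAddCommGroup E] [NormedSpace ℂ E] (N : ℕ) where
  /-- the diagonalizing coordinates -/
  coord : X → E ≃ₗ[ℂ] EuclideanSpace ℂ (Fin N)
  /-- the weights -/
  eig : X → Fin N → ℝ
  eig_pos : ∀ x j, 0 < eig x j
  -- The coordinates and weights may be chosen point by point without measurability. Only what does
  -- not depend on that choice, the powers of the operator and the norm, is required to be
  -- measurable.
  meas_rpow : ∀ (s : ℝ) (η : X → E), AEStronglyMeasurable η μ → AEStronglyMeasurable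
    (fun x => (coord x).symm (WithLp.toLp 2 fun j => ((eig x j ^ s : ℝ) : ℂ) * coord x (η x) j)) μ
  meas_energy : ∀ η : X → E, AEStronglyMeasurable η μ →
    AEMeasurable (fun x => ‖coord x (η x)‖ ^ 2) μ

namespace SpectralField

variable {X : Type*} [MeasurableSpace X] {μ : Measure X} {E : Type*} [NormedAddCommGroup E]
  [NormedSpace ℂ E] {N : ℕ} (D : SpectralField μ E N)

/-- The operator that multiplies the `j`-th coordinate by `φ (eig j)`. -/
def mult (φ : ℝ → ℂ) (x : X) (ω : E) : E :=
  (D.coord x).symm (WithLp.toLp 2 fun j => φ (D.eig x j) * D.coord x ω j)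

/-- The Hermitian norms `Σ eig_jᵗ |ω_j|²` interpolating between the two given ones. -/
def energy (t : ℝ) (x : X) (ω : E) : ℝ := ∑ j, D.eig x j ^ t * ‖D.coord x ω j‖ ^ 2

@[simp] theorem coord_mult (φ : ℝ → ℂ) (x : X) (ω : E) (j : Fin N) :
    D.coord x (D.mult φ x ω) j = φ (D.eig x j) * D.coord x ω j := by
  simp [mult]

theorem coord_ext {x : X} {ω ω' : E} (h : ∀ j, D.coord x ω j = D.coord x ω' j) : ω = ω' :=
  (D.coord x).injective (by ext j; exact h j)

theorem energy_nonneg (t : ℝ) (x : X) (ω : E) : 0 ≤ D.energy t x ω :=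
  Finset.sum_nonneg fun j _ => mul_nonneg (Real.rpow_nonneg (D.eig_pos x j).le _) (sq_nonneg _)

theorem energy_zero_exp (x : X) (ω : E) : D.energy 0 x ω = ‖D.coord x ω‖ ^ 2 := by
  simp [energy, EuclideanSpace.norm_sq_eq]

theorem energy_pos (t : ℝ) (x : X) {ω : E} (hω : ω ≠ 0) : 0 < D.energy t x ω := by
  obtain ⟨j, hj⟩ : ∃ j, D.coord x ω j ≠ 0 := by
    by_contra! h
    exact hω (D.coord_ext (ω' := 0) (by simpa using h))
  refine Finset.sum_pos' (fun j _ => mul_nonneg (Real.rpow_nonneg (D.eig_pos x j).le _)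
    (sq_nonneg _)) ⟨j, Finset.mem_univ j, ?_⟩
  have := Real.rpow_pos_of_pos (D.eig_pos x j) t
  have := norm_pos_iff.2 hj
  positivity

theorem energy_smul (t : ℝ) (x : X) (c : ℂ) (ω : E) :
    D.energy t x (c • ω) = ‖c‖ ^ 2 * D.energy t x ω := by
  simp only [energy, Finset.mul_sum]
  refine Finset.sum_congr rfl fun j _ => ?_
  simp [mul_pow]
  ring

theorem energy_mult (t : ℝ) (φ : ℝ → ℂ) (x : X) (ω : E) :
    D.energy t x (D.mult φ x ω) =
      ∑ j, D.eig x j ^ t * ‖φ (D.eig x j)‖ ^ 2 * ‖D.coord x ω j‖ ^ 2 := by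
  simp only [energy, coord_mult, norm_mul, mul_pow]
  exact Finset.sum_congr rfl fun j _ => by ring

theorem energy_mult_rpow (t s : ℝ) (x : X) (ω : E) :
    D.energy t x (D.mult (fun r => ((r ^ s : ℝ) : ℂ)) x ω) = D.energy (t + 2 * s) x ω := by
  rw [energy_mult, energy]
  refine Finset.sum_congr rfl fun j _ => ?_
  have h := D.eig_pos x j
  rw [Complex.norm_real, Real.norm_eq_abs, sq_abs, ← Real.rpow_natCast (D.eig x j ^ s),
    ← Real.rpow_mul h.le, ← Real.rpow_add h]
  congr 3
  push_cast
  ring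

/-- Everything is diagonal, so an inequality between operators follows from a scalar inequality in
the weight r. -/
theorem energy_mult_le (t : ℝ) {φ : ℝ → ℂ} {C s : ℝ} (x : X) (ω : E)
    (h : ∀ r : ℝ, 0 < r → r ^ t * ‖φ r‖ ^ 2 ≤ C * r ^ s) :
    D.energy t x (D.mult φ x ω) ≤ C * D.energy s x ω := by
  rw [energy_mult, energy, Finset.mul_sum]
  refine Finset.sum_le_sum fun j _ => ?_
  rw [← mul_assoc]
  exact mul_le_mul_of_nonneg_right (h _ (D.eig_pos x j)) (sq_nonneg _)

/-! #### Multipliers that preserve measurability -/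

/-- `φ` acts on measurable fields. -/
def IsMeasMultiplier (φ : ℝ → ℂ) : Prop :=
  ∀ η : X → E, AEStronglyMeasurable η μ → AEStronglyMeasurable (fun x => D.mult φ x (η x)) μ

variable {D}

theorem isMeasMultiplier_rpow (s : ℝ) : D.IsMeasMultiplier fun r => ((r ^ s : ℝ) : ℂ) :=
  D.meas_rpow s

theorem isMeasMultiplier_const (c : ℂ) : D.IsMeasMultiplier fun _ => c := by
  intro η hη
  have : (fun x => D.mult (fun _ => c) x (η x)) = fun x => c • η x := by
    funext x
    exact D.coord_ext (x := x) fun j => by simp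
  rw [this]
  exact hη.const_smul c

theorem IsMeasMultiplier.add {φ ψ : ℝ → ℂ} (hφ : D.IsMeasMultiplier φ)
    (hψ : D.IsMeasMultiplier ψ) : D.IsMeasMultiplier fun r => φ r + ψ r := by
  intro η hη
  have : (fun x => D.mult (fun r => φ r + ψ r) x (η x)) =
      fun x => D.mult φ x (η x) + D.mult ψ x (η x) := by
    funext x
    exact D.coord_ext (x := x) fun j => by simp [add_mul]
  rw [this]
  exact (hφ η hη).add (hψ η hη)

theorem IsMeasMultiplier.mul {φ ψ : ℝ → ℂ} (hφ : D.IsMeasMultiplier φ)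
    (hψ : D.IsMeasMultiplier ψ) : D.IsMeasMultiplier fun r => φ r * ψ r := by
  intro η hη
  have : (fun x => D.mult (fun r => φ r * ψ r) x (η x)) =
      fun x => D.mult φ x (D.mult ψ x (η x)) := by
    funext x
    exact D.coord_ext (x := x) fun j => by simp [mul_assoc]
  rw [this]
  exact hφ _ (hψ η hη)

theorem IsMeasMultiplier.congr {φ ψ : ℝ → ℂ} (hφ : D.IsMeasMultiplier φ)
    (h : ∀ r, 0 < r → φ r = ψ r) : D.IsMeasMultiplier ψ := by
  intro η hη
  have : (fun x => D.mult ψ x (η x)) = fun x => D.mult φ x (η x) := by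
    funext x
    exact D.coord_ext (x := x) fun j => by simp [h _ (D.eig_pos x j)]
  rw [this]
  exact hφ η hη

/-- At each point the operators act on finitely many coordinates, so convergence of the symbols
gives convergence of the fields. Starting from real powers, sums, products and limits then yield the
logarithm and exponentials. -/
theorem IsMeasMultiplier.of_tendsto {φ : ℕ → ℝ → ℂ} {ψ : ℝ → ℂ}
    (hφ : ∀ m, D.IsMeasMultiplier (φ m))
    (h : ∀ r, 0 < r → Tendsto (fun m => φ m r) atTop (𝓝 (ψ r))) : D.IsMeasMultiplier ψ := by
  intro η hη
  refine aestronglyMeasurable_of_tendsto_ae atTop (fun m => hφ m η hη)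
    (Eventually.of_forall fun x => ?_)
  have hc : Continuous (D.coord x).symm.toLinearMap := LinearMap.continuous_of_finiteDimensional _
  refine (hc.comp (PiLp.continuous_toLp 2 _)).continuousAt.tendsto.comp
    (tendsto_pi_nhds.2 fun j => ?_)
  exact (h _ (D.eig_pos x j)).mul_const _

theorem IsMeasMultiplier.pow {φ : ℝ → ℂ} (hφ : D.IsMeasMultiplier φ) (m : ℕ) :
    D.IsMeasMultiplier fun r => φ r ^ m := by
  induction m with
  | zero => simpa using isMeasMultiplier_const (D := D) 1
  | succ m ih => simpa only [pow_succ] using ih.mul hφ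

theorem IsMeasMultiplier.sum {φ : ℕ → ℝ → ℂ} (hφ : ∀ m, D.IsMeasMultiplier (φ m)) (M : ℕ) :
    D.IsMeasMultiplier fun r => ∑ m ∈ Finset.range M, φ m r := by
  induction M with
  | zero => simpa using isMeasMultiplier_const (D := D) 0
  | succ M ih => simpa only [Finset.sum_range_succ] using ih.add (hφ M)

theorem IsMeasMultiplier.cexp {φ : ℝ → ℂ} (hφ : D.IsMeasMultiplier φ) :
    D.IsMeasMultiplier fun r => Complex.exp (φ r) := by
  refine IsMeasMultiplier.of_tendsto
    (φ := fun M r => ∑ m ∈ Finset.range M, φ r ^ m * ((m.factorial : ℂ))⁻¹)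
    (fun M => IsMeasMultiplier.sum (fun m => (hφ.pow m).mul (isMeasMultiplier_const _)) M)
    fun r _ => ?_
  have := (NormedSpace.expSeries_div_hasSum_exp (φ r)).tendsto_sum_nat
  rw [Complex.exp_eq_exp_ℂ]
  simpa only [div_eq_mul_inv] using this

/-- The logarithm is the derivative of s ↦ rˢ at 0, a limit of difference quotients of real powers.
-/
theorem isMeasMultiplier_log : D.IsMeasMultiplier fun r => (Real.log r : ℂ) := by
  refine IsMeasMultiplier.of_tendsto
    (φ := fun m r => ((((m : ℝ) + 1 : ℝ) : ℂ)) *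
      (((r ^ (1 / ((m : ℝ) + 1)) : ℝ) : ℂ) + (-1)))
    (fun m => (isMeasMultiplier_const _).mul
      ((isMeasMultiplier_rpow _).add (isMeasMultiplier_const _)))
    fun r hr => ?_
  have h1 := (Real.hasStrictDerivAt_const_rpow hr 0).hasDerivAt.tendsto_slope_zero_right
  have h2 : Tendsto (fun m : ℕ => 1 / ((m : ℝ) + 1)) atTop (𝓝[>] 0) :=
    tendsto_nhdsWithin_iff.2 ⟨tendsto_one_div_add_atTop_nhds_zero_nat,
      Eventually.of_forall fun m => mem_Ioi.2 (by positivity)⟩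
  have h3 := (Complex.continuous_ofReal.tendsto _).comp (h1.comp h2)
  simp only [Real.rpow_zero, one_mul] at h3
  refine h3.congr fun m => ?_
  simp only [Function.comp_apply, one_div, inv_inv, zero_add, smul_eq_mul, Complex.ofReal_mul,
    Complex.ofReal_add, Complex.ofReal_neg, Complex.ofReal_one, sub_eq_add_neg]

theorem isMeasMultiplier_cexp_log (a b : ℂ) :
    D.IsMeasMultiplier fun r => Complex.exp (a + b * (Real.log r : ℂ)) :=
  ((isMeasMultiplier_const a).add ((isMeasMultiplier_const b).mul isMeasMultiplier_log)).cexp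

theorem isMeasMultiplier_exp_neg :
    D.IsMeasMultiplier fun r => ((Real.exp (-r) : ℝ) : ℂ) := by
  refine ((isMeasMultiplier_const (-1)).mul (isMeasMultiplier_rpow 1)).cexp.congr fun r _ => ?_
  simp

variable (D)

theorem aemeasurable_energy (t : ℝ) {η : X → E} (hη : AEStronglyMeasurable η μ) :
    AEMeasurable (fun x => D.energy t x (η x)) μ := by
  have h := D.meas_energy _ (D.meas_rpow (t / 2) η hη)
  refine h.congr (Eventually.of_forall fun x => ?_)
  have := D.energy_mult_rpow 0 (t / 2) x (η x)
  rw [energy_zero_exp] at this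
  simp only
  rw [show t = 0 + 2 * (t / 2) by ring, ← this]
  rw [show 0 + 2 * (t / 2) = t by ring]
  rfl

/-- Polarization reduces inner products to the norms, which are measurable by assumption. -/
theorem aestronglyMeasurable_inner {η ξ : X → E} (hη : AEStronglyMeasurable η μ)
    (hξ : AEStronglyMeasurable ξ μ) :
    AEStronglyMeasurable (fun x => inner ℂ (D.coord x (η x)) (D.coord x (ξ x))) μ := by
  have key : ∀ ζ : X → E, AEStronglyMeasurable ζ μ →
      AEStronglyMeasurable (fun x => ((‖D.coord x (ζ x)‖ : ℂ)) ^ 2) μ := by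
    intro ζ hζ
    have := Complex.continuous_ofReal.comp_aestronglyMeasurable
      (D.meas_energy ζ hζ).aestronglyMeasurable
    simpa using this
  have h := (((key _ (hη.add hξ)).sub (key _ (hη.sub hξ))).add
    (((key _ (hη.sub (hξ.const_smul Complex.I))).sub
      (key _ (hη.add (hξ.const_smul Complex.I)))).mul_const Complex.I)).mul_const (4 : ℂ)⁻¹
  refine h.congr (Eventually.of_forall fun x => ?_)
  simp only [inner_eq_sum_norm_sq_div_four (𝕜 := ℂ)]
  simp [div_eq_mul_inv]

/-! #### Convexity in the exponent -/

/-- Hölder's inequality over the coordinates: the logarithm of the energy is convex in the exponent.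
-/
theorem energy_le_rpow_mul_rpow {θ : ℝ} (h0 : 0 ≤ θ) (h1 : θ ≤ 1) (s r : ℝ) (x : X) (ω : E) :
    D.energy ((1 - θ) * s + θ * r) x ω ≤ D.energy s x ω ^ (1 - θ) * D.energy r x ω ^ θ := by
  have := sum_rpow_mul_rpow_le Finset.univ (u := fun j => D.eig x j ^ s * ‖D.coord x ω j‖ ^ 2)
    (v := fun j => D.eig x j ^ r * ‖D.coord x ω j‖ ^ 2)
    (fun j _ => mul_nonneg (Real.rpow_nonneg (D.eig_pos x j).le _) (sq_nonneg _))
    (fun j _ => mul_nonneg (Real.rpow_nonneg (D.eig_pos x j).le _) (sq_nonneg _)) h0 h1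
  refine le_trans (le_of_eq ?_) this
  refine Finset.sum_congr rfl fun j _ => ?_
  have he := D.eig_pos x j
  rw [Real.mul_rpow (Real.rpow_nonneg he.le _) (sq_nonneg _),
    Real.mul_rpow (Real.rpow_nonneg he.le _) (sq_nonneg _), ← Real.rpow_mul he.le,
    ← Real.rpow_mul he.le, mul_mul_mul_comm, ← Real.rpow_add he,
    ← Real.rpow_add_of_nonneg (sq_nonneg _) (by linarith) h0]
  rw [show 1 - θ + θ = 1 by ring, Real.rpow_one, mul_comm s, mul_comm r]

theorem energy_sq_le (s r : ℝ) (x : X) (ω : E) :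
    D.energy ((s + r) / 2) x ω ^ 2 ≤ D.energy s x ω * D.energy r x ω := by
  have h := D.energy_le_rpow_mul_rpow (θ := 1 / 2) (by norm_num) (by norm_num) s r x ω
  rw [show (1 - 1 / 2) * s + 1 / 2 * r = (s + r) / 2 by ring,
    show (1 : ℝ) - 1 / 2 = 1 / 2 by norm_num, ← Real.sqrt_eq_rpow, ← Real.sqrt_eq_rpow] at h
  calc D.energy ((s + r) / 2) x ω ^ 2
      ≤ (Real.sqrt (D.energy s x ω) * Real.sqrt (D.energy r x ω)) ^ 2 :=
        pow_le_pow_left₀ (D.energy_nonneg _ _ _) h 2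
    _ = _ := by
      rw [mul_pow, Real.sq_sqrt (D.energy_nonneg _ _ _), Real.sq_sqrt (D.energy_nonneg _ _ _)]

theorem continuous_energy [FiniteDimensional ℂ E] (t : ℝ) (x : X) :
    Continuous fun ω => D.energy t x ω := by
  have hc : Continuous (D.coord x).toLinearMap := LinearMap.continuous_of_finiteDimensional _
  refine continuous_finsetSum _ fun j _ => continuous_const.mul (Continuous.pow ?_ 2)
  exact ((EuclideanSpace.proj j : EuclideanSpace ℂ (Fin N) →L[ℂ] ℂ).continuous.comp hc).norm

/-! #### Upper and lower bounds -/

theorem exists_basis_bound (E : Type*) [NormedAddCommGroup E] [NormedSpace ℂ E]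
    [FiniteDimensional ℂ E] : ∃ C : ℝ, 0 < C ∧ ∀ {F : Type} [NormedAddCommGroup F]
      [NormedSpace ℂ F] (f : E →ₗ[ℂ] F) (ω : E),
      ‖f ω‖ ^ 2 ≤ C * (∑ i, ‖f (Module.finBasis ℂ E i)‖ ^ 2) * ‖ω‖ ^ 2 := by
  let L : E →L[ℂ] (Fin (Module.finrank ℂ E) → ℂ) :=
    ((Module.finBasis ℂ E).equivFunL : E →L[ℂ] (Fin (Module.finrank ℂ E) → ℂ))
  -- The summand 1 only keeps the constant positive when E is trivial.
  refine ⟨‖L‖ ^ 2 * Module.finrank ℂ E + 1, by positivity, fun {F} _ _ f ω => ?_⟩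
  have h1 : f ω = ∑ i, L ω i • f (Module.finBasis ℂ E i) := by
    conv_lhs => rw [← (Module.finBasis ℂ E).sum_repr ω, map_sum]
    simp only [map_smul]
    rfl
  have h2 : ‖f ω‖ ≤ ‖L‖ * ‖ω‖ * ∑ i, ‖f (Module.finBasis ℂ E i)‖ := by
    rw [h1, Finset.mul_sum]
    refine (norm_sum_le _ _).trans (Finset.sum_le_sum fun i _ => ?_)
    rw [norm_smul]
    gcongr
    exact (norm_le_pi_norm _ i).trans (L.le_opNorm ω)
  have h3 := sq_sum_le_card_mul_sum_sq (s := Finset.univ)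
    (f := fun i => ‖f (Module.finBasis ℂ E i)‖)
  simp only [Finset.card_univ, Fintype.card_fin] at h3
  calc ‖f ω‖ ^ 2 ≤ (‖L‖ * ‖ω‖ * ∑ i, ‖f (Module.finBasis ℂ E i)‖) ^ 2 :=
        pow_le_pow_left₀ (norm_nonneg _) h2 2
    _ = ‖L‖ ^ 2 * ‖ω‖ ^ 2 * (∑ i, ‖f (Module.finBasis ℂ E i)‖) ^ 2 := by ring
    _ ≤ ‖L‖ ^ 2 * ‖ω‖ ^ 2 * (Module.finrank ℂ E * ∑ i, ‖f (Module.finBasis ℂ E i)‖ ^ 2) := by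
        gcongr
    _ = (‖L‖ ^ 2 * Module.finrank ℂ E) * (∑ i, ‖f (Module.finBasis ℂ E i)‖ ^ 2) * ‖ω‖ ^ 2 := by
        ring
    _ ≤ _ := by
        gcongr
        linarith

section Bounds

variable [FiniteDimensional ℂ E]

/-- A measurable upper bound for the norms `energy t x`. -/
def upper (t : ℝ) (x : X) : ℝ :=
  (exists_basis_bound E).choose * ∑ i, D.energy t x (Module.finBasis ℂ E i)

/-- The optimal constant in `‖ω‖² ≤ C · energy t x ω`. -/
def lower (t : ℝ) (x : X) : ℝ := ⨆ u : Metric.sphere (0 : E) 1, (D.energy t x u)⁻¹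

theorem energy_le_upper (t : ℝ) (x : X) (ω : E) : D.energy t x ω ≤ D.upper t x * ‖ω‖ ^ 2 := by
  let f : E →ₗ[ℂ] EuclideanSpace ℂ (Fin N) :=
    (Matrix.toLpLin 2 2 (Matrix.diagonal fun j => ((D.eig x j ^ (t / 2) : ℝ) : ℂ))) ∘ₗ
      (D.coord x).toLinearMap
  have key : ∀ ω, ‖f ω‖ ^ 2 = D.energy t x ω := by
    intro ω
    have := D.energy_mult_rpow 0 (t / 2) x ω
    rw [energy_zero_exp, show 0 + 2 * (t / 2) = t by ring] at this
    rw [← this]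
    congr 2
    ext j
    rw [coord_mult]
    simp [f, Matrix.mulVec_diagonal]
  have h := (exists_basis_bound E).choose_spec.2 f ω
  simp only [key] at h
  exact h

theorem upper_nonneg (t : ℝ) (x : X) : 0 ≤ D.upper t x :=
  mul_nonneg (exists_basis_bound E).choose_spec.1.le
    (Finset.sum_nonneg fun _ _ => D.energy_nonneg _ _ _)

theorem upper_pos [Nontrivial E] (t : ℝ) (x : X) : 0 < D.upper t x := by
  have : 0 < Module.finrank ℂ E := Module.finrank_pos
  refine mul_pos (exists_basis_bound E).choose_spec.1 (Finset.sum_pos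
    (fun i _ => D.energy_pos _ _ ((Module.finBasis ℂ E).ne_zero i)) ⟨⟨0, this⟩, Finset.mem_univ _⟩)

theorem aemeasurable_upper (t : ℝ) : AEMeasurable (D.upper t) μ :=
  (Finset.aemeasurable_fun_sum _ fun _ _ =>
    D.aemeasurable_energy t aestronglyMeasurable_const).const_mul _

theorem energy_sphere_pos (t : ℝ) (x : X) (u : Metric.sphere (0 : E) 1) :
    0 < D.energy t x u := by
  refine D.energy_pos t x fun h => ?_
  have := mem_sphere_zero_iff_norm.1 u.2
  simp [h] at this

theorem continuous_inv_energy (t : ℝ) (x : X) :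
    Continuous fun u : Metric.sphere (0 : E) 1 => (D.energy t x u)⁻¹ :=
  ((D.continuous_energy t x).comp continuous_subtype_val).inv₀
    fun u => (D.energy_sphere_pos t x u).ne'

theorem bddAbove_inv_energy (t : ℝ) (x : X) :
    BddAbove (range fun u : Metric.sphere (0 : E) 1 => (D.energy t x u)⁻¹) := by
  have : ProperSpace E := FiniteDimensional.proper ℂ E
  exact (isCompact_range (D.continuous_inv_energy t x)).bddAbove

theorem inv_energy_le_lower (t : ℝ) (x : X) (u : Metric.sphere (0 : E) 1) :
    (D.energy t x u)⁻¹ ≤ D.lower t x := le_ciSup (D.bddAbove_inv_energy t x) u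

theorem lower_nonneg (t : ℝ) (x : X) : 0 ≤ D.lower t x :=
  Real.iSup_nonneg fun _ => inv_nonneg.2 (D.energy_nonneg _ _ _)

theorem norm_sq_le_lower (t : ℝ) (x : X) (ω : E) :
    ‖ω‖ ^ 2 ≤ D.lower t x * D.energy t x ω := by
  rcases eq_or_ne ω 0 with rfl | hω
  · simpa using mul_nonneg (D.lower_nonneg t x) (D.energy_nonneg t x 0)
  · have hn : 0 < ‖ω‖ := norm_pos_iff.2 hω
    let u : Metric.sphere (0 : E) 1 := ⟨((‖ω‖⁻¹ : ℝ) : ℂ) • ω, by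
      rw [mem_sphere_zero_iff_norm, norm_smul, Complex.norm_real, norm_inv, norm_norm,
        inv_mul_cancel₀ hn.ne']⟩
    have h := D.inv_energy_le_lower t x u
    have hu := D.energy_sphere_pos t x u
    have hω' : D.energy t x ω = ‖ω‖ ^ 2 * D.energy t x u := by
      have : (u : E) = ((‖ω‖⁻¹ : ℝ) : ℂ) • ω := rfl
      rw [this, energy_smul, Complex.norm_real, norm_inv, norm_norm]
      field_simp
    rw [hω', mul_left_comm]
    refine le_mul_of_one_le_right (sq_nonneg _) ?_
    calc (1 : ℝ) = (D.energy t x u)⁻¹ * D.energy t x u := (inv_mul_cancel₀ hu.ne').symm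
      _ ≤ _ := mul_le_mul_of_nonneg_right h hu.le

variable [Nontrivial E]

theorem lower_pos (t : ℝ) (x : X) : 0 < D.lower t x := by
  obtain ⟨u, hu⟩ := NormedSpace.sphere_nonempty (E := E) (x := 0) (r := 1) |>.2 zero_le_one
  exact (inv_pos.2 (D.energy_sphere_pos t x ⟨u, hu⟩)).trans_le (D.inv_energy_le_lower t x ⟨u, hu⟩)

theorem lower_le {t : ℝ} {x : X} {c : ℝ}
    (h : ∀ u : Metric.sphere (0 : E) 1, (D.energy t x u)⁻¹ ≤ c) : D.lower t x ≤ c := by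
  have : Nonempty (Metric.sphere (0 : E) 1) :=
    (NormedSpace.sphere_nonempty.2 zero_le_one).to_subtype
  exact ciSup_le h

/-- A countable dense family of unit vectors of `E`. -/
def unitSeq (E : Type*) [NormedAddCommGroup E] [NormedSpace ℂ E] [FiniteDimensional ℂ E]
    [Nontrivial E] : ℕ → Metric.sphere (0 : E) 1 :=
  haveI : Nonempty (Metric.sphere (0 : E) 1) :=
    (NormedSpace.sphere_nonempty.2 zero_le_one).to_subtype
  haveI : ProperSpace E := FiniteDimensional.proper ℂ E
  TopologicalSpace.denseSeq _

theorem denseRange_unitSeq : DenseRange (unitSeq E) := by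
  have : Nonempty (Metric.sphere (0 : E) 1) :=
    (NormedSpace.sphere_nonempty.2 zero_le_one).to_subtype
  have : ProperSpace E := FiniteDimensional.proper ℂ E
  exact TopologicalSpace.denseRange_denseSeq _

/-- By continuity the supremum over the unit sphere may be taken over a countable dense set, which
makes it measurable in x. -/
theorem isLUB_lower (t : ℝ) (x : X) :
    IsLUB {a | ∃ m, (D.energy t x (unitSeq E m))⁻¹ = a} (D.lower t x) := by
  constructor
  · rintro a ⟨m, rfl⟩
    exact D.inv_energy_le_lower t x _
  · intro c hc
    refine D.lower_le fun u => ?_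
    have hcl : IsClosed {u : Metric.sphere (0 : E) 1 | (D.energy t x u)⁻¹ ≤ c} :=
      isClosed_le (D.continuous_inv_energy t x) continuous_const
    exact hcl.closure_subset_iff.2 (range_subset_iff.2 fun m => hc ⟨m, rfl⟩)
      (denseRange_unitSeq u)

theorem aemeasurable_lower (t : ℝ) : AEMeasurable (D.lower t) μ :=
  AEMeasurable.isLUB (fun m => (D.aemeasurable_energy t
    (aestronglyMeasurable_const (b := ((unitSeq E m : Metric.sphere (0 : E) 1) : E)))).inv)
    (Eventually.of_forall fun x => D.isLUB_lower t x)

/-- A measurable field of unit vectors that are almost shortest for `energy t`. -/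
theorem exists_unit_field (t : ℝ) : ∃ w : X → E, AEStronglyMeasurable w μ ∧ (∀ x, ‖w x‖ = 1) ∧
    ∀ᵐ x ∂μ, D.lower t x * D.energy t x (w x) ≤ 2 := by
  classical
  have hq : ∀ m, AEMeasurable (fun x => D.energy t x (unitSeq E m)) μ := fun m =>
    D.aemeasurable_energy t aestronglyMeasurable_const
  have hl := D.aemeasurable_lower t
  let q : ℕ → X → ℝ := fun m => (hq m).mk _
  let l : X → ℝ := hl.mk _
  -- The first alternative makes the search for the first good index total on all of X. It can occur
  -- only where the measurable versions l, q differ from the original functions, on a null set.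
  let p : X → ℕ → Prop := fun x m => (∀ m, ¬ l x * q m x ≤ 2) ∨ l x * q m x ≤ 2
  have hp : ∀ x, ∃ m, p x m := by
    intro x
    by_cases h : ∀ m, ¬ l x * q m x ≤ 2
    · exact ⟨0, Or.inl h⟩
    · push Not at h
      obtain ⟨m, hm⟩ := h
      exact ⟨m, Or.inr hm⟩
  have hm : ∀ m, MeasurableSet {x | l x * q m x ≤ 2} := fun m =>
    measurableSet_le (hl.measurable_mk.mul (hq m).measurable_mk) measurable_const
  have hpm : ∀ m, MeasurableSet {x | p x m} := by
    intro m
    have : {x | p x m} = (⋂ m, {x | l x * q m x ≤ 2}ᶜ) ∪ {x | l x * q m x ≤ 2} := by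
      ext x
      simp [p]
    rw [this]
    exact (MeasurableSet.iInter fun m => (hm m).compl).union (hm m)
  have hfind := measurable_find hp hpm
  refine ⟨fun x => unitSeq E (Nat.find (hp x)), ?_, fun x => ?_, ?_⟩
  · have : StronglyMeasurable fun m : ℕ => ((unitSeq E m : Metric.sphere (0 : E) 1) : E) :=
      StronglyMeasurable.of_discrete
    exact (this.comp_measurable hfind).aestronglyMeasurable
  · exact mem_sphere_zero_iff_norm.1 (unitSeq E _).2
  · filter_upwards [hl.ae_eq_mk, ae_all_iff.2 fun m => (hq m).ae_eq_mk] with x hx1 hx2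
    have hlq : ∀ m, l x * q m x = D.lower t x * D.energy t x (unitSeq E m) := fun m => by
      rw [hx1, hx2 m]
    have hpos := D.lower_pos t x
    obtain ⟨_, ⟨m, rfl⟩, h1, -⟩ :=
      (D.isLUB_lower t x).exists_between (half_lt_self hpos)
    have h2 : l x * q m x ≤ 2 := by
      rw [hlq]
      have h3 := D.energy_sphere_pos t x (unitSeq E m)
      have h4 := mul_lt_mul_of_pos_right h1 h3
      rw [inv_mul_cancel₀ h3.ne'] at h4
      linarith
    rcases Nat.find_spec (hp x) with h | h
    · exact absurd h2 (h m)
    · rwa [hlq] at h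

end Bounds

end SpectralField

/-! ### Pointwise inequalities between the constants for different exponents. -/

namespace SpectralField

variable {X : Type*} [MeasurableSpace X] {μ : Measure X} {E : Type*} [NormedAddCommGroup E]
  [NormedSpace ℂ E] {N : ℕ} (D : SpectralField μ E N)

section Pointwise

variable [FiniteDimensional ℂ E]

/-- The optimal constant `lower` is logarithmically convex in the exponent. -/
theorem norm_sq_le_lower_rpow {θ : ℝ} (h0 : 0 ≤ θ) (h1 : θ ≤ 1) (s r : ℝ) (x : X) (ω : E) :
    ‖ω‖ ^ 2 ≤ D.lower s x ^ (1 - θ) * D.lower r x ^ θ *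
      D.energy ((1 - θ) * s + θ * r) x ω := by
  have hL0 := D.lower_nonneg s x
  have hL1 := D.lower_nonneg r x
  rcases eq_or_ne ω 0 with rfl | hω
  · have := D.energy_nonneg ((1 - θ) * s + θ * r) x 0
    simp only [norm_zero, ne_eq, OfNat.ofNat_ne_zero, not_false_eq_true, zero_pow]
    positivity
  -- Convexity of the energy points the wrong way for lower bounds, so the argument is by duality.
  -- For a functional g norming ω and represented by ξ in the coordinates, the squared dual norm of
  -- g is the energy of ξ with the opposite exponent.
  obtain ⟨g, hg, hgω⟩ := exists_dual_vector ℂ ω (norm_ne_zero_iff.2 hω)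
  let l : Fin N → ℂ := fun j => g ((D.coord x).symm (EuclideanSpace.single j 1))
  have hgl : ∀ η, g η = ∑ j, D.coord x η j * l j := by
    intro η
    have : η = ∑ j, D.coord x η j • (D.coord x).symm (EuclideanSpace.single j 1) := by
      apply (D.coord x).injective
      rw [map_sum]
      simp only [map_smul, LinearEquiv.apply_symm_apply]
      ext i
      simp [Pi.single_apply]
    conv_lhs => rw [this, map_sum]
    simp only [map_smul, smul_eq_mul, l]
  let ξ : E := (D.coord x).symm (WithLp.toLp 2 fun j => (starRingEnd ℂ) (l j))
  have hξ : ∀ j, D.coord x ξ j = (starRingEnd ℂ) (l j) := fun j => by simp [ξ]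
  have hgξ : ∀ p : ℝ, g (D.mult (fun r => ((r ^ p : ℝ) : ℂ)) x ξ) = (D.energy p x ξ : ℂ) := by
    intro p
    rw [hgl, energy, Complex.ofReal_sum]
    refine Finset.sum_congr rfl fun j _ => ?_
    rw [coord_mult, hξ, mul_assoc, mul_comm _ (l j), Complex.mul_conj, Complex.normSq_eq_norm_sq,
      RCLike.norm_conj]
    push_cast
    ring
  -- Test the definition of `lower` on the vector where g attains its dual norm.
  have hi : ∀ p : ℝ, D.energy (-p) x ξ ≤ D.lower p x := by
    intro p
    have h1 := D.norm_sq_le_lower p x (D.mult (fun r => ((r ^ (-p) : ℝ) : ℂ)) x ξ)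
    rw [energy_mult_rpow, show p + 2 * -p = -p by ring] at h1
    have h2 := g.le_opNorm (D.mult (fun r => ((r ^ (-p) : ℝ) : ℂ)) x ξ)
    rw [hgξ, hg, one_mul, Complex.norm_real, Real.norm_eq_abs,
      abs_of_nonneg (D.energy_nonneg _ _ _)] at h2
    rcases (D.energy_nonneg (-p) x ξ).eq_or_lt with h | h
    · rw [← h]; exact D.lower_nonneg p x
    · have h3 : D.energy (-p) x ξ ^ 2 ≤ D.lower p x * D.energy (-p) x ξ :=
        (pow_le_pow_left₀ h.le h2 2).trans h1
      rw [sq] at h3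
      exact le_of_mul_le_mul_right h3 h
  set q := (1 - θ) * s + θ * r with hq
  -- Cauchy–Schwarz for g ω, with the weights -q/2 and q/2 on the two factors.
  have hii : ‖ω‖ ^ 2 ≤ D.energy (-q) x ξ * D.energy q x ω := by
    have h1 : ‖ω‖ ≤ ∑ j, (D.eig x j ^ (-q / 2) * ‖l j‖) *
        (D.eig x j ^ (q / 2) * ‖D.coord x ω j‖) := by
      have h2 : ‖g ω‖ = ‖ω‖ := by rw [hgω]; simp
      rw [← h2, hgl]
      refine (norm_sum_le _ _).trans (Finset.sum_le_sum fun j _ => ?_)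
      have he := D.eig_pos x j
      have h3 : D.eig x j ^ (-q / 2) * D.eig x j ^ (q / 2) = 1 := by
        rw [← Real.rpow_add he]; ring_nf; exact Real.rpow_zero _
      rw [norm_mul, mul_mul_mul_comm, h3, one_mul, mul_comm]
    have hsq : ∀ (p : ℝ) (j), (D.eig x j ^ (p / 2)) ^ 2 = D.eig x j ^ p := by
      intro p j
      rw [← Real.rpow_natCast, ← Real.rpow_mul (D.eig_pos x j).le]
      congr 1
      push_cast
      ring
    refine (pow_le_pow_left₀ (norm_nonneg _) h1 2).trans
      ((Finset.sum_mul_sq_le_sq_mul_sq _ _ _).trans (le_of_eq ?_))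
    simp only [energy, mul_pow, hsq, hξ, RCLike.norm_conj]
  have hiii := D.energy_le_rpow_mul_rpow h0 h1 (-s) (-r) x ξ
  rw [show (1 - θ) * -s + θ * -r = -q by rw [hq]; ring] at hiii
  refine hii.trans (mul_le_mul_of_nonneg_right ?_ (D.energy_nonneg _ _ _))
  refine hiii.trans ?_
  have := D.energy_nonneg (-s) x ξ
  have := D.energy_nonneg (-r) x ξ
  gcongr
  · exact hi s
  · exact hi r

/-- Since energy s ≤ U_s L_r · energy r on every vector, moving the exponent from s by s - r, away
from r, costs at most the factor U_s L_r. Log-convexity turns this into a bound for moving towards r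
by a fraction θ. -/
theorem energy_le_mul_rpow {θ : ℝ} (h0 : 0 ≤ θ) (h1 : θ ≤ 1) (s r : ℝ) (x : X) (ω : E) :
    D.energy s x ω ≤
      D.energy ((1 - θ) * s + θ * r) x ω * (D.upper s x * D.lower r x) ^ θ := by
  have hUL : 0 ≤ D.upper s x * D.lower r x := mul_nonneg (D.upper_nonneg _ _) (D.lower_nonneg _ _)
  rcases eq_or_ne ω 0 with rfl | hω
  · have h : ∀ p, D.energy p x 0 = 0 := fun p => by simp [energy]
    rw [h, h, zero_mul]
  have hpos : ∀ p, 0 < D.energy p x ω := fun p => D.energy_pos p x hω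
  have hA : D.energy (2 * s - r) x ω ≤ D.energy s x ω * (D.upper s x * D.lower r x) := by
    have h1 := D.energy_sq_le s (3 * s - 2 * r) x ω
    rw [show (s + (3 * s - 2 * r)) / 2 = 2 * s - r by ring] at h1
    have h2 := D.energy_le_upper s x (D.mult (fun t => ((t ^ (s - r) : ℝ) : ℂ)) x ω)
    have h3 := D.norm_sq_le_lower r x (D.mult (fun t => ((t ^ (s - r) : ℝ) : ℂ)) x ω)
    rw [energy_mult_rpow, show s + 2 * (s - r) = 3 * s - 2 * r by ring] at h2
    rw [energy_mult_rpow, show r + 2 * (s - r) = 2 * s - r by ring] at h3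
    have h4 : D.energy (2 * s - r) x ω ^ 2 ≤
        D.energy s x ω * (D.upper s x * D.lower r x) * D.energy (2 * s - r) x ω := by
      calc _ ≤ D.energy s x ω * D.energy (3 * s - 2 * r) x ω := h1
        _ ≤ D.energy s x ω * (D.upper s x * (D.lower r x * D.energy (2 * s - r) x ω)) :=
          mul_le_mul_of_nonneg_left
            (h2.trans (mul_le_mul_of_nonneg_left h3 (D.upper_nonneg _ _))) (hpos _).le
        _ = _ := by ring
    rw [sq] at h4
    exact le_of_mul_le_mul_right h4 (hpos _)
  have hB := D.energy_le_rpow_mul_rpow h0 h1 s (2 * s - r) x ω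
  -- The second exponent is the reflection of the first through s, so s is their midpoint.
  have hC := D.energy_sq_le ((1 - θ) * s + θ * r) ((1 - θ) * s + θ * (2 * s - r)) x ω
  rw [show ((1 - θ) * s + θ * r + ((1 - θ) * s + θ * (2 * s - r))) / 2 = s by ring] at hC
  have hs := hpos s
  have hD : D.energy ((1 - θ) * s + θ * (2 * s - r)) x ω ≤
      D.energy s x ω * (D.upper s x * D.lower r x) ^ θ := by
    calc _ ≤ _ := hB
      _ ≤ D.energy s x ω ^ (1 - θ) *
          (D.energy s x ω * (D.upper s x * D.lower r x)) ^ θ :=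
        mul_le_mul_of_nonneg_left (Real.rpow_le_rpow (hpos _).le hA h0) (by positivity)
      _ = _ := by
        rw [Real.mul_rpow hs.le hUL, ← mul_assoc, ← Real.rpow_add hs,
          show 1 - θ + θ = 1 by ring, Real.rpow_one]
  have hE : D.energy s x ω * D.energy s x ω ≤ D.energy ((1 - θ) * s + θ * r) x ω *
      (D.upper s x * D.lower r x) ^ θ * D.energy s x ω := by
    calc _ = D.energy s x ω ^ 2 := (sq _).symm
      _ ≤ _ := hC
      _ ≤ _ := mul_le_mul_of_nonneg_left hD (hpos _).le
      _ = _ := by ring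
  exact le_of_mul_le_mul_right hE hs

variable [Nontrivial E]

/-- Summing `energy_le_mul_rpow` over the basis gives U_s ≤ U_t (U_s L_r)^θ, which is then solved
for U_s. An endpoint is thus controlled by an interior point and the other endpoint. -/
theorem upper_le {θ : ℝ} (h0 : 0 ≤ θ) (h1 : θ < 1) (s r : ℝ) (x : X) :
    D.upper s x ≤ (D.upper ((1 - θ) * s + θ * r) x * D.lower r x ^ θ) ^ (1 / (1 - θ)) := by
  have hU := D.upper_pos s x
  have hL := D.lower_pos r x
  have hP := D.upper_pos ((1 - θ) * s + θ * r) x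
  have h : D.upper s x ≤ D.upper ((1 - θ) * s + θ * r) x * (D.upper s x * D.lower r x) ^ θ := by
    conv_lhs => rw [upper]
    rw [upper, mul_assoc, Finset.sum_mul]
    exact mul_le_mul_of_nonneg_left
      (Finset.sum_le_sum fun i _ => D.energy_le_mul_rpow h0 h1.le s r x _)
      (exists_basis_bound E).choose_spec.1.le
  have h2 : D.upper s x ^ (1 - θ) ≤ D.upper ((1 - θ) * s + θ * r) x * D.lower r x ^ θ := by
    rw [Real.rpow_sub hU, Real.rpow_one, div_le_iff₀ (by positivity)]
    rw [Real.mul_rpow hU.le hL.le] at h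
    linarith
  have h3 := Real.rpow_le_rpow (by positivity) h2 (z := 1 / (1 - θ))
    (one_div_nonneg.2 (by linarith))
  rwa [← Real.rpow_mul hU.le, mul_one_div_cancel (by linarith), Real.rpow_one] at h3

/-- On the unit sphere 1 ≤ L_t · energy t ≤ L_t (energy s)^{1-θ} U_r^θ by log-convexity, and this is
solved for the inverse of the energy. -/
theorem lower_le_rpow {θ : ℝ} (h0 : 0 ≤ θ) (h1 : θ < 1) (s r : ℝ) (x : X) :
    D.lower s x ≤ (D.lower ((1 - θ) * s + θ * r) x * D.upper r x ^ θ) ^ (1 / (1 - θ)) := by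
  refine D.lower_le fun u => ?_
  have hu : ‖(u : E)‖ = 1 := mem_sphere_zero_iff_norm.1 u.2
  have hE := D.energy_sphere_pos s x u
  have hL := D.lower_pos ((1 - θ) * s + θ * r) x
  have hU := D.upper_pos r x
  have h2 : (D.energy s x u)⁻¹ ^ (1 - θ) ≤
      D.lower ((1 - θ) * s + θ * r) x * D.upper r x ^ θ := by
    have h3 := D.norm_sq_le_lower ((1 - θ) * s + θ * r) x u
    rw [hu, one_pow] at h3
    have h4 := D.energy_le_upper r x u
    rw [hu, one_pow, mul_one] at h4
    have h5 : (1 : ℝ) ≤ D.lower ((1 - θ) * s + θ * r) x *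
        (D.energy s x u ^ (1 - θ) * D.upper r x ^ θ) := by
      refine h3.trans (mul_le_mul_of_nonneg_left
        ((D.energy_le_rpow_mul_rpow h0 h1.le s r x u).trans ?_) hL.le)
      exact mul_le_mul_of_nonneg_left (Real.rpow_le_rpow (D.energy_nonneg _ _ _) h4 h0)
        (by positivity)
    rw [Real.inv_rpow hE.le, inv_le_iff_one_le_mul₀ (by positivity)]
    linarith
  have h3 := Real.rpow_le_rpow (by positivity) h2 (z := 1 / (1 - θ))
    (one_div_nonneg.2 (by linarith))
  rwa [← Real.rpow_mul (by positivity), mul_one_div_cancel (by linarith), Real.rpow_one] at h3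

end Pointwise

end SpectralField

/-! ### Functions with finite integral -/

section FiniteIntegral

variable {X : Type*} [MeasurableSpace X] {μ : Measure X}

/-- The integral of the positive part of `f` is finite. -/
def FinInt (μ : Measure X) (f : X → ℝ) : Prop := ∫⁻ x, ENNReal.ofReal (f x) ∂μ < ∞

theorem FinInt.mono {f g : X → ℝ} (hg : FinInt μ g) (h : ∀ᵐ x ∂μ, f x ≤ g x) : FinInt μ f :=
  (lintegral_mono_ae (h.mono fun _ hx => ENNReal.ofReal_le_ofReal hx)).trans_lt hg

theorem FinInt.add {f g : X → ℝ} (hf : FinInt μ f) (hg : FinInt μ g) (hm : AEMeasurable f μ) :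
    FinInt μ fun x => f x + g x := by
  refine (lintegral_mono fun x => ENNReal.ofReal_add_le).trans_lt ?_
  rw [lintegral_add_left' hm.ennreal_ofReal]
  exact ENNReal.add_lt_top.2 ⟨hf, hg⟩

theorem FinInt.const_mul {f : X → ℝ} (hf : FinInt μ f) {c : ℝ} (hc : 0 ≤ c) :
    FinInt μ fun x => c * f x := by
  unfold FinInt
  simp only [ENNReal.ofReal_mul hc]
  rw [lintegral_const_mul' _ _ ENNReal.ofReal_ne_top]
  exact ENNReal.mul_lt_top ENNReal.ofReal_lt_top hf

theorem finInt_const [IsFiniteMeasure μ] (c : ℝ) : FinInt μ fun _ => c := by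
  unfold FinInt
  rw [lintegral_const]
  exact ENNReal.mul_lt_top ENNReal.ofReal_lt_top (measure_lt_top _ _)

theorem FinInt.sum {ι : Type*} (s : Finset ι) {f : ι → X → ℝ} (hf : ∀ i ∈ s, FinInt μ (f i))
    (hm : ∀ i ∈ s, AEMeasurable (f i) μ) : FinInt μ fun x => ∑ i ∈ s, f i x := by
  classical
  induction s using Finset.induction_on with
  | empty => simp [FinInt]
  | insert a s ha ih =>
    simp only [Finset.sum_insert ha]
    exact (hf a (Finset.mem_insert_self a s)).add
      (ih (fun i hi => hf i (Finset.mem_insert_of_mem hi))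
        fun i hi => hm i (Finset.mem_insert_of_mem hi)) (hm a (Finset.mem_insert_self a s))

theorem FinInt.rpow_of_le [IsFiniteMeasure μ] {f : X → ℝ} (h0 : ∀ x, 0 ≤ f x) {a b : ℝ}
    (hb : FinInt μ fun x => f x ^ b) (ha : 0 ≤ a) (hab : a ≤ b) : FinInt μ fun x => f x ^ a := by
  refine ((finInt_const 1).add hb aemeasurable_const).mono (Eventually.of_forall fun x => ?_)
  rcases le_total (f x) 1 with h | h
  · exact (Real.rpow_le_one (h0 x) h ha).trans (by linarith [Real.rpow_nonneg (h0 x) b])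
  · exact (Real.rpow_le_rpow_of_exponent_le h hab).trans (by linarith)

theorem rpow_mul_rpow_le_add {a b s t : ℝ} (ha : 0 ≤ a) (hb : 0 ≤ b) (hs : 0 ≤ s) (ht : 0 ≤ t)
    (hst : s + t = 1) : a ^ s * b ^ t ≤ a + b := by
  have := Real.geom_mean_le_arith_mean2_weighted hs ht ha hb hst
  nlinarith

variable {E : Type*} [NormedAddCommGroup E]

/-- Exponents are parametrized by their reciprocals u = 1/p, in which interpolation is affine; p = ∞
is u = 0 and is always treated apart. -/
theorem memLp_inv_ofReal_iff {u : ℝ} (hu : 0 < u) {η : X → E} :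
    MemLp η (ENNReal.ofReal u)⁻¹ μ ↔
      AEStronglyMeasurable η μ ∧ FinInt μ fun x => ‖η x‖ ^ (1 / u) := by
  refine and_congr_right fun _ => ?_
  rw [eLpNorm_lt_top_iff_lintegral_rpow_enorm_lt_top (by simp) (by simpa using hu)]
  unfold FinInt
  have : ((ENNReal.ofReal u)⁻¹).toReal = 1 / u := by
    rw [ENNReal.toReal_inv, ENNReal.toReal_ofReal hu.le, one_div]
  simp only [this, ← ofReal_norm, ENNReal.ofReal_rpow_of_nonneg (norm_nonneg _)
    (one_div_nonneg.2 hu.le)]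

theorem exists_bound_of_memLp_top {η : X → E} (h : MemLp η ∞ μ) : ∃ C : ℝ, 0 ≤ C ∧
    ∀ᵐ x ∂μ, ‖η x‖ ≤ C := by
  have h1 := h.2
  rw [eLpNorm_exponent_top] at h1
  refine ⟨(eLpNormEssSup η μ).toReal, ENNReal.toReal_nonneg, ?_⟩
  filter_upwards [ae_le_eLpNormEssSup (f := η) (μ := μ)] with x hx
  rw [← ENNReal.ofReal_le_iff_le_toReal h1.ne, ofReal_norm]
  exact hx

/-- The iterates of `β ↦ κ + λ β` starting from `0` exhaust `[0, κ / (1 - λ))`. -/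
theorem mem_of_affine_iteration {G : Set ℝ} {κ l : ℝ} (hκ : 0 < κ) (hl : 0 ≤ l) (h0 : (0 : ℝ) ∈ G)
    (hdown : ∀ a b, 0 ≤ a → a ≤ b → b ∈ G → a ∈ G) (hstep : ∀ b, 0 ≤ b → b ∈ G → κ + l * b ∈ G)
    {b : ℝ} (hb : 0 ≤ b) (hbκ : b * (1 - l) < κ) : b ∈ G := by
  by_contra hbG
  have hbound : ∀ g ∈ G ∩ Ici 0, g ≤ b := by
    intro g hg
    by_contra! h
    exact hbG (hdown b g hb h.le hg.1)
  have hne : (G ∩ Ici (0 : ℝ)).Nonempty := ⟨0, h0, self_mem_Ici⟩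
  have hbdd : BddAbove (G ∩ Ici (0 : ℝ)) := ⟨b, hbound⟩
  set S := sSup (G ∩ Ici (0 : ℝ)) with hS
  have hSb : S ≤ b := csSup_le hne hbound
  have hS0 : 0 ≤ S := le_csSup hbdd ⟨h0, self_mem_Ici⟩
  have h1 : ∀ g ∈ G ∩ Ici (0 : ℝ), κ + l * g ≤ S := fun g hg =>
    le_csSup hbdd ⟨hstep g hg.2 hg.1, add_nonneg hκ.le (mul_nonneg hl hg.2)⟩
  -- The supremum is not moved up by the affine map, which places it beyond every b with b (1 - l) <
  -- κ.
  have h2 : κ + l * S ≤ S := by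
    rcases hl.eq_or_lt with rfl | hl
    · simpa using h1 0 ⟨h0, self_mem_Ici⟩
    · have : S ≤ (S - κ) / l := csSup_le hne fun g hg => by
        rw [le_div_iff₀ hl]
        linarith [h1 g hg]
      rw [le_div_iff₀ hl] at this
      linarith
  rcases le_total (1 - l) 0 with h | h <;> nlinarith

end FiniteIntegral

/-! ### Inclusions between energy spaces and Lebesgue spaces, and integrability of the constants. -/

namespace SpectralField

variable {X : Type*} [MeasurableSpace X] {μ : Measure X} {E : Type*} [NormedAddCommGroup E]
  [NormedSpace ℂ E] {N : ℕ} (D : SpectralField μ E N)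

/-- The field `η` has finite energy for `energy t`. -/
def FiniteEnergy (t : ℝ) (η : X → E) : Prop :=
  AEStronglyMeasurable η μ ∧ FinInt μ fun x => D.energy t x (η x)

/-- `Lᵖ` is contained in the space of fields of finite energy. -/
def LpSub (t : ℝ) (p : ℝ≥0∞) : Prop := ∀ η : X → E, MemLp η p μ → D.FiniteEnergy t η

/-- The space of fields of finite energy is contained in `L^q`. -/
def SubLp (t : ℝ) (q : ℝ≥0∞) : Prop := ∀ η : X → E, D.FiniteEnergy t η → MemLp η q μ

variable [IsFiniteMeasure μ]

variable [FiniteDimensional ℂ E] [Nontrivial E]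

/-- Hölder for U·|η|² with exponents 1/(1-2u) and 1/(2u), in the pointwise form of Young's
inequality. -/
theorem lpSub_of_finInt {t u : ℝ} (hu0 : 0 ≤ u) (hu1 : u < 1 / 2)
    (h : FinInt μ fun x => D.upper t x ^ (1 / (1 - 2 * u))) : D.LpSub t (ENNReal.ofReal u)⁻¹ := by
  intro η hη
  refine ⟨hη.1, ?_⟩
  rcases hu0.eq_or_lt with rfl | hu
  · simp only [ENNReal.ofReal_zero, ENNReal.inv_zero] at hη
    obtain ⟨C, hC0, hC⟩ := exists_bound_of_memLp_top hη
    simp only [mul_zero, sub_zero, div_one, Real.rpow_one] at h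
    refine (h.const_mul (sq_nonneg C)).mono (hC.mono fun x hx => ?_)
    refine (D.energy_le_upper t x _).trans ?_
    rw [mul_comm]
    exact mul_le_mul_of_nonneg_right (pow_le_pow_left₀ (norm_nonneg _) hx 2) (D.upper_nonneg _ _)
  · rw [memLp_inv_ofReal_iff hu] at hη
    refine (h.add hη.2 ((D.aemeasurable_upper t).pow_const _)).mono
      (Eventually.of_forall fun x => ?_)
    have hU := D.upper_nonneg t x
    refine (D.energy_le_upper t x _).trans ?_
    have := rpow_mul_rpow_le_add (a := D.upper t x ^ (1 / (1 - 2 * u))) (b := ‖η x‖ ^ (1 / u))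
      (s := 1 - 2 * u) (t := 2 * u) (by positivity) (by positivity) (by linarith) (by linarith)
      (by ring)
    refine le_trans (le_of_eq ?_) this
    rw [← Real.rpow_mul hU, ← Real.rpow_mul (norm_nonneg _),
      one_div_mul_cancel (by linarith), Real.rpow_one, ← Real.rpow_natCast]
    congr 2
    field_simp
    norm_num

/-- Hölder for (L·energy)^{1/(2v)}, with weights (2v-1)/(2v) and 1/(2v). -/
theorem subLp_of_finInt {t v : ℝ} (hv0 : 1 / 2 < v)
    (h : FinInt μ fun x => D.lower t x ^ (1 / (2 * v - 1))) :
    D.SubLp t (ENNReal.ofReal v)⁻¹ := by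
  intro η hη
  rw [memLp_inv_ofReal_iff (by linarith)]
  refine ⟨hη.1, (h.add hη.2 ((D.aemeasurable_lower t).pow_const _)).mono
    (Eventually.of_forall fun x => ?_)⟩
  have hL := D.lower_nonneg t x
  have hE := D.energy_nonneg t x (η x)
  have hb : 0 < 2 * v - 1 := by linarith
  have := rpow_mul_rpow_le_add (a := D.lower t x ^ (1 / (2 * v - 1))) (b := D.energy t x (η x))
    (s := (2 * v - 1) / (2 * v)) (t := 1 / (2 * v)) (by positivity) hE (by positivity)
    (by positivity) (by field_simp; ring)
  refine le_trans ?_ this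
  calc ‖η x‖ ^ (1 / v) = (‖η x‖ ^ 2) ^ (1 / (2 * v)) := by
        rw [← Real.rpow_natCast, ← Real.rpow_mul (norm_nonneg _)]
        congr 1
        field_simp
        norm_num
    _ ≤ (D.lower t x * D.energy t x (η x)) ^ (1 / (2 * v)) :=
        Real.rpow_le_rpow (sq_nonneg _) (D.norm_sq_le_lower t x _) (by positivity)
    _ = _ := by
        rw [Real.mul_rpow hL hE, ← Real.rpow_mul hL]
        congr 2
        field_simp

/-- Test the inclusion on U^{bu} times each basis vector: these fields are in the Lebesgue space
because U^b is integrable, and their energies add up to U^{1+2ub} up to a constant. -/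
theorem LpSub.finInt_step {t u : ℝ} (hu0 : 0 ≤ u) (h : D.LpSub t (ENNReal.ofReal u)⁻¹) {b : ℝ}
    (hb : 0 ≤ b) (hU : FinInt μ fun x => D.upper t x ^ b) :
    FinInt μ fun x => D.upper t x ^ (1 + 2 * u * b) := by
  have hm : AEStronglyMeasurable (fun x => ((D.upper t x ^ (b * u) : ℝ) : ℂ)) μ :=
    Complex.continuous_ofReal.comp_aestronglyMeasurable
      ((D.aemeasurable_upper t).pow_const _).aestronglyMeasurable
  have hmem : ∀ i, MemLp (fun x => ((D.upper t x ^ (b * u) : ℝ) : ℂ) • Module.finBasis ℂ E i)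
      (ENNReal.ofReal u)⁻¹ μ := by
    intro i
    rcases hu0.eq_or_lt with rfl | hu
    · simpa using memLp_top_const (Module.finBasis ℂ E i)
    · rw [memLp_inv_ofReal_iff hu]
      refine ⟨hm.smul_const _, ?_⟩
      have hc : 0 ≤ ‖Module.finBasis ℂ E i‖ ^ (1 / u) := by positivity
      refine (hU.const_mul hc).mono (Eventually.of_forall fun x => le_of_eq ?_)
      have hx := D.upper_nonneg t x
      rw [norm_smul, Complex.norm_real, Real.norm_of_nonneg (by positivity),
        Real.mul_rpow (by positivity) (by positivity), ← Real.rpow_mul hx, mul_comm]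
      congr 2
      field_simp
  have hfin : ∀ i, FinInt μ fun x =>
      D.upper t x ^ (2 * u * b) * D.energy t x (Module.finBasis ℂ E i) := by
    intro i
    refine (h _ (hmem i)).2.mono (Eventually.of_forall fun x => le_of_eq ?_)
    have hx := D.upper_nonneg t x
    rw [energy_smul, Complex.norm_real, Real.norm_of_nonneg (by positivity),
      ← Real.rpow_natCast, ← Real.rpow_mul hx]
    congr 2
    push_cast
    ring
  refine ((FinInt.sum Finset.univ (fun i _ => hfin i) fun i _ =>
    ((D.aemeasurable_upper t).pow_const _).mul
      (D.aemeasurable_energy t aestronglyMeasurable_const)).const_mul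
        (exists_basis_bound E).choose_spec.1.le).mono (Eventually.of_forall fun x => le_of_eq ?_)
  rw [← Finset.mul_sum, Real.rpow_add (D.upper_pos t x), Real.rpow_one]
  change (_ * ∑ i, D.energy t x (Module.finBasis ℂ E i)) * D.upper t x ^ (2 * u * b) = _
  ring

/-- Bootstrap from b = 0 along b ↦ 1 + 2ub, whose fixed point is 1/(1-2u) when u < 1/2. This
converse of `lpSub_of_finInt` misses only the endpoint and needs no a priori norm bound for the
inclusion. -/
theorem LpSub.finInt {t u : ℝ} (hu0 : 0 ≤ u) (h : D.LpSub t (ENNReal.ofReal u)⁻¹) {b : ℝ}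
    (hb : 0 ≤ b) (hbu : b * (1 - 2 * u) < 1) : FinInt μ fun x => D.upper t x ^ b := by
  refine mem_of_affine_iteration (G := {b | FinInt μ fun x => D.upper t x ^ b})
    one_pos (by linarith : 0 ≤ 2 * u) ?_ ?_ ?_ hb hbu
  · simpa using finInt_const (μ := μ) 1
  · intro a b ha hab hG
    exact FinInt.rpow_of_le (D.upper_nonneg t) hG ha hab
  · intro b hb hG
    exact LpSub.finInt_step D hu0 h hb hG

/-- The field obtained from a nearly extremal one by prescribing its energy. -/
theorem exists_field_energy_le (t : ℝ) {e : X → ℝ} (he : AEMeasurable e μ) (he0 : ∀ x, 0 ≤ e x) :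
    ∃ η : X → E, AEStronglyMeasurable η μ ∧ (∀ x, ‖η x‖ = (e x * D.lower t x) ^ (1 / 2 : ℝ)) ∧
      ∀ᵐ x ∂μ, D.energy t x (η x) ≤ 2 * e x := by
  obtain ⟨w, hw, hw1, hw2⟩ := D.exists_unit_field t
  have hpos : ∀ x, 0 ≤ e x * D.lower t x := fun x => mul_nonneg (he0 x) (D.lower_nonneg t x)
  refine ⟨fun x => (((e x * D.lower t x) ^ (1 / 2 : ℝ) : ℝ) : ℂ) • w x,
    (Complex.continuous_ofReal.comp_aestronglyMeasurable
      ((he.mul (D.aemeasurable_lower t)).pow_const _).aestronglyMeasurable).smul hw,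
    fun x => ?_, hw2.mono fun x hx => ?_⟩
  · rw [norm_smul, hw1, mul_one, Complex.norm_real,
      Real.norm_of_nonneg (Real.rpow_nonneg (hpos x) _)]
  · rw [energy_smul, Complex.norm_real, Real.norm_of_nonneg (Real.rpow_nonneg (hpos x) _),
      ← Real.sqrt_eq_rpow, Real.sq_sqrt (hpos x), mul_assoc, mul_comm 2]
    exact mul_le_mul_of_nonneg_left hx (he0 x)

/-- Test on a nearly extremal field of energy about L^b. Its squared norm is L^{b+1}, so its power
1/v is L^{(b+1)/(2v)}. -/
theorem SubLp.finInt_step {t v : ℝ} (hv : 0 < v) (h : D.SubLp t (ENNReal.ofReal v)⁻¹) {b : ℝ}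
    (hb : 0 ≤ b) (hL : FinInt μ fun x => D.lower t x ^ b) :
    FinInt μ fun x => D.lower t x ^ (1 / (2 * v) + 1 / (2 * v) * b) := by
  obtain ⟨η, hη, hηn, hηe⟩ := D.exists_field_energy_le t
    ((D.aemeasurable_lower t).pow_const b) fun x => Real.rpow_nonneg (D.lower_nonneg t x) _
  have := (memLp_inv_ofReal_iff hv).1 (h η ⟨hη, (hL.const_mul zero_le_two).mono hηe⟩)
  refine this.2.mono (Eventually.of_forall fun x => le_of_eq ?_)
  have hx := D.lower_pos t x
  rw [hηn, ← Real.rpow_add_one hx.ne', ← Real.rpow_mul hx.le, ← Real.rpow_mul hx.le]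
  congr 1
  field_simp
  ring

theorem SubLp.finInt {t v : ℝ} (hv : 0 < v) (h : D.SubLp t (ENNReal.ofReal v)⁻¹) {b : ℝ}
    (hb : 0 ≤ b) (hbv : b * (2 * v - 1) < 1) : FinInt μ fun x => D.lower t x ^ b := by
  refine mem_of_affine_iteration (G := {b | FinInt μ fun x => D.lower t x ^ b})
    (by positivity : 0 < 1 / (2 * v)) (by positivity : 0 ≤ 1 / (2 * v)) ?_ ?_ ?_ hb ?_
  · simpa using finInt_const (μ := μ) 1
  · intro a b ha hab hG
    exact FinInt.rpow_of_le (D.lower_nonneg t) hG ha hab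
  · intro b hb hG
    exact SubLp.finInt_step D hv h hb hG
  · rw [lt_div_iff₀ (by positivity)]
    calc b * (1 - 1 / (2 * v)) * (2 * v) = b * (2 * v - 1) := by field_simp
      _ < 1 := hbv

/-! #### Interpolation of the inclusions -/

/-- Rescale η pointwise by two powers of its norm so that it falls into each of the two Lebesgue
spaces. Log-convexity of the energy recombines the two finite energies into that of η. -/
theorem LpSub.interp {s r u₀ u₁ θ : ℝ} (h0 : 0 ≤ θ) (h1 : θ ≤ 1) (hu₀ : 0 ≤ u₀) (hu₁ : 0 ≤ u₁)
    (hs : D.LpSub s (ENNReal.ofReal u₀)⁻¹) (hr : D.LpSub r (ENNReal.ofReal u₁)⁻¹) :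
    D.LpSub ((1 - θ) * s + θ * r) (ENNReal.ofReal ((1 - θ) * u₀ + θ * u₁))⁻¹ := by
  intro η hη
  refine ⟨hη.1, ?_⟩
  set u := (1 - θ) * u₀ + θ * u₁ with hu
  have hu0 : 0 ≤ u := add_nonneg (mul_nonneg (by linarith) hu₀) (mul_nonneg h0 hu₁)
  -- The powers are u₀/u and u₁/u. If u = 0, the field is bounded and no rescaling is needed because
  -- the measure is finite.
  obtain ⟨ρ₀, ρ₁, hρ, hmem₀, hmem₁⟩ : ∃ ρ₀ ρ₁ : ℝ, (1 - θ) * ρ₀ + θ * ρ₁ = 1 ∧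
      MemLp (fun x => ((‖η x‖ ^ (ρ₀ - 1) : ℝ) : ℂ) • η x) (ENNReal.ofReal u₀)⁻¹ μ ∧
      MemLp (fun x => ((‖η x‖ ^ (ρ₁ - 1) : ℝ) : ℂ) • η x) (ENNReal.ofReal u₁)⁻¹ μ := by
    rcases hu0.eq_or_lt with h | h
    · rw [← h] at hη
      simp only [ENNReal.ofReal_zero, ENNReal.inv_zero] at hη
      refine ⟨1, 1, by ring, ?_, ?_⟩ <;>
      · simp only [sub_self, Real.rpow_zero, Complex.ofReal_one, one_smul]
        exact hη.mono_exponent le_top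
    · refine ⟨u₀ / u, u₁ / u, ?_, ?_⟩
      · rw [hu] at h ⊢
        field_simp
      have key : ∀ u', 0 ≤ u' →
          MemLp (fun x => ((‖η x‖ ^ (u' / u - 1) : ℝ) : ℂ) • η x) (ENNReal.ofReal u')⁻¹ μ := by
        intro u' hu'
        have hm : AEStronglyMeasurable (fun x => ((‖η x‖ ^ (u' / u - 1) : ℝ) : ℂ) • η x) μ :=
          (Complex.continuous_ofReal.comp_aestronglyMeasurable
            (hη.1.norm.aemeasurable.pow_const _).aestronglyMeasurable).smul hη.1
        have hn : ∀ x, ‖((‖η x‖ ^ (u' / u - 1) : ℝ) : ℂ) • η x‖ ≤ ‖η x‖ ^ (u' / u) := by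
          intro x
          rw [norm_smul, Complex.norm_real,
            Real.norm_of_nonneg (Real.rpow_nonneg (norm_nonneg _) _)]
          rcases (norm_nonneg (η x)).eq_or_lt with h | h
          · rw [← h, mul_zero]; positivity
          · rw [← Real.rpow_add_one h.ne', sub_add_cancel]
        rcases hu'.eq_or_lt with rfl | hu'
        · simp only [ENNReal.ofReal_zero, ENNReal.inv_zero]
          refine memLp_top_of_bound hm 1 (Eventually.of_forall fun x => (hn x).trans ?_)
          simp
        · rw [memLp_inv_ofReal_iff hu']
          refine ⟨hm, ((memLp_inv_ofReal_iff h).1 hη).2.mono (Eventually.of_forall fun x => ?_)⟩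
          refine (Real.rpow_le_rpow (norm_nonneg _) (hn x) (by positivity)).trans (le_of_eq ?_)
          rw [← Real.rpow_mul (norm_nonneg _)]
          congr 1
          field_simp
      exact ⟨key u₀ hu₀, key u₁ hu₁⟩
  have hF₀ := hs _ hmem₀
  have hF₁ := hr _ hmem₁
  refine (hF₀.2.add hF₁.2 (D.aemeasurable_energy s hF₀.1)).mono (Eventually.of_forall fun x => ?_)
  have hθ : 0 ≤ 1 - θ := by linarith
  refine le_trans ?_ (rpow_mul_rpow_le_add (s := 1 - θ) (t := θ) (D.energy_nonneg _ _ _)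
    (D.energy_nonneg _ _ _) hθ h0 (by ring))
  refine (D.energy_le_rpow_mul_rpow h0 h1 s r x _).trans ?_
  rcases eq_or_ne (η x) 0 with h | h
  · simp [h]
  have hn : 0 < ‖η x‖ := norm_pos_iff.2 h
  have hEs := D.energy_nonneg s x (η x)
  have hEr := D.energy_nonneg r x (η x)
  rw [energy_smul, energy_smul, Complex.norm_real, Complex.norm_real,
    Real.norm_of_nonneg (by positivity), Real.norm_of_nonneg (by positivity),
    Real.mul_rpow (by positivity) hEs, Real.mul_rpow (by positivity) hEr, mul_mul_mul_comm]
  refine le_of_eq ?_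
  have : ((‖η x‖ ^ (ρ₀ - 1)) ^ 2) ^ (1 - θ) * ((‖η x‖ ^ (ρ₁ - 1)) ^ 2) ^ θ = 1 := by
    rw [← Real.rpow_natCast, ← Real.rpow_natCast, ← Real.rpow_mul hn.le, ← Real.rpow_mul hn.le,
      ← Real.rpow_mul hn.le, ← Real.rpow_mul hn.le, ← Real.rpow_add hn]
    have : (ρ₀ - 1) * ((2 : ℕ) : ℝ) * (1 - θ) + (ρ₁ - 1) * ((2 : ℕ) : ℝ) * θ = 0 := by
      push_cast
      linear_combination 2 * hρ
    rw [this, Real.rpow_zero]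
  rw [this, one_mul]

/-- η itself need not have finite energy at s or r. Its energy density at t is transplanted to
nearly extremal fields at s and r, and log-convexity of `lower` compares η with them. -/
theorem SubLp.interp {s r v₀ v₁ θ : ℝ} (h0 : 0 ≤ θ) (h1 : θ ≤ 1) (hv₀ : 0 < v₀) (hv₁ : 0 < v₁)
    (hs : D.SubLp s (ENNReal.ofReal v₀)⁻¹) (hr : D.SubLp r (ENNReal.ofReal v₁)⁻¹) :
    D.SubLp ((1 - θ) * s + θ * r) (ENNReal.ofReal ((1 - θ) * v₀ + θ * v₁))⁻¹ := by
  intro η hη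
  set t := (1 - θ) * s + θ * r with ht
  set v := (1 - θ) * v₀ + θ * v₁ with hv
  have hθ : 0 ≤ 1 - θ := by linarith
  have hv0 : 0 < v := by
    rcases h0.eq_or_lt with rfl | h
    · simpa [hv] using hv₀
    · have := mul_pos h hv₁
      have := mul_nonneg hθ hv₀.le
      linarith
  -- The comparison field has p-energy at most twice the t-energy of η, and squared norm equal to
  -- that t-energy times L_p.
  have key : ∀ {p v'}, 0 < v' → D.SubLp p (ENNReal.ofReal v')⁻¹ →
      FinInt μ fun x => (D.energy t x (η x) * D.lower p x) ^ (1 / (2 * v')) := by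
    intro p v' hv' h
    obtain ⟨ξ, hξ, hξn, hξe⟩ := D.exists_field_energy_le p (D.aemeasurable_energy t hη.1)
      fun x => D.energy_nonneg _ _ _
    have := (memLp_inv_ofReal_iff hv').1 (h ξ ⟨hξ, (hη.2.const_mul zero_le_two).mono hξe⟩)
    refine this.2.mono (Eventually.of_forall fun x => le_of_eq ?_)
    rw [hξn, ← Real.rpow_mul (mul_nonneg (D.energy_nonneg _ _ _) (D.lower_nonneg _ _))]
    congr 1
    field_simp
  rw [memLp_inv_ofReal_iff hv0]
  refine ⟨hη.1, ((key hv₀ hs).add (key hv₁ hr) (((D.aemeasurable_energy t hη.1).mul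
    (D.aemeasurable_lower s)).pow_const _)).mono (Eventually.of_forall fun x => ?_)⟩
  have hE := D.energy_nonneg t x (η x)
  have hLs := D.lower_nonneg s x
  have hLr := D.lower_nonneg r x
  refine le_trans ?_ (rpow_mul_rpow_le_add (s := (1 - θ) * v₀ / v) (t := θ * v₁ / v)
    (by positivity) (by positivity) (by positivity) (by positivity)
    (by rw [← add_div, ← hv, div_self hv0.ne']))
  rw [← Real.rpow_mul (by positivity), ← Real.rpow_mul (by positivity)]
  calc ‖η x‖ ^ (1 / v) = (‖η x‖ ^ 2) ^ (1 / (2 * v)) := by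
        rw [← Real.rpow_natCast, ← Real.rpow_mul (norm_nonneg _)]
        congr 1
        field_simp
        norm_num
    _ ≤ (D.lower s x ^ (1 - θ) * D.lower r x ^ θ * D.energy t x (η x)) ^ (1 / (2 * v)) :=
        Real.rpow_le_rpow (sq_nonneg _) (D.norm_sq_le_lower_rpow h0 h1 s r x _) (by positivity)
    _ = ((D.energy t x (η x) * D.lower s x) ^ (1 - θ) *
          (D.energy t x (η x) * D.lower r x) ^ θ) ^ (1 / (2 * v)) := by
        rw [Real.mul_rpow hE hLs, Real.mul_rpow hE hLr, mul_mul_mul_comm,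
          ← Real.rpow_add_of_nonneg hE hθ h0, sub_add_cancel, Real.rpow_one,
          mul_comm (D.energy t x (η x))]
    _ = _ := by
        rw [Real.mul_rpow (by positivity) (by positivity), ← Real.rpow_mul (by positivity),
          ← Real.rpow_mul (by positivity)]
        congr 2 <;> field_simp

/-! #### Extrapolation of the inclusions -/

/-- Insert into `upper_le` the integrability of U_t^b for b < 1/(1-2u) and of L_r^b for b < 1, and
apply Hölder. The loss θ vanishes as t tends to s. -/
theorem LpSub.extrap {s r u u' θ : ℝ} (h0 : 0 < θ) (h1 : θ < 1) (hu : 0 ≤ u) (hu2 : u ≤ 1 / 2)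
    (hu' : 0 ≤ u') (ht : D.LpSub ((1 - θ) * s + θ * r) (ENNReal.ofReal u)⁻¹) (hr : D.SubLp r 1)
    (hlt : (1 - 2 * u) + θ < (1 - θ) * (1 - 2 * u')) : D.LpSub s (ENNReal.ofReal u')⁻¹ := by
  have hθ : 0 < 1 - θ := by linarith
  have hu'2 : u' < 1 / 2 := by nlinarith
  set κ := (1 - θ) * (1 - 2 * u') with hκ
  -- Half of the slack in the hypothesis goes to each factor, so that A > 1 - 2u and B > 1 strictly
  -- while A + θB = κ, as Hölder requires.
  set ε := (κ - (1 - 2 * u) - θ) / 2 with hε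
  have hε0 : 0 < ε := by rw [hε]; linarith
  set A := 1 - 2 * u + ε with hA
  set B := 1 + ε / θ with hB
  have hA0 : 0 < A := by rw [hA]; linarith
  have hB1 : 1 < B := by rw [hB]; have := div_pos hε0 h0; linarith
  have hκAB : A + θ * B = κ := by rw [hA, hB]; field_simp; rw [hε]; ring
  have hκ0 : 0 < κ := by rw [← hκAB]; positivity
  refine D.lpSub_of_finInt hu' hu'2 ?_
  have hUt := LpSub.finInt D hu ht (b := 1 / A) (by positivity)
    (by rw [one_div, inv_mul_lt_iff₀ hA0]; linarith)
  have hr' : D.SubLp r (ENNReal.ofReal 1)⁻¹ := by simpa using hr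
  have hLr := SubLp.finInt D one_pos hr' (b := 1 / B) (by positivity)
    (by norm_num; exact inv_lt_one_of_one_lt₀ hB1)
  refine (hUt.add hLr ((D.aemeasurable_upper _).pow_const _)).mono
    (Eventually.of_forall fun x => ?_)
  have hU := D.upper_pos ((1 - θ) * s + θ * r) x
  have hL := D.lower_pos r x
  refine le_trans ?_ (rpow_mul_rpow_le_add (s := A / κ) (t := θ * B / κ)
    (by positivity) (by positivity) (by positivity) (by positivity)
    (by rw [← add_div, hκAB, div_self hκ0.ne']))
  have h2u : 0 < 1 - 2 * u' := by linarith
  calc D.upper s x ^ (1 / (1 - 2 * u'))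
      ≤ ((D.upper ((1 - θ) * s + θ * r) x * D.lower r x ^ θ) ^ (1 / (1 - θ))) ^
          (1 / (1 - 2 * u')) :=
        Real.rpow_le_rpow (D.upper_nonneg _ _) (D.upper_le h0.le h1 s r x) (by positivity)
    _ = _ := by
        rw [← Real.rpow_mul (by positivity), ← Real.rpow_mul (by positivity),
          ← Real.rpow_mul (by positivity), Real.mul_rpow hU.le (by positivity),
          ← Real.rpow_mul hL.le]
        congr 2
        · rw [hκ]; field_simp
        · rw [hκ]; field_simp

/-- The same argument with the roles of `upper` and `lower` exchanged, based on `lower_le_rpow`. -/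
theorem SubLp.extrap {s r v v' θ : ℝ} (h0 : 0 < θ) (h1 : θ < 1) (hv : 1 / 2 ≤ v)
    (ht : D.SubLp ((1 - θ) * s + θ * r) (ENNReal.ofReal v)⁻¹) (hr : D.LpSub r ∞)
    (hlt : (2 * v - 1) + θ < (1 - θ) * (2 * v' - 1)) : D.SubLp s (ENNReal.ofReal v')⁻¹ := by
  have hθ : 0 < 1 - θ := by linarith
  have hv'2 : 1 / 2 < v' := by nlinarith
  set κ := (1 - θ) * (2 * v' - 1) with hκ
  set ε := (κ - (2 * v - 1) - θ) / 2 with hε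
  have hε0 : 0 < ε := by rw [hε]; linarith
  set A := 2 * v - 1 + ε with hA
  set B := 1 + ε / θ with hB
  have hA0 : 0 < A := by rw [hA]; linarith
  have hB1 : 1 < B := by rw [hB]; have := div_pos hε0 h0; linarith
  have hκAB : A + θ * B = κ := by rw [hA, hB]; field_simp; rw [hε]; ring
  have hκ0 : 0 < κ := by rw [← hκAB]; positivity
  refine D.subLp_of_finInt hv'2 ?_
  have hLt := SubLp.finInt D (by linarith) ht (b := 1 / A) (by positivity)
    (by rw [one_div, inv_mul_lt_iff₀ hA0]; linarith)
  have hr' : D.LpSub r (ENNReal.ofReal 0)⁻¹ := by simpa using hr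
  have hUr := LpSub.finInt D le_rfl hr' (b := 1 / B) (by positivity)
    (by norm_num; exact inv_lt_one_of_one_lt₀ hB1)
  refine (hLt.add hUr ((D.aemeasurable_lower _).pow_const _)).mono
    (Eventually.of_forall fun x => ?_)
  have hL := D.lower_pos ((1 - θ) * s + θ * r) x
  have hU := D.upper_pos r x
  refine le_trans ?_ (rpow_mul_rpow_le_add (s := A / κ) (t := θ * B / κ)
    (by positivity) (by positivity) (by positivity) (by positivity)
    (by rw [← add_div, hκAB, div_self hκ0.ne']))
  have h2v : 0 < 2 * v' - 1 := by linarith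
  calc D.lower s x ^ (1 / (2 * v' - 1))
      ≤ ((D.lower ((1 - θ) * s + θ * r) x * D.upper r x ^ θ) ^ (1 / (1 - θ))) ^
          (1 / (2 * v' - 1)) :=
        Real.rpow_le_rpow (D.lower_nonneg _ _) (D.lower_le_rpow h0.le h1 s r x) (by positivity)
    _ = _ := by
        rw [← Real.rpow_mul (by positivity), ← Real.rpow_mul (by positivity),
          ← Real.rpow_mul (by positivity), Real.mul_rpow hL.le (by positivity),
          ← Real.rpow_mul hU.le]
        congr 2
        · rw [hκ]; field_simp
        · rw [hκ]; field_simp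

end SpectralField

/-! ### Continuity of the optimal exponents -/

/-- Convexity gives continuity inside and the chord as upper bound near the endpoints. The two
hypotheses are exactly the missing lower bounds there. -/
theorem continuousOn_Icc_of_convexOn {f : ℝ → ℝ} (hf : ConvexOn ℝ (Icc 0 1) f)
    (h0 : ∀ t ∈ Ioo (0 : ℝ) 1, (1 - t) * f 0 ≤ f t + t)
    (h1 : ∀ t ∈ Ioo (0 : ℝ) 1, t * f 1 ≤ f t + (1 - t)) : ContinuousOn f (Icc 0 1) := by
  have hup : ∀ t ∈ Icc (0 : ℝ) 1, f t ≤ (1 - t) * f 0 + t * f 1 := by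
    intro t ht
    have hconv := hf.2
    have := @hconv 0 (left_mem_Icc.2 zero_le_one) 1 (right_mem_Icc.2 zero_le_one)
      (1 - t) t (by linarith [ht.2]) ht.1 (by ring)
    simpa using this
  have hint := (hf.subset Ioo_subset_Icc_self (convex_Ioo 0 1)).continuousOn isOpen_Ioo
  intro t ht
  rcases ht.1.eq_or_lt with rfl | ht0
  · have hl : Tendsto (fun t : ℝ => (1 - t) * f 0 - t) (𝓝[Icc 0 1] 0) (𝓝 (f 0)) := by
      have : Continuous fun t : ℝ => (1 - t) * f 0 - t := by fun_prop
      simpa using (this.tendsto 0).mono_left nhdsWithin_le_nhds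
    have hu : Tendsto (fun t : ℝ => (1 - t) * f 0 + t * f 1) (𝓝[Icc 0 1] 0) (𝓝 (f 0)) := by
      have : Continuous fun t : ℝ => (1 - t) * f 0 + t * f 1 := by fun_prop
      simpa using (this.tendsto 0).mono_left nhdsWithin_le_nhds
    refine tendsto_of_tendsto_of_tendsto_of_le_of_le' hl hu ?_ ?_
    · have hlt : ∀ᶠ t : ℝ in 𝓝[Icc 0 1] 0, t < 1 :=
        nhdsWithin_le_nhds (Iio_mem_nhds zero_lt_one)
      filter_upwards [hlt, self_mem_nhdsWithin] with t h1' ht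
      rcases ht.1.eq_or_lt with rfl | h
      · simp
      · linarith [h0 t ⟨h, h1'⟩]
    · filter_upwards [self_mem_nhdsWithin] with t ht using hup t ht
  rcases ht.2.eq_or_lt with rfl | ht1
  · have hl : Tendsto (fun t : ℝ => t * f 1 - (1 - t)) (𝓝[Icc 0 1] 1) (𝓝 (f 1)) := by
      have : Continuous fun t : ℝ => t * f 1 - (1 - t) := by fun_prop
      simpa using (this.tendsto 1).mono_left nhdsWithin_le_nhds
    have hu : Tendsto (fun t : ℝ => (1 - t) * f 0 + t * f 1) (𝓝[Icc 0 1] 1) (𝓝 (f 1)) := by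
      have : Continuous fun t : ℝ => (1 - t) * f 0 + t * f 1 := by fun_prop
      simpa using (this.tendsto 1).mono_left nhdsWithin_le_nhds
    refine tendsto_of_tendsto_of_tendsto_of_le_of_le' hl hu ?_ ?_
    · have hlt : ∀ᶠ t : ℝ in 𝓝[Icc 0 1] 1, 0 < t :=
        nhdsWithin_le_nhds (Ioi_mem_nhds zero_lt_one)
      filter_upwards [hlt, self_mem_nhdsWithin] with t h1' ht
      rcases ht.2.eq_or_lt with rfl | h
      · simp
      · linarith [h1 t ⟨h1', h⟩]
    · filter_upwards [self_mem_nhdsWithin] with t ht using hup t ht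
  · exact (hint.continuousAt (Ioo_mem_nhds ht0 ht1)).continuousWithinAt

theorem eq_ofReal_inv_toReal {p : ℝ≥0∞} (hp : p ≠ 0) : p = (ENNReal.ofReal (p⁻¹).toReal)⁻¹ := by
  rw [ENNReal.ofReal_toReal (ENNReal.inv_ne_top.2 hp), inv_inv]

theorem sInf_inv_eq {P : ℝ≥0∞ → Prop} {s : ℝ} (hs : IsLUB {u : ℝ | 0 ≤ u ∧ u ≤ 1 / 2 ∧
    P (ENNReal.ofReal u)⁻¹} s) : sInf {p | 2 ≤ p ∧ P p} = (ENNReal.ofReal s)⁻¹ := by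
  refine le_antisymm ?_ (le_sInf ?_)
  · rw [← inv_inv (sInf _), ENNReal.inv_le_inv]
    rcases eq_or_ne (sInf {p | 2 ≤ p ∧ P p})⁻¹ ∞ with h | h
    · rw [h]; exact le_top
    rw [ENNReal.ofReal_le_iff_le_toReal h]
    refine hs.2 fun u hu => ?_
    rw [← ENNReal.ofReal_le_iff_le_toReal h, ENNReal.le_inv_iff_le_inv]
    refine sInf_le ⟨?_, hu.2.2⟩
    rw [ENNReal.le_inv_iff_le_inv]
    refine (ENNReal.ofReal_le_ofReal hu.2.1).trans (le_of_eq ?_)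
    rw [one_div, ENNReal.ofReal_inv_of_pos two_pos]
    simp
  · rintro p ⟨hp, hP⟩
    have hp0 : p ≠ 0 := (zero_lt_two.trans_le hp).ne'
    rw [ENNReal.inv_le_iff_inv_le]
    have hpt : p⁻¹ ≠ ∞ := ENNReal.inv_ne_top.2 hp0
    rw [← ENNReal.ofReal_toReal hpt]
    refine ENNReal.ofReal_le_ofReal (hs.1 ⟨ENNReal.toReal_nonneg, ?_, ?_⟩)
    · rw [← ENNReal.toReal_ofReal (by norm_num : (0 : ℝ) ≤ 1 / 2)]
      refine ENNReal.toReal_mono ENNReal.ofReal_ne_top ?_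
      rw [one_div, ENNReal.ofReal_inv_of_pos two_pos, ENNReal.inv_le_inv]
      simpa using hp
    · rwa [← eq_ofReal_inv_toReal hp0]

theorem sSup_inv_eq {P : ℝ≥0∞ → Prop} {s : ℝ} (hs0 : 0 ≤ s) (hs : IsGLB {v : ℝ | 1 / 2 ≤ v ∧ v ≤ 1 ∧
    P (ENNReal.ofReal v)⁻¹} s) : sSup {q | 1 ≤ q ∧ q ≤ 2 ∧ P q} = (ENNReal.ofReal s)⁻¹ := by
  refine le_antisymm (sSup_le ?_) ?_
  · rintro q ⟨hq1, hq2, hP⟩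
    have hq0 : q ≠ 0 := (zero_lt_one.trans_le hq1).ne'
    rw [ENNReal.le_inv_iff_le_inv]
    have hqt : q⁻¹ ≠ ∞ := ENNReal.inv_ne_top.2 hq0
    rw [← ENNReal.ofReal_toReal hqt]
    refine ENNReal.ofReal_le_ofReal (hs.1 ⟨?_, ?_, ?_⟩)
    · rw [← ENNReal.toReal_ofReal (by norm_num : (0 : ℝ) ≤ 1 / 2)]
      refine ENNReal.toReal_mono hqt ?_
      rw [one_div, ENNReal.ofReal_inv_of_pos two_pos, ENNReal.inv_le_inv]
      simpa using hq2
    · rw [← ENNReal.toReal_one]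
      exact ENNReal.toReal_mono ENNReal.one_ne_top (ENNReal.inv_le_one.2 hq1)
    · rwa [← eq_ofReal_inv_toReal hq0]
  · set S := sSup {q | 1 ≤ q ∧ q ≤ 2 ∧ P q} with hS
    rw [ENNReal.inv_le_iff_inv_le]
    rcases eq_or_ne S⁻¹ ∞ with h | h
    -- Here the supremum is 0, so no exponent is admissible; but the empty set has no greatest lower
    -- bound in ℝ.
    · by_contra hcon
      have hempty : {v : ℝ | 1 / 2 ≤ v ∧ v ≤ 1 ∧ P (ENNReal.ofReal v)⁻¹} = ∅ := by
        rw [eq_empty_iff_forall_notMem]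
        rintro v ⟨hv1, hv2, hP⟩
        have hle : (ENNReal.ofReal v)⁻¹ ≤ S := by
          refine le_sSup ⟨?_, ?_, hP⟩
          · rw [ENNReal.one_le_inv]; simpa using hv2
          · rw [ENNReal.inv_le_iff_inv_le]
            refine le_trans (le_of_eq ?_) (ENNReal.ofReal_le_ofReal hv1)
            rw [one_div, ENNReal.ofReal_inv_of_pos two_pos]
            simp
        rw [ENNReal.inv_eq_top] at h
        rw [h] at hle
        simp at hle
      rw [hempty] at hs
      have : s + 1 ≤ s := hs.2 (by simp)
      linarith
    · rw [← ENNReal.ofReal_toReal h]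
      refine ENNReal.ofReal_le_ofReal (hs.2 fun v hv => ?_)
      have hv0 : 0 ≤ v := by linarith [hv.1]
      rw [← ENNReal.toReal_ofReal hv0]
      refine ENNReal.toReal_mono ENNReal.ofReal_ne_top ?_
      rw [ENNReal.inv_le_iff_inv_le]
      refine le_sSup ⟨?_, ?_, hv.2.2⟩
      · rw [ENNReal.one_le_inv]; simpa using hv.2.1
      · rw [ENNReal.inv_le_iff_inv_le]
        refine le_trans (le_of_eq ?_) (ENNReal.ofReal_le_ofReal hv.1)
        rw [one_div, ENNReal.ofReal_inv_of_pos two_pos]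
        simp

namespace SpectralField

variable {X : Type*} [MeasurableSpace X] {μ : Measure X} {E : Type*} [NormedAddCommGroup E]
  [NormedSpace ℂ E] {N : ℕ} (D : SpectralField μ E N)

variable [IsFiniteMeasure μ] [FiniteDimensional ℂ E] [Nontrivial E]

/-- With u = 1/p, interpolation makes 1 - 2 sup u convex in t, and extrapolation provides the
endpoint bounds of `continuousOn_Icc_of_convexOn`. -/
theorem continuousOn_sInf_lpSub (h0 : D.LpSub 0 ∞) (h1 : D.LpSub 1 ∞) (h0' : D.SubLp 0 1)
    (h1' : D.SubLp 1 1) :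
    ContinuousOn (fun t => sInf {p | 2 ≤ p ∧ D.LpSub t p}) (Icc 0 1) := by
  let U : ℝ → Set ℝ := fun t => {u : ℝ | 0 ≤ u ∧ u ≤ 1 / 2 ∧ D.LpSub t (ENNReal.ofReal u)⁻¹}
  have hbdd : ∀ t, BddAbove (U t) := fun t => ⟨1 / 2, fun u hu => hu.2.1⟩
  have hne : ∀ t ∈ Icc (0 : ℝ) 1, (U t).Nonempty := by
    intro t ht
    refine ⟨0, le_rfl, by norm_num, ?_⟩
    have := LpSub.interp D ht.1 ht.2 (s := 0) (r := 1) (u₀ := 0) (u₁ := 0) le_rfl le_rfl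
      (by simpa using h0) (by simpa using h1)
    simpa using this
  have hconc : ConvexOn ℝ (Icc 0 1) fun t => 1 - 2 * sSup (U t) := by
    refine ⟨convex_Icc 0 1, fun s hs r hr a b ha hb hab => ?_⟩
    have hc : a • s + b • r = (1 - b) * s + b * r := by
      rw [← hab]; simp
    have hmem := convex_Icc (0 : ℝ) 1 hs hr ha hb hab
    have h : a * sSup (U s) + b * sSup (U r) ≤ sSup (U (a • s + b • r)) := by
      have hstep : ∀ u₀ ∈ U s, ∀ u₁ ∈ U r, a * u₀ + b * u₁ ≤ sSup (U (a • s + b • r)) := by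
        intro u₀ hu₀ u₁ hu₁
        refine le_csSup (hbdd _) ⟨?_, ?_, ?_⟩
        · have := mul_nonneg ha hu₀.1
          have := mul_nonneg hb hu₁.1
          linarith
        · have := mul_le_mul_of_nonneg_left hu₀.2.1 ha
          have := mul_le_mul_of_nonneg_left hu₁.2.1 hb
          nlinarith
        · have := LpSub.interp D hb (by linarith) hu₀.1 hu₁.1 hu₀.2.2 hu₁.2.2
          rw [hc]
          rwa [show a = 1 - b by linarith]
      have h2 : ∀ u₁ ∈ U r, a * sSup (U s) + b * u₁ ≤ sSup (U (a • s + b • r)) := by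
        intro u₁ hu₁
        rcases ha.eq_or_lt with rfl | ha
        · obtain ⟨u₀, hu₀⟩ := hne s hs
          simpa using hstep u₀ hu₀ u₁ hu₁
        · have : sSup (U s) ≤ (sSup (U (a • s + b • r)) - b * u₁) / a :=
            csSup_le (hne s hs) fun u₀ hu₀ => by
              rw [le_div_iff₀ ha]; linarith [hstep u₀ hu₀ u₁ hu₁]
          rw [le_div_iff₀ ha] at this
          linarith
      rcases hb.eq_or_lt with rfl | hb
      · obtain ⟨u₁, hu₁⟩ := hne r hr
        simpa using h2 u₁ hu₁
      · have : sSup (U r) ≤ (sSup (U (a • s + b • r)) - a * sSup (U s)) / b :=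
          csSup_le (hne r hr) fun u₁ hu₁ => by
            rw [le_div_iff₀ hb]; linarith [h2 u₁ hu₁]
        rw [le_div_iff₀ hb] at this
        linarith
    simp only [smul_eq_mul] at h ⊢
    nlinarith
  have hSnn : ∀ t ∈ Icc (0 : ℝ) 1, 0 ≤ sSup (U t) := by
    intro t ht
    obtain ⟨u, hu⟩ := hne t ht
    exact hu.1.trans (le_csSup (hbdd t) hu)
  have hend : ∀ s r θ : ℝ, s ∈ Icc (0 : ℝ) 1 → (1 - θ) * s + θ * r ∈ Icc (0 : ℝ) 1 →
      D.SubLp r 1 → θ ∈ Ioo (0 : ℝ) 1 →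
      (1 - θ) * (1 - 2 * sSup (U s)) ≤ (1 - 2 * sSup (U ((1 - θ) * s + θ * r))) + θ := by
    intro s r θ hs ht hr hθ
    have hθ' : 0 < 1 - θ := by linarith [hθ.2]
    have key : ∀ u ∈ U ((1 - θ) * s + θ * r),
        (1 - θ) * (1 - 2 * sSup (U s)) ≤ (1 - 2 * u) + θ := by
      intro u hu
      by_contra! hcon
      -- Put c = (1-θ)(1-2u'). Extrapolation makes the reciprocal exponent u' admissible at s
      -- although it exceeds the supremum.
      obtain ⟨c, hc1, hc2⟩ := exists_between hcon
      have hu' : sSup (U s) < (1 - c / (1 - θ)) / 2 := by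
        have : c / (1 - θ) < 1 - 2 * sSup (U s) := by
          rw [div_lt_iff₀ hθ']; linarith
        linarith
      refine absurd hu' (not_lt.2 (le_csSup (hbdd s) ⟨(hSnn s hs).trans hu'.le, ?_, ?_⟩))
      · have : 0 ≤ c / (1 - θ) := div_nonneg (by linarith [hu.2.1, hθ.1]) hθ'.le
        linarith
      · refine LpSub.extrap D hθ.1 hθ.2 hu.1 hu.2.1 ((hSnn s hs).trans hu'.le) hu.2.2 hr ?_
        have : (1 - θ) * (1 - 2 * ((1 - c / (1 - θ)) / 2)) = c := by field_simp; ring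
        rw [this]
        exact hc1
    have : sSup (U ((1 - θ) * s + θ * r)) ≤
        (1 + θ - (1 - θ) * (1 - 2 * sSup (U s))) / 2 :=
      csSup_le (hne _ ht) fun u hu => by linarith [key u hu]
    linarith
  have hcont := continuousOn_Icc_of_convexOn hconc
    (fun t ht => by
      have := hend 0 1 t (by simp) (by simpa using Ioo_subset_Icc_self ht) h1' ht
      simpa using this)
    (fun t ht => by
      have := hend 1 0 (1 - t) (by simp) (by simpa using Ioo_subset_Icc_self ht) h0'
        ⟨by linarith [ht.2], by linarith [ht.1]⟩
      simpa using this)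
  have hS : ContinuousOn (fun t => sSup (U t)) (Icc 0 1) := by
    have := (continuousOn_const (c := (1 : ℝ)).sub hcont).div_const 2
    refine this.congr fun t _ => ?_
    simp
  refine ((ENNReal.continuous_ofReal.comp_continuousOn hS).inv).congr fun t ht => ?_
  exact sInf_inv_eq (isLUB_csSup (hne t ht) (hbdd t))

/-- The same scheme for v = 1/q, with the convex function 2 inf v - 1. -/
theorem continuousOn_sSup_subLp (h0 : D.LpSub 0 ∞) (h1 : D.LpSub 1 ∞) (h0' : D.SubLp 0 1)
    (h1' : D.SubLp 1 1) :
    ContinuousOn (fun t => sSup {q | 1 ≤ q ∧ q ≤ 2 ∧ D.SubLp t q}) (Icc 0 1) := by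
  let V : ℝ → Set ℝ := fun t => {v : ℝ | 1 / 2 ≤ v ∧ v ≤ 1 ∧ D.SubLp t (ENNReal.ofReal v)⁻¹}
  have hbdd : ∀ t, BddBelow (V t) := fun t => ⟨1 / 2, fun v hv => hv.1⟩
  have hne : ∀ t ∈ Icc (0 : ℝ) 1, (V t).Nonempty := by
    intro t ht
    refine ⟨1, by norm_num, le_rfl, ?_⟩
    have := SubLp.interp D ht.1 ht.2 (s := 0) (r := 1) (v₀ := 1) (v₁ := 1) one_pos one_pos
      (by simpa using h0') (by simpa using h1')
    simpa using this
  have hconc : ConvexOn ℝ (Icc 0 1) fun t => 2 * sInf (V t) - 1 := by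
    refine ⟨convex_Icc 0 1, fun s hs r hr a b ha hb hab => ?_⟩
    have hc : a • s + b • r = (1 - b) * s + b * r := by
      rw [← hab]; simp
    have h : sInf (V (a • s + b • r)) ≤ a * sInf (V s) + b * sInf (V r) := by
      have hstep : ∀ v₀ ∈ V s, ∀ v₁ ∈ V r, sInf (V (a • s + b • r)) ≤ a * v₀ + b * v₁ := by
        intro v₀ hv₀ v₁ hv₁
        refine csInf_le (hbdd _) ⟨?_, ?_, ?_⟩
        · have := mul_le_mul_of_nonneg_left hv₀.1 ha
          have := mul_le_mul_of_nonneg_left hv₁.1 hb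
          nlinarith
        · have := mul_le_mul_of_nonneg_left hv₀.2.1 ha
          have := mul_le_mul_of_nonneg_left hv₁.2.1 hb
          nlinarith
        · have := SubLp.interp D hb (by linarith) (by linarith [hv₀.1]) (by linarith [hv₁.1])
            hv₀.2.2 hv₁.2.2
          rw [hc]
          rwa [show a = 1 - b by linarith]
      have h2 : ∀ v₁ ∈ V r, sInf (V (a • s + b • r)) ≤ a * sInf (V s) + b * v₁ := by
        intro v₁ hv₁
        rcases ha.eq_or_lt with rfl | ha
        · obtain ⟨v₀, hv₀⟩ := hne s hs
          simpa using hstep v₀ hv₀ v₁ hv₁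
        · have : (sInf (V (a • s + b • r)) - b * v₁) / a ≤ sInf (V s) :=
            le_csInf (hne s hs) fun v₀ hv₀ => by
              rw [div_le_iff₀ ha]; linarith [hstep v₀ hv₀ v₁ hv₁]
          rw [div_le_iff₀ ha] at this
          linarith
      rcases hb.eq_or_lt with rfl | hb
      · obtain ⟨v₁, hv₁⟩ := hne r hr
        simpa using h2 v₁ hv₁
      · have : (sInf (V (a • s + b • r)) - a * sInf (V s)) / b ≤ sInf (V r) :=
          le_csInf (hne r hr) fun v₁ hv₁ => by
            rw [div_le_iff₀ hb]; linarith [h2 v₁ hv₁]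
        rw [div_le_iff₀ hb] at this
        linarith
    simp only [smul_eq_mul] at h ⊢
    nlinarith
  have hSnn : ∀ t ∈ Icc (0 : ℝ) 1, 1 / 2 ≤ sInf (V t) ∧ sInf (V t) ≤ 1 := by
    intro t ht
    obtain ⟨v, hv⟩ := hne t ht
    exact ⟨le_csInf (hne t ht) fun v hv => hv.1, (csInf_le (hbdd t) hv).trans hv.2.1⟩
  have hend : ∀ s r θ : ℝ, s ∈ Icc (0 : ℝ) 1 → (1 - θ) * s + θ * r ∈ Icc (0 : ℝ) 1 →
      D.LpSub r ∞ → θ ∈ Ioo (0 : ℝ) 1 →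
      (1 - θ) * (2 * sInf (V s) - 1) ≤ (2 * sInf (V ((1 - θ) * s + θ * r)) - 1) + θ := by
    intro s r θ hs ht hr hθ
    have hθ' : 0 < 1 - θ := by linarith [hθ.2]
    have key : ∀ v ∈ V ((1 - θ) * s + θ * r),
        (1 - θ) * (2 * sInf (V s) - 1) ≤ (2 * v - 1) + θ := by
      intro v hv
      by_contra! hcon
      obtain ⟨c, hc1, hc2⟩ := exists_between hcon
      have hv' : (1 + c / (1 - θ)) / 2 < sInf (V s) := by
        have : c / (1 - θ) < 2 * sInf (V s) - 1 := by
          rw [div_lt_iff₀ hθ']; linarith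
        linarith
      refine absurd hv' (not_lt.2 (csInf_le (hbdd s) ⟨?_, hv'.le.trans (hSnn s hs).2, ?_⟩))
      · have : 0 ≤ c / (1 - θ) := div_nonneg (by linarith [hv.1, hθ.1]) hθ'.le
        linarith
      · refine SubLp.extrap D hθ.1 hθ.2 hv.1 hv.2.2 hr ?_
        have : (1 - θ) * (2 * ((1 + c / (1 - θ)) / 2) - 1) = c := by field_simp; ring
        rw [this]
        exact hc1
    have : ((1 - θ) * (2 * sInf (V s) - 1) + 1 - θ) / 2 ≤ sInf (V ((1 - θ) * s + θ * r)) :=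
      le_csInf (hne _ ht) fun v hv => by linarith [key v hv]
    linarith
  have hcont := continuousOn_Icc_of_convexOn hconc
    (fun t ht => by
      have := hend 0 1 t (by simp) (by simpa using Ioo_subset_Icc_self ht) h1 ht
      simpa using this)
    (fun t ht => by
      have := hend 1 0 (1 - t) (by simp) (by simpa using Ioo_subset_Icc_self ht) h0
        ⟨by linarith [ht.2], by linarith [ht.1]⟩
      simpa using this)
  have hS : ContinuousOn (fun t => sInf (V t)) (Icc 0 1) := by
    have := (hcont.add (continuousOn_const (c := (1 : ℝ)))).div_const 2
    refine this.congr fun t _ => ?_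
    simp
  refine ((ENNReal.continuous_ofReal.comp_continuousOn hS).inv).congr fun t ht => ?_
  exact sSup_inv_eq (by linarith [(hSnn t ht).1]) (isGLB_csInf (hne t ht) (hbdd t))

end SpectralField

/-! ### Complex interpolation: upper bound of the interpolation norm -/

namespace SpectralField

variable {X : Type*} [MeasurableSpace X] {μ : Measure X} {E : Type*} [NormedAddCommGroup E]
  [NormedSpace ℂ E] {N : ℕ} (D : SpectralField μ E N)

/-- The energy norm on classes of measurable fields. -/
def fieldNorm (t : ℝ) (η : X →ₘ[μ] E) : ℝ≥0∞ :=
  (∫⁻ x, ENNReal.ofReal (D.energy t x (η x)) ∂μ) ^ (1 / 2 : ℝ)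

/-- The action of a multiplier on classes of measurable fields. -/
def multField {φ : ℝ → ℂ} (hφ : D.IsMeasMultiplier φ) (η : X →ₘ[μ] E) : X →ₘ[μ] E :=
  AEEqFun.mk (fun x => D.mult φ x (η x)) (hφ η η.aestronglyMeasurable)

theorem coeFn_multField {φ : ℝ → ℂ} (hφ : D.IsMeasMultiplier φ) (η : X →ₘ[μ] E) :
    D.multField hφ η =ᵐ[μ] fun x => D.mult φ x (η x) := AEEqFun.coeFn_mk _ _

theorem fieldNorm_multField {φ : ℝ → ℂ} (hφ : D.IsMeasMultiplier φ) (s : ℝ) (η : X →ₘ[μ] E) :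
    D.fieldNorm s (D.multField hφ η) =
      (∫⁻ x, ENNReal.ofReal (D.energy s x (D.mult φ x (η x))) ∂μ) ^ (1 / 2 : ℝ) := by
  unfold fieldNorm
  congr 1
  refine lintegral_congr_ae ?_
  filter_upwards [D.coeFn_multField hφ η] with x hx
  rw [hx]

theorem fieldNorm_multField_le {φ : ℝ → ℂ} (hφ : D.IsMeasMultiplier φ) {s t K : ℝ} (hK : 0 ≤ K)
    (h : ∀ r : ℝ, 0 < r → r ^ s * ‖φ r‖ ^ 2 ≤ K * r ^ t) (η : X →ₘ[μ] E) :
    D.fieldNorm s (D.multField hφ η) ≤ ENNReal.ofReal K ^ (1 / 2 : ℝ) * D.fieldNorm t η := by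
  rw [fieldNorm_multField, fieldNorm, ← ENNReal.mul_rpow_of_nonneg _ _ (by norm_num)]
  refine ENNReal.rpow_le_rpow ?_ (by norm_num)
  rw [← lintegral_const_mul' _ _ ENNReal.ofReal_ne_top]
  refine lintegral_mono fun x => ?_
  rw [← ENNReal.ofReal_mul hK]
  exact ENNReal.ofReal_le_ofReal (D.energy_mult_le s x _ h)

/-- Dominated convergence, with the energy of η at t as majorant. It reduces the limits in
Calderón's conditions to scalar bounds and scalar limits. -/
theorem tendsto_fieldNorm_multField {A : Type*} {l : Filter A} [l.IsCountablyGenerated]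
    {φ : A → ℝ → ℂ} (hφ : ∀ a, D.IsMeasMultiplier (φ a)) {s t K : ℝ}
    (hb : ∀ᶠ a in l, ∀ r : ℝ, 0 < r → r ^ s * ‖φ a r‖ ^ 2 ≤ K * r ^ t)
    (h0 : ∀ r : ℝ, 0 < r → Tendsto (fun a => φ a r) l (𝓝 0)) {η : X →ₘ[μ] E}
    (hη : D.fieldNorm t η < ∞) :
    Tendsto (fun a => D.fieldNorm s (D.multField (hφ a) η)) l (𝓝 0) := by
  simp only [fieldNorm_multField]
  have hfin : ∫⁻ x, ENNReal.ofReal (K * D.energy t x (η x)) ∂μ ≠ ∞ := by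
    have h1 : ∫⁻ x, ENNReal.ofReal (D.energy t x (η x)) ∂μ < ∞ := by
      by_contra h
      rw [not_lt_top_iff] at h
      rw [fieldNorm, h, ENNReal.top_rpow_of_pos (by norm_num)] at hη
      exact lt_irrefl _ hη
    refine ne_top_of_le_ne_top (ENNReal.mul_lt_top (ENNReal.ofReal_lt_top (r := |K|)) h1).ne ?_
    rw [← lintegral_const_mul' _ _ ENNReal.ofReal_ne_top]
    refine lintegral_mono fun x => ?_
    rw [← ENNReal.ofReal_mul (abs_nonneg K)]
    exact ENNReal.ofReal_le_ofReal
      (mul_le_mul_of_nonneg_right (le_abs_self K) (D.energy_nonneg _ _ _))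
  have hlim := tendsto_lintegral_filter_of_dominated_convergence' (μ := μ)
    (fun x => ENNReal.ofReal (K * D.energy t x (η x))) (l := l)
    (F := fun a x => ENNReal.ofReal (D.energy s x (D.mult (φ a) x (η x)))) (f := fun _ => 0)
    (Eventually.of_forall fun a => ?_) (hb.mono fun a ha => Eventually.of_forall fun x =>
      ENNReal.ofReal_le_ofReal (D.energy_mult_le s x _ ha)) hfin (Eventually.of_forall fun x => ?_)
  · rw [lintegral_zero] at hlim
    have := (ENNReal.continuous_rpow_const (y := (1 / 2 : ℝ))).tendsto 0 |>.comp hlim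
    rwa [ENNReal.zero_rpow_of_pos (by norm_num)] at this
  · exact (D.aemeasurable_energy s (hφ a η η.aestronglyMeasurable)).ennreal_ofReal
  · have : Tendsto (fun a => D.energy s x (D.mult (φ a) x (η x))) l (𝓝 0) := by
      simp only [energy_mult]
      have hj : ∀ j : Fin N, Tendsto (fun a => D.eig x j ^ s * ‖φ a (D.eig x j)‖ ^ 2 *
          ‖D.coord x (η x) j‖ ^ 2) l (𝓝 0) := by
        intro j
        have := (((h0 _ (D.eig_pos x j)).norm.pow 2).const_mul (D.eig x j ^ s)).mul_const
          (‖D.coord x (η x) j‖ ^ 2)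
        simpa using this
      simpa using tendsto_finsetSum Finset.univ fun j _ => hj j
    simpa using ENNReal.tendsto_ofReal this

theorem one_sub_exp_neg_sq_le {r : ℝ} (hr : 0 < r) : (1 - Real.exp (-r)) ^ 2 ≤ min 1 r := by
  have h1 : 1 - r ≤ Real.exp (-r) := by linarith [Real.add_one_le_exp (-r)]
  have h2 : Real.exp (-r) < 1 := Real.exp_lt_one_iff.2 (by linarith)
  have h3 := Real.exp_pos (-r)
  refine le_min ?_ ?_ <;> nlinarith

theorem mul_exp_neg_sq_le {r : ℝ} (hr : 0 < r) : r * Real.exp (-r) ^ 2 ≤ min 1 r := by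
  have h2 : Real.exp (-r) < 1 := Real.exp_lt_one_iff.2 (by linarith)
  have h3 := Real.exp_pos (-r)
  have h4 : r * Real.exp (-r) ≤ 1 := by
    have : r ≤ Real.exp r := by linarith [Real.add_one_le_exp r]
    calc r * Real.exp (-r) ≤ Real.exp r * Real.exp (-r) := by gcongr
      _ = 1 := by rw [← Real.exp_add]; simp
  refine le_min ?_ ?_
  · rw [sq, ← mul_assoc]; nlinarith
  · rw [sq]; nlinarith [mul_pos hr h3]

theorem isMeasMultiplier_one_sub_exp :
    D.IsMeasMultiplier fun r => ((1 - Real.exp (-r) : ℝ) : ℂ) :=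
  ((isMeasMultiplier_const 1).add ((isMeasMultiplier_const (-1)).mul
    isMeasMultiplier_exp_neg)).congr fun r _ => by push_cast; ring

/-- Split 1 = (1 - e^{-r}) + e^{-r}, a smooth separation of small and large weights that stays among
the measurable multipliers. Small weights are measured by the first norm and large ones by the
second only as far as min 1 r, which is what makes the sum norm tractable. -/
theorem sumNorm_multField_le {φ : ℝ → ℂ} (hφ : D.IsMeasMultiplier φ) (η : X →ₘ[μ] E) :
    sumNorm (D.fieldNorm 0) (D.fieldNorm 1) (D.multField hφ η) ≤
      D.fieldNorm 0 (D.multField (D.isMeasMultiplier_one_sub_exp.mul hφ) η) +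
      D.fieldNorm 1 (D.multField (isMeasMultiplier_exp_neg.mul hφ) η) := by
  refine iInf_le_of_le _ (iInf_le_of_le _ (iInf_le_of_le ?_ le_rfl))
  refine AEEqFun.ext ?_
  filter_upwards [AEEqFun.coeFn_add (D.multField (D.isMeasMultiplier_one_sub_exp.mul hφ) η)
    (D.multField (isMeasMultiplier_exp_neg.mul hφ) η), D.coeFn_multField hφ η,
    D.coeFn_multField (D.isMeasMultiplier_one_sub_exp.mul hφ) η,
    D.coeFn_multField (isMeasMultiplier_exp_neg.mul hφ) η] with x h1 h2 h3 h4
  rw [h1, h2, Pi.add_apply, h3, h4]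
  refine D.coord_ext (x := x) fun j => ?_
  simp only [map_add, PiLp.add_apply, coord_mult]
  push_cast
  ring

theorem weight_zero_le {φ : ℝ → ℂ} {K t : ℝ}
    (h : ∀ r : ℝ, 0 < r → min 1 r * ‖φ r‖ ^ 2 ≤ K * r ^ t) (r : ℝ) (hr : 0 < r) :
    r ^ (0 : ℝ) * ‖((1 - Real.exp (-r) : ℝ) : ℂ) * φ r‖ ^ 2 ≤ K * r ^ t := by
  refine le_trans ?_ (h r hr)
  rw [Real.rpow_zero, one_mul, norm_mul, mul_pow, Complex.norm_real, Real.norm_eq_abs, sq_abs]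
  exact mul_le_mul_of_nonneg_right (one_sub_exp_neg_sq_le hr) (sq_nonneg _)

theorem weight_one_le {φ : ℝ → ℂ} {K t : ℝ}
    (h : ∀ r : ℝ, 0 < r → min 1 r * ‖φ r‖ ^ 2 ≤ K * r ^ t) (r : ℝ) (hr : 0 < r) :
    r ^ (1 : ℝ) * ‖((Real.exp (-r) : ℝ) : ℂ) * φ r‖ ^ 2 ≤ K * r ^ t := by
  refine le_trans ?_ (h r hr)
  rw [Real.rpow_one, norm_mul, mul_pow, Complex.norm_real, Real.norm_eq_abs, sq_abs, ← mul_assoc]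
  exact mul_le_mul_of_nonneg_right (mul_exp_neg_sq_le hr) (sq_nonneg _)

theorem sumNorm_multField_le_of_weight {φ : ℝ → ℂ} (hφ : D.IsMeasMultiplier φ) {K t : ℝ}
    (hK : 0 ≤ K) (h : ∀ r : ℝ, 0 < r → min 1 r * ‖φ r‖ ^ 2 ≤ K * r ^ t) (η : X →ₘ[μ] E) :
    sumNorm (D.fieldNorm 0) (D.fieldNorm 1) (D.multField hφ η) ≤
      2 * (ENNReal.ofReal K ^ (1 / 2 : ℝ) * D.fieldNorm t η) := by
  rw [two_mul]
  exact (D.sumNorm_multField_le hφ η).trans (add_le_add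
    (D.fieldNorm_multField_le _ hK (weight_zero_le h) η)
    (D.fieldNorm_multField_le _ hK (weight_one_le h) η))

theorem tendsto_sumNorm_multField {A : Type*} {l : Filter A} [l.IsCountablyGenerated]
    {φ : A → ℝ → ℂ} (hφ : ∀ a, D.IsMeasMultiplier (φ a)) {t K : ℝ}
    (hb : ∀ᶠ a in l, ∀ r : ℝ, 0 < r → min 1 r * ‖φ a r‖ ^ 2 ≤ K * r ^ t)
    (h0 : ∀ r : ℝ, 0 < r → Tendsto (fun a => φ a r) l (𝓝 0)) {η : X →ₘ[μ] E}
    (hη : D.fieldNorm t η < ∞) :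
    Tendsto (fun a => sumNorm (D.fieldNorm 0) (D.fieldNorm 1) (D.multField (hφ a) η)) l
      (𝓝 0) := by
  have h1 := D.tendsto_fieldNorm_multField (s := 0)
    (fun a => D.isMeasMultiplier_one_sub_exp.mul (hφ a))
    (hb.mono fun a ha => weight_zero_le ha)
    (fun r hr => by simpa using (h0 r hr).const_mul ((1 - Real.exp (-r) : ℝ) : ℂ)) hη
  have h2 := D.tendsto_fieldNorm_multField (s := 1)
    (fun a => isMeasMultiplier_exp_neg.mul (hφ a))
    (hb.mono fun a ha => weight_one_le ha)
    (fun r hr => by simpa using (h0 r hr).const_mul ((Real.exp (-r) : ℝ) : ℂ)) hη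
  refine tendsto_of_tendsto_of_tendsto_of_le_of_le tendsto_const_nhds
    (by simpa using h1.add h2) (fun _ => bot_le) fun a => D.sumNorm_multField_le (hφ a) η

theorem multField_sub {φ ψ χ : ℝ → ℂ} (hφ : D.IsMeasMultiplier φ) (hψ : D.IsMeasMultiplier ψ)
    (hχ : D.IsMeasMultiplier χ) (h : ∀ r, χ r = φ r - ψ r) (η : X →ₘ[μ] E) :
    D.multField hφ η - D.multField hψ η = D.multField hχ η := by
  refine AEEqFun.ext ?_
  filter_upwards [AEEqFun.coeFn_sub (D.multField hφ η) (D.multField hψ η), D.coeFn_multField hφ η,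
    D.coeFn_multField hψ η, D.coeFn_multField hχ η] with x h1 h2 h3 h4
  rw [h1, Pi.sub_apply, h2, h3, h4]
  refine D.coord_ext (x := x) fun j => ?_
  simp [h, sub_mul]

theorem multField_smul {φ χ : ℝ → ℂ} (hφ : D.IsMeasMultiplier φ) (c : ℂ)
    (hχ : D.IsMeasMultiplier χ) (h : ∀ r, χ r = c * φ r) (η : X →ₘ[μ] E) :
    c • D.multField hφ η = D.multField hχ η := by
  refine AEEqFun.ext ?_
  filter_upwards [AEEqFun.coeFn_smul c (D.multField hφ η), D.coeFn_multField hφ η,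
    D.coeFn_multField hχ η] with x h1 h2 h3
  rw [h1, Pi.smul_apply, h2, h3]
  refine D.coord_ext (x := x) fun j => ?_
  simp [h, mul_assoc]

/-! #### The extremal function -/

/-- The symbol of the extremal function, with a Gaussian factor. -/
def symbol (δ t : ℝ) (z : ℂ) (r : ℝ) : ℂ :=
  Complex.exp (δ * (z ^ 2 - t ^ 2) + (t - z) / 2 * (Real.log r : ℂ))

theorem isMeasMultiplier_symbol (δ t : ℝ) (z : ℂ) : D.IsMeasMultiplier (symbol δ t z) :=
  isMeasMultiplier_cexp_log _ _

theorem norm_symbol_sq (δ t : ℝ) (z : ℂ) {r : ℝ} (hr : 0 < r) :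
    ‖symbol δ t z r‖ ^ 2 =
      Real.exp (2 * δ * (z.re ^ 2 - z.im ^ 2 - t ^ 2)) * r ^ (t - z.re) := by
  rw [symbol, Complex.norm_exp, ← Real.exp_nat_mul, Real.rpow_def_of_pos hr, ← Real.exp_add]
  congr 1
  simp [sq, Complex.mul_re, Complex.mul_im]
  ring

theorem min_mul_rpow_le {r : ℝ} (hr : 0 < r) {x : ℝ} (h0 : 0 ≤ x) (h1 : x ≤ 1) (t : ℝ) :
    min 1 r * r ^ (t - x) ≤ r ^ t := by
  rcases le_total r 1 with h | h
  · rw [min_eq_right h]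
    calc r * r ^ (t - x) = r ^ (1 - x) * r ^ t := by
          rw [← Real.rpow_add hr, show 1 - x + t = 1 + (t - x) by ring, Real.rpow_add hr,
            Real.rpow_one]
      _ ≤ 1 * r ^ t := by
          gcongr
          exact Real.rpow_le_one hr.le h (by linarith)
      _ = _ := one_mul _
  · rw [min_eq_left h, one_mul]
    exact Real.rpow_le_rpow_of_exponent_le h (by linarith)

theorem norm_symbol_sq_le {δ : ℝ} (hδ : 0 ≤ δ) (t : ℝ) {z : ℂ} (h0 : 0 ≤ z.re) (h1 : z.re ≤ 1)
    {r : ℝ} (hr : 0 < r) : ‖symbol δ t z r‖ ^ 2 ≤ Real.exp (2 * δ) * r ^ (t - z.re) := by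
  rw [norm_symbol_sq δ t z hr]
  refine mul_le_mul_of_nonneg_right (Real.exp_le_exp.2 ?_) (Real.rpow_nonneg hr.le _)
  have : z.re ^ 2 - z.im ^ 2 - t ^ 2 ≤ 1 := by nlinarith [sq_nonneg z.im, sq_nonneg t]
  nlinarith

/-- The symbol has squared modulus at most e^{2δ} r^{t - Re z}, and min 1 r absorbs r^{-Re z}
throughout the strip. The majorant is uniform in z. -/
theorem weight_symbol_le {δ : ℝ} (hδ : 0 ≤ δ) (t : ℝ) {z : ℂ} (hz : z ∈ closedStrip)
    {r : ℝ} (hr : 0 < r) : min 1 r * ‖symbol δ t z r‖ ^ 2 ≤ Real.exp (2 * δ) * r ^ t := by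
  have h1 := norm_symbol_sq_le hδ t hz.1 hz.2 hr
  have h2 := min_mul_rpow_le hr hz.1 hz.2 t
  have h3 : 0 < min 1 r := lt_min one_pos hr
  calc _ ≤ min 1 r * (Real.exp (2 * δ) * r ^ (t - z.re)) := by gcongr
    _ = Real.exp (2 * δ) * (min 1 r * r ^ (t - z.re)) := by ring
    _ ≤ _ := by gcongr

theorem differentiable_symbol (δ t r : ℝ) : Differentiable ℂ fun z => symbol δ t z r := by
  unfold symbol
  fun_prop

theorem deriv_symbol (δ t r : ℝ) (z : ℂ) : deriv (fun z => symbol δ t z r) z =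
    (δ * (2 * z) + (-1 / 2) * (Real.log r : ℂ)) * symbol δ t z r := by
  have h : HasDerivAt (fun z : ℂ => (δ : ℂ) * (z ^ 2 - t ^ 2) + (t - z) / 2 * (Real.log r : ℂ))
      (δ * (2 * z) + (-1 / 2) * (Real.log r : ℂ)) z := by
    have h1 := (((hasDerivAt_pow 2 z).sub_const ((t : ℂ) ^ 2)).const_mul (δ : ℂ)).add
      ((((hasDerivAt_id z).const_sub (t : ℂ)).div_const 2).mul_const (Real.log r : ℂ))
    exact h1.congr_deriv (by simp)
  rw [show (fun z => symbol δ t z r) = fun z => Complex.exp _ from rfl, h.cexp.deriv, mul_comm]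
  rfl

theorem isMeasMultiplier_deriv_symbol (δ t : ℝ) (z : ℂ) :
    D.IsMeasMultiplier fun r => deriv (fun z => symbol δ t z r) z := by
  simp only [deriv_symbol]
  exact ((isMeasMultiplier_const _).add ((isMeasMultiplier_const _).mul
    isMeasMultiplier_log)).mul (D.isMeasMultiplier_symbol δ t z)

/-- Cauchy's estimate for the symbol inside the strip. -/
theorem exists_weight_deriv_symbol_le {δ : ℝ} (hδ : 0 ≤ δ) (t : ℝ) {z : ℂ} (h0 : 0 < z.re)
    (h1 : z.re < 1) : ∃ ρ > 0, ∃ K : ℝ, 0 ≤ K ∧ ∀ w ∈ Metric.ball z ρ, ∀ r : ℝ, 0 < r →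
      min 1 r * ‖deriv (fun z => symbol δ t z r) w‖ ^ 2 ≤ K * r ^ t := by
  obtain ⟨ρ, hρ, hρz⟩ : ∃ ρ > 0, ∀ w : ℂ, ‖w - z‖ ≤ 2 * ρ → w ∈ closedStrip := by
    refine ⟨min z.re (1 - z.re) / 2, by have := lt_min h0 (sub_pos.2 h1); linarith,
      fun w hw => ?_⟩
    have h := (Complex.abs_re_le_norm (w - z)).trans hw
    rw [Complex.sub_re, abs_le] at h
    have := min_le_left z.re (1 - z.re)
    have := min_le_right z.re (1 - z.re)
    exact ⟨by linarith [h.1], by linarith [h.2]⟩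
  refine ⟨ρ, hρ, Real.exp (2 * δ) / ρ ^ 2, by positivity, fun w hw r hr => ?_⟩
  have hmin : 0 < min 1 r := lt_min one_pos hr
  set C := Real.sqrt (Real.exp (2 * δ) * r ^ t / min 1 r) with hC
  have hbound : ∀ v ∈ Metric.sphere w ρ, ‖symbol δ t v r‖ ≤ C := by
    intro v hv
    refine Real.le_sqrt_of_sq_le ?_
    rw [le_div_iff₀ hmin, mul_comm]
    refine weight_symbol_le hδ t (hρz v ?_) hr
    have h2 := mem_sphere_iff_norm.1 hv
    have h3 := mem_ball_iff_norm.1 hw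
    calc ‖v - z‖ = ‖(v - w) + (w - z)‖ := by ring_nf
      _ ≤ ‖v - w‖ + ‖w - z‖ := norm_add_le _ _
      _ ≤ 2 * ρ := by linarith
  have h := Complex.norm_deriv_le_of_forall_mem_sphere_norm_le hρ
    (differentiable_symbol δ t r).diffContOnCl hbound
  have hsq : ‖deriv (fun z => symbol δ t z r) w‖ ^ 2 ≤ (C / ρ) ^ 2 :=
    pow_le_pow_left₀ (norm_nonneg _) h 2
  have hrt := Real.rpow_nonneg hr.le t
  calc _ ≤ min 1 r * (C / ρ) ^ 2 := by gcongr
    _ = _ := by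
      rw [div_pow, hC, Real.sq_sqrt (by positivity)]
      field_simp

variable {D}

/-- Each condition is a scalar estimate with majorant a multiple of rᵗ and a pointwise limit of the
symbols. The Gaussian factor supplies the decay on the boundary lines. -/
theorem isCalderon_symbol {δ t : ℝ} (hδ : 0 < δ) {ω : X →ₘ[μ] E} (hω : D.fieldNorm t ω < ∞) :
    IsCalderon (D.fieldNorm 0) (D.fieldNorm 1)
      fun z => D.multField (D.isMeasMultiplier_symbol δ t z) ω := by
  have hsub : ∀ w z, D.IsMeasMultiplier fun r => symbol δ t w r - symbol δ t z r := fun w z =>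
    ((D.isMeasMultiplier_symbol δ t w).add ((isMeasMultiplier_const (-1)).mul
      (D.isMeasMultiplier_symbol δ t z))).congr fun r _ => by ring
  have hcont : ∀ r, Continuous fun z => symbol δ t z r := fun r =>
    (differentiable_symbol δ t r).continuous
  have hsubsq : ∀ a b : ℂ, ‖a - b‖ ^ 2 ≤ 2 * ‖a‖ ^ 2 + 2 * ‖b‖ ^ 2 := by
    intro a b
    have h := norm_sub_le a b
    have h' := pow_le_pow_left₀ (norm_nonneg _) h 2
    nlinarith [sq_nonneg (‖a‖ - ‖b‖)]
  have hleft : ∀ (y r : ℝ), 0 < r → r ^ (0 : ℝ) * ‖symbol δ t (y * Complex.I) r‖ ^ 2 ≤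
      Real.exp (-(2 * δ * y ^ 2)) * r ^ t := by
    intro y r hr
    rw [norm_symbol_sq δ t _ hr]
    simp only [Complex.mul_re, Complex.mul_im, Complex.ofReal_re, Complex.ofReal_im, Complex.I_re,
      Complex.I_im, mul_zero, mul_one, sub_self, zero_mul, add_zero, zero_pow, ne_eq,
      OfNat.ofNat_ne_zero, not_false_eq_true, zero_sub, Real.rpow_zero, one_mul, sub_zero]
    gcongr
    nlinarith [mul_nonneg hδ.le (sq_nonneg t)]
  have hright : ∀ (y r : ℝ), 0 < r → r ^ (1 : ℝ) * ‖symbol δ t (1 + y * Complex.I) r‖ ^ 2 ≤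
      (Real.exp (2 * δ) * Real.exp (-(2 * δ * y ^ 2))) * r ^ t := by
    intro y r hr
    rw [norm_symbol_sq δ t _ hr]
    simp only [Complex.add_re, Complex.add_im, Complex.one_re, Complex.one_im, Complex.mul_re,
      Complex.mul_im, Complex.ofReal_re, Complex.ofReal_im, Complex.I_re,
      Complex.I_im, mul_zero, mul_one, sub_self, zero_mul, add_zero, zero_add, one_pow]
    rw [mul_left_comm, ← Real.rpow_add hr, ← Real.exp_add, add_sub_cancel]
    gcongr
    nlinarith [mul_nonneg hδ.le (sq_nonneg t)]
  have hexp1 : ∀ y : ℝ, Real.exp (-(2 * δ * y ^ 2)) ≤ 1 := fun y =>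
    Real.exp_le_one_iff.2 (by have := mul_nonneg hδ.le (sq_nonneg y); linarith)
  have hgauss : Tendsto (fun y : ℝ => Real.exp (-(2 * δ * y ^ 2))) (cocompact ℝ) (𝓝 0) := by
    refine Real.tendsto_exp_neg_atTop_nhds_zero.comp ?_
    refine Tendsto.const_mul_atTop (by positivity) ?_
    have := (tendsto_pow_atTop two_ne_zero).comp (tendsto_norm_cocompact_atTop (E := ℝ))
    simpa [Function.comp_def] using this
  have hgauss' : ∀ C : ℝ, Tendsto (fun y : ℝ => ENNReal.ofReal
      (C * Real.exp (-(2 * δ * y ^ 2))) ^ (1 / 2 : ℝ) * D.fieldNorm t ω) (cocompact ℝ) (𝓝 0) := by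
    intro C
    have h1 := ENNReal.tendsto_ofReal (hgauss.const_mul C)
    have h2 := ((ENNReal.continuous_rpow_const (y := (1 / 2 : ℝ))).tendsto _).comp h1
    have h3 := ENNReal.Tendsto.mul_const (b := D.fieldNorm t ω) h2 (Or.inr hω.ne)
    simpa using h3
  have hrpow_lt : ∀ K : ℝ, ENNReal.ofReal K ^ (1 / 2 : ℝ) * D.fieldNorm t ω < ∞ := fun K =>
    ENNReal.mul_lt_top (ENNReal.rpow_lt_top_of_nonneg (by norm_num) ENNReal.ofReal_ne_top) hω
  refine ⟨?_, ?_, ?_, ?_, ?_, ?_, ?_, ?_, ?_⟩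
  · refine ⟨(2 * (ENNReal.ofReal (Real.exp (2 * δ)) ^ (1 / 2 : ℝ) * D.fieldNorm t ω)).toNNReal,
      fun z hz => ?_⟩
    rw [ENNReal.coe_toNNReal (ENNReal.mul_lt_top (by simp) (hrpow_lt _)).ne]
    exact D.sumNorm_multField_le_of_weight _ (Real.exp_pos _).le
      (fun r hr => weight_symbol_le hδ.le t hz hr) ω
  · intro z hz
    simp only [D.multField_sub _ _ (hsub _ _) fun r => rfl]
    refine D.tendsto_sumNorm_multField (fun w => hsub w z) (t := t)
      (K := 4 * Real.exp (2 * δ)) ?_ ?_ hω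
    · filter_upwards [self_mem_nhdsWithin] with w hw r hr
      have h1 := weight_symbol_le hδ.le t hw hr
      have h2 := weight_symbol_le hδ.le t hz hr
      have h3 := mul_le_mul_of_nonneg_left (hsubsq (symbol δ t w r) (symbol δ t z r))
        (lt_min one_pos hr).le
      linarith
    · intro r hr
      have := (((hcont r).tendsto z).mono_left
        (nhdsWithin_le_nhds (s := closedStrip))).sub_const (symbol δ t z r)
      simpa using this
  · intro z hz0 hz1
    obtain ⟨ρ, hρ, K, hK, hbound⟩ := exists_weight_deriv_symbol_le hδ.le t hz0 hz1
    refine ⟨D.multField (D.isMeasMultiplier_deriv_symbol δ t z) ω, ?_, ?_⟩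
    · exact (D.sumNorm_multField_le_of_weight _ hK
        (fun r hr => hbound z (Metric.mem_ball_self hρ) r hr) ω).trans_lt
        (ENNReal.mul_lt_top (by simp) (hrpow_lt _))
    · have hq : ∀ w : ℂ, D.IsMeasMultiplier fun r =>
          (w - z)⁻¹ * (symbol δ t w r - symbol δ t z r) := fun w =>
        (isMeasMultiplier_const _).mul (hsub w z)
      have hqd : ∀ w : ℂ, D.IsMeasMultiplier fun r =>
          (w - z)⁻¹ * (symbol δ t w r - symbol δ t z r) -
            deriv (fun z => symbol δ t z r) z := fun w =>
        ((hq w).add ((isMeasMultiplier_const (-1)).mul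
          (D.isMeasMultiplier_deriv_symbol δ t z))).congr fun r _ => by ring
      simp only [D.multField_sub _ _ (hsub _ _) fun r => rfl]
      have heq : ∀ w : ℂ, (w - z)⁻¹ • D.multField (hsub w z) ω -
          D.multField (D.isMeasMultiplier_deriv_symbol δ t z) ω = D.multField (hqd w) ω := by
        intro w
        rw [D.multField_smul (hsub w z) _ (hq w) fun r => rfl,
          D.multField_sub (hq w) _ (hqd w) fun r => rfl]
      simp only [heq]
      refine D.tendsto_sumNorm_multField hqd (t := t) (K := 4 * K) ?_ ?_ hω
      · filter_upwards [nhdsWithin_le_nhds (Metric.ball_mem_nhds z hρ),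
          self_mem_nhdsWithin] with w hw hwz r hr
        have hmin := lt_min one_pos hr
        -- By Cauchy's estimate C bounds the derivative on the ball, hence also the difference
        -- quotient by the mean value inequality. Their difference then has squared modulus at most
        -- 4C².
        set C := Real.sqrt (K * r ^ t / min 1 r) with hC
        have hrt := Real.rpow_nonneg hr.le t
        have hCb : ∀ v ∈ Metric.ball z ρ, ‖deriv (fun z => symbol δ t z r) v‖ ≤ C := by
          intro v hv
          refine Real.le_sqrt_of_sq_le ?_
          rw [le_div_iff₀ hmin, mul_comm]
          exact hbound v hv r hr
        have hmv := (convex_ball z ρ).norm_image_sub_le_of_norm_deriv_le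
          (fun v _ => (differentiable_symbol δ t r) v) hCb (Metric.mem_ball_self hρ) hw
        have hwz' : 0 < ‖w - z‖ := norm_pos_iff.2 (sub_ne_zero.2 hwz)
        have h1 : ‖(w - z)⁻¹ * (symbol δ t w r - symbol δ t z r)‖ ≤ C := by
          rw [norm_mul, norm_inv, inv_mul_le_iff₀ hwz', mul_comm]
          exact hmv
        have h2 := hCb z (Metric.mem_ball_self hρ)
        have h3 := hsubsq ((w - z)⁻¹ * (symbol δ t w r - symbol δ t z r))
          (deriv (fun z => symbol δ t z r) z)
        have h4 := pow_le_pow_left₀ (norm_nonneg _) h1 2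
        have h5 := pow_le_pow_left₀ (norm_nonneg _) h2 2
        have h6 : min 1 r * C ^ 2 = K * r ^ t := by
          rw [hC, Real.sq_sqrt (by positivity)]
          field_simp
        calc _ ≤ min 1 r * (4 * C ^ 2) := by
              gcongr
              linarith
          _ = 4 * K * r ^ t := by rw [mul_left_comm, h6]; ring
      · intro r hr
        have hd := ((differentiable_symbol δ t r) z).hasDerivAt
        have := (hasDerivAt_iff_tendsto_slope.1 hd).sub_const (deriv (fun z => symbol δ t z r) z)
        simpa [slope_def_field, div_eq_inv_mul] using this
  · intro y
    exact (D.fieldNorm_multField_le _ (Real.exp_pos _).le (hleft y) ω).trans_lt (hrpow_lt _)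
  · intro y
    simp only [D.multField_sub _ _ (hsub _ _) fun r => rfl]
    refine D.tendsto_fieldNorm_multField (fun s : ℝ => hsub (s * Complex.I) (y * Complex.I))
      (t := t) (K := 4) (Eventually.of_forall fun s r hr => ?_) (fun r hr => ?_) hω
    · have h1 := hleft s r hr
      have h2 := hleft y r hr
      have h3 := hsubsq (symbol δ t (s * Complex.I) r) (symbol δ t (y * Complex.I) r)
      have hrt := Real.rpow_nonneg hr.le t
      have h4 := mul_le_mul_of_nonneg_right (hexp1 s) hrt
      have h5 := mul_le_mul_of_nonneg_right (hexp1 y) hrt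
      rw [Real.rpow_zero, one_mul] at h1 h2 ⊢
      linarith
    · have h1 : Continuous fun s : ℝ => symbol δ t (s * Complex.I) r :=
        (hcont r).comp (by fun_prop)
      simpa using (h1.tendsto y).sub_const (symbol δ t (y * Complex.I) r)
  · refine tendsto_of_tendsto_of_tendsto_of_le_of_le tendsto_const_nhds (hgauss' 1)
      (fun _ => bot_le) fun y => ?_
    refine D.fieldNorm_multField_le _ (by positivity) (fun r hr => ?_) ω
    rw [one_mul]
    exact hleft y r hr
  · intro y
    exact (D.fieldNorm_multField_le _ (by positivity) (hright y) ω).trans_lt (hrpow_lt _)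
  · intro y
    simp only [D.multField_sub _ _ (hsub _ _) fun r => rfl]
    refine D.tendsto_fieldNorm_multField
      (fun s : ℝ => hsub (1 + s * Complex.I) (1 + y * Complex.I))
      (t := t) (K := 4 * Real.exp (2 * δ)) (Eventually.of_forall fun s r hr => ?_)
      (fun r hr => ?_) hω
    · have h1 := hright s r hr
      have h2 := hright y r hr
      have h3 := mul_le_mul_of_nonneg_left (hsubsq (symbol δ t (1 + s * Complex.I) r)
        (symbol δ t (1 + y * Complex.I) r)) (Real.rpow_nonneg hr.le 1)
      have hrt : 0 ≤ Real.exp (2 * δ) * r ^ t :=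
        mul_nonneg (Real.exp_pos _).le (Real.rpow_nonneg hr.le t)
      have h4 := mul_le_mul_of_nonneg_right (hexp1 s) hrt
      have h5 := mul_le_mul_of_nonneg_right (hexp1 y) hrt
      linarith
    · have h1 : Continuous fun s : ℝ => symbol δ t (1 + s * Complex.I) r :=
        (hcont r).comp (by fun_prop)
      simpa using (h1.tendsto y).sub_const (symbol δ t (1 + y * Complex.I) r)
  · refine tendsto_of_tendsto_of_tendsto_of_le_of_le tendsto_const_nhds
      (hgauss' (Real.exp (2 * δ))) (fun _ => bot_le) fun y => ?_
    exact D.fieldNorm_multField_le _ (by positivity) (hright y) ω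

/-- The symbol equals 1 at z = t and costs at most a factor e^δ on both boundary lines; let δ tend
to 0. -/
theorem interpNorm_le (t : ℝ) (ω : X →ₘ[μ] E) :
    interpNorm (D.fieldNorm 0) (D.fieldNorm 1) t ω ≤ D.fieldNorm t ω := by
  rcases eq_or_ne (D.fieldNorm t ω) ∞ with h | hω
  · rw [h]; exact le_top
  have key : ∀ δ : ℝ, 0 < δ → interpNorm (D.fieldNorm 0) (D.fieldNorm 1) t ω ≤
      ENNReal.ofReal (Real.exp (2 * δ)) ^ (1 / 2 : ℝ) * D.fieldNorm t ω := by
    intro δ hδ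
    refine iInf_le_of_le _ (iInf_le_of_le (isCalderon_symbol hδ hω.lt_top)
      (iInf_le_of_le ?_ (max_le (iSup_le fun y => ?_) (iSup_le fun y => ?_))))
    · refine AEEqFun.ext ?_
      filter_upwards [D.coeFn_multField (D.isMeasMultiplier_symbol δ t t) ω] with x hx
      rw [hx]
      refine D.coord_ext (x := x) fun j => ?_
      simp [symbol]
    · refine D.fieldNorm_multField_le _ (by positivity) (fun r hr => ?_) ω
      rw [norm_symbol_sq δ t _ hr]
      simp only [Complex.mul_re, Complex.mul_im, Complex.ofReal_re, Complex.ofReal_im,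
        Complex.I_re, Complex.I_im, mul_zero, mul_one, sub_self, zero_mul, add_zero, zero_pow,
        ne_eq, OfNat.ofNat_ne_zero, not_false_eq_true, zero_sub, Real.rpow_zero, one_mul, sub_zero]
      refine mul_le_mul_of_nonneg_right (Real.exp_le_exp.2 ?_) (Real.rpow_nonneg hr.le _)
      nlinarith [mul_nonneg hδ.le (sq_nonneg t), mul_nonneg hδ.le (sq_nonneg y)]
    · refine D.fieldNorm_multField_le _ (by positivity) (fun r hr => ?_) ω
      rw [norm_symbol_sq δ t _ hr]
      simp only [Complex.add_re, Complex.add_im, Complex.one_re, Complex.one_im, Complex.mul_re,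
        Complex.mul_im, Complex.ofReal_re, Complex.ofReal_im, Complex.I_re,
        Complex.I_im, mul_zero, mul_one, sub_self, zero_mul, add_zero, zero_add, one_pow]
      rw [mul_left_comm, ← Real.rpow_add hr, add_sub_cancel]
      refine mul_le_mul_of_nonneg_right (Real.exp_le_exp.2 ?_) (Real.rpow_nonneg hr.le _)
      nlinarith [mul_nonneg hδ.le (sq_nonneg t), mul_nonneg hδ.le (sq_nonneg y)]
  have hlim : Tendsto (fun δ : ℝ => ENNReal.ofReal (Real.exp (2 * δ)) ^ (1 / 2 : ℝ) *
      D.fieldNorm t ω) (𝓝[>] 0) (𝓝 (D.fieldNorm t ω)) := by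
    have h1 : Continuous fun δ : ℝ => ENNReal.ofReal (Real.exp (2 * δ)) ^ (1 / 2 : ℝ) :=
      ENNReal.continuous_rpow_const.comp (ENNReal.continuous_ofReal.comp (by fun_prop))
    have h2 := ENNReal.Tendsto.mul_const (b := D.fieldNorm t ω)
      ((h1.tendsto 0).mono_left (nhdsWithin_le_nhds (s := Ioi 0))) (Or.inr hω)
    simpa using h2
  exact ge_of_tendsto hlim (by filter_upwards [self_mem_nhdsWithin] with δ hδ using key δ hδ)

end SpectralField

/-! ### Complex interpolation: lower bound of the interpolation norm -/

theorem sumNorm_eq {Y : Type*} [AddCommGroup Y] (N₀ N₁ : Y → ℝ≥0∞) (x : Y) :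
    sumNorm N₀ N₁ x = ⨅ a : Y, N₀ a + N₁ (x - a) := by
  refine le_antisymm (le_iInf fun a => iInf_le_of_le a (iInf_le_of_le (x - a)
    (iInf_le_of_le (by abel) le_rfl))) (le_iInf fun a => le_iInf fun b => le_iInf fun h => ?_)
  refine iInf_le_of_le a (le_of_eq ?_)
  rw [← h, add_sub_cancel_left]

namespace SpectralField

variable {X : Type*} [MeasurableSpace X] {μ : Measure X} {E : Type*} [NormedAddCommGroup E]
  [NormedSpace ℂ E] {N : ℕ} (D : SpectralField μ E N)

/-- On `S` the weights stay in `[K⁻¹, K]` and the field `ξ` has finite energy. -/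
structure IsBand (S : Set X) (K : ℝ) (ξ : X → E) : Prop where
  one_le : 1 ≤ K
  eig_mem : ∀ᵐ x ∂μ.restrict S, ∀ j, D.eig x j ∈ Icc K⁻¹ K
  meas : AEStronglyMeasurable ξ μ
  finite : ∫⁻ x in S, ENNReal.ofReal (D.energy 0 x (ξ x)) ∂μ < ∞

/-- The pairing of `ξ` with the image of `η` under a multiplier, over `S`. -/
def pairing (S : Set X) (ξ : X → E) (φ : ℝ → ℂ) (η : X → E) : ℂ :=
  ∫ x in S, inner ℂ (D.coord x (ξ x)) (D.coord x (D.mult φ x (η x))) ∂μ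

/-- The integral of the modulus of the integrand of `pairing`. -/
def absPairing (S : Set X) (ξ : X → E) (φ : ℝ → ℂ) (η : X → E) : ℝ≥0∞ :=
  ∫⁻ x in S, ‖(inner ℂ (D.coord x (ξ x)) (D.coord x (D.mult φ x (η x))) : ℂ)‖ₑ ∂μ

variable {D} {S : Set X} {K : ℝ} {ξ : X → E}

theorem enorm_pairing_le (φ : ℝ → ℂ) (η : X → E) :
    ‖D.pairing S ξ φ η‖ₑ ≤ D.absPairing S ξ φ η := enorm_integral_le_lintegral_enorm _

theorem aestronglyMeasurable_pairing (hξ : AEStronglyMeasurable ξ μ) {φ : ℝ → ℂ}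
    (hφ : D.IsMeasMultiplier φ) {η : X → E} (hη : AEStronglyMeasurable η μ) :
    AEStronglyMeasurable
      (fun x => (inner ℂ (D.coord x (ξ x)) (D.coord x (D.mult φ x (η x))) : ℂ)) (μ.restrict S) :=
  (D.aestronglyMeasurable_inner hξ (hφ η hη)).mono_measure Measure.restrict_le_self

theorem integrable_pairing (hξ : AEStronglyMeasurable ξ μ) {φ : ℝ → ℂ}
    (hφ : D.IsMeasMultiplier φ) {η : X → E} (hη : AEStronglyMeasurable η μ)
    (h : D.absPairing S ξ φ η < ∞) : Integrable
      (fun x => (inner ℂ (D.coord x (ξ x)) (D.coord x (D.mult φ x (η x))) : ℂ)) (μ.restrict S) :=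
  ⟨aestronglyMeasurable_pairing hξ hφ hη, h⟩

theorem IsBand.absPairing_le (hS : D.IsBand S K ξ) {φ : ℝ → ℂ} (hφ : D.IsMeasMultiplier φ)
    {s c : ℝ} (hc : 0 ≤ c) (h : ∀ r ∈ Icc K⁻¹ K, ‖φ r‖ ^ 2 ≤ c * r ^ s) (η : X →ₘ[μ] E) :
    D.absPairing S ξ φ η ≤
      (∫⁻ x in S, ENNReal.ofReal (D.energy 0 x (ξ x)) ∂μ) ^ (1 / 2 : ℝ) *
        (ENNReal.ofReal c ^ (1 / 2 : ℝ) * D.fieldNorm s η) := by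
  have hm : ∀ ζ : X → E, AEStronglyMeasurable ζ μ → AEMeasurable
      (fun x => ENNReal.ofReal (D.energy 0 x (ζ x)) ^ (1 / 2 : ℝ)) (μ.restrict S) := fun ζ hζ =>
    (((D.aemeasurable_energy 0 hζ).ennreal_ofReal).pow_const _).mono_measure
      Measure.restrict_le_self
  have hpt : ∀ ζ : E, ∀ x, ‖D.coord x ζ‖ₑ = ENNReal.ofReal (D.energy 0 x ζ) ^ (1 / 2 : ℝ) := by
    intro ζ x
    rw [energy_zero_exp, ← ofReal_norm, ENNReal.ofReal_pow (norm_nonneg _), ← ENNReal.rpow_natCast,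
      ← ENNReal.rpow_mul]
    norm_num
  have hsq : ∀ a : ℝ≥0∞, (a ^ (1 / 2 : ℝ)) ^ (2 : ℝ) = a := fun a => by
    rw [← ENNReal.rpow_mul]; norm_num
  have h1 := ENNReal.lintegral_mul_le_Lp_mul_Lq (μ.restrict S) Real.HolderConjugate.two_two
    (hm ξ hS.meas) (hm _ (hφ η η.aestronglyMeasurable))
  simp only [hsq, Pi.mul_apply] at h1
  refine le_trans (lintegral_mono fun x => ?_) (h1.trans ?_)
  · rw [← hpt, ← hpt, ← ofReal_norm, ← ofReal_norm, ← ofReal_norm,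
      ← ENNReal.ofReal_mul (norm_nonneg _)]
    exact ENNReal.ofReal_le_ofReal (norm_inner_le_norm _ _)
  · gcongr
    rw [fieldNorm, ← ENNReal.mul_rpow_of_nonneg _ _ (by norm_num)]
    refine ENNReal.rpow_le_rpow ?_ (by norm_num)
    rw [← lintegral_const_mul' _ _ ENNReal.ofReal_ne_top]
    refine le_trans (lintegral_mono_ae ?_) (setLIntegral_le_lintegral S _)
    filter_upwards [hS.eig_mem] with x hx
    rw [← ENNReal.ofReal_mul hc]
    refine ENNReal.ofReal_le_ofReal ?_
    rw [energy_mult, energy, Finset.mul_sum]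
    refine Finset.sum_le_sum fun j _ => ?_
    rw [Real.rpow_zero, one_mul, ← mul_assoc]
    exact mul_le_mul_of_nonneg_right (h _ (hx j)) (sq_nonneg _)

theorem absPairing_add_le (hξ : AEStronglyMeasurable ξ μ) {φ : ℝ → ℂ} (hφ : D.IsMeasMultiplier φ)
    (a b : X →ₘ[μ] E) :
    D.absPairing S ξ φ (a + b : X →ₘ[μ] E) ≤ D.absPairing S ξ φ a + D.absPairing S ξ φ b := by
  rw [absPairing, absPairing, absPairing, ← lintegral_add_left'
    (aestronglyMeasurable_pairing hξ hφ a.aestronglyMeasurable).enorm]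
  refine lintegral_mono_ae ?_
  filter_upwards [ae_restrict_of_ae (AEEqFun.coeFn_add a b)] with x hx
  have : D.coord x (D.mult φ x ((a + b : X →ₘ[μ] E) x)) =
      D.coord x (D.mult φ x (a x)) + D.coord x (D.mult φ x (b x)) := by
    ext j
    rw [hx]
    simp [mul_add]
  rw [this, inner_add_right]
  exact enorm_add_le _ _

/-- When the weights lie in [K⁻¹, K], each of the two norms controls the Euclidean one up to √K.
Pairing with ξ is therefore continuous for the sum norm, with a constant depending on φ only through
its supremum on the band. -/
theorem IsBand.exists_absPairing_le_sumNorm (hS : D.IsBand S K ξ) : ∃ C : ℝ≥0∞, C ≠ ∞ ∧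
    ∀ φ : ℝ → ℂ, D.IsMeasMultiplier φ → ∀ c : ℝ, 0 ≤ c → (∀ r ∈ Icc K⁻¹ K, ‖φ r‖ ≤ c) →
    ∀ η : X →ₘ[μ] E, D.absPairing S ξ φ η ≤
      C * ENNReal.ofReal c * sumNorm (D.fieldNorm 0) (D.fieldNorm 1) η := by
  have hK0 : 0 < K := one_pos.trans_le hS.one_le
  have hC : (∫⁻ x in S, ENNReal.ofReal (D.energy 0 x (ξ x)) ∂μ) ^ (1 / 2 : ℝ) *
      ENNReal.ofReal K ^ (1 / 2 : ℝ) ≠ ∞ := ENNReal.mul_ne_top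
    (ENNReal.rpow_ne_top_of_nonneg (by norm_num) hS.finite.ne)
    (ENNReal.rpow_ne_top_of_nonneg (by norm_num) ENNReal.ofReal_ne_top)
  refine ⟨_, hC, fun φ hφ c hc h η => ?_⟩
  have hsqrt : ENNReal.ofReal (K * c ^ 2) ^ (1 / 2 : ℝ) =
      ENNReal.ofReal K ^ (1 / 2 : ℝ) * ENNReal.ofReal c := by
    rw [ENNReal.ofReal_mul hK0.le, ENNReal.mul_rpow_of_nonneg _ _ (by norm_num),
      ENNReal.ofReal_pow hc, ← ENNReal.rpow_natCast, ← ENNReal.rpow_mul]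
    norm_num
  rw [sumNorm_eq, ENNReal.mul_iInf' (fun h' _ => absurd h'
    (ENNReal.mul_ne_top hC ENNReal.ofReal_ne_top))
    fun _ => ⟨0⟩]
  refine le_iInf fun a => ?_
  have hadd : D.absPairing S ξ φ η ≤ D.absPairing S ξ φ a +
      D.absPairing S ξ φ (η - a : X →ₘ[μ] E) := by
    have := absPairing_add_le (S := S) hS.meas hφ a (η - a)
    rwa [add_sub_cancel] at this
  have hsq : ∀ r ∈ Icc K⁻¹ K, ‖φ r‖ ^ 2 ≤ c ^ 2 := fun r hr =>
    pow_le_pow_left₀ (norm_nonneg _) (h r hr) 2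
  refine hadd.trans ?_
  rw [mul_assoc _ _ (ENNReal.ofReal c), ← hsqrt, mul_assoc, mul_add, mul_add]
  refine add_le_add (hS.absPairing_le hφ (by positivity) (fun r hr => ?_) a)
    (hS.absPairing_le hφ (by positivity) (fun r hr => ?_) (η - a))
  · rw [Real.rpow_zero, mul_one]
    nlinarith [hsq r hr, hS.one_le, sq_nonneg c]
  · rw [Real.rpow_one]
    have h1 : 1 ≤ K * r := by
      have := mul_le_mul_of_nonneg_left hr.1 hK0.le
      rwa [mul_inv_cancel₀ hK0.ne'] at this
    nlinarith [hsq r hr, sq_nonneg c]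

theorem pairing_sub_left (hξ : AEStronglyMeasurable ξ μ) {φ ψ χ : ℝ → ℂ}
    (hφ : D.IsMeasMultiplier φ) (hψ : D.IsMeasMultiplier ψ) (h : ∀ r, χ r = φ r - ψ r)
    (η : X →ₘ[μ] E) (h1 : D.absPairing S ξ φ η < ∞) (h2 : D.absPairing S ξ ψ η < ∞) :
    D.pairing S ξ χ η = D.pairing S ξ φ η - D.pairing S ξ ψ η := by
  rw [pairing, pairing, pairing, ← integral_sub
    (integrable_pairing hξ hφ η.aestronglyMeasurable h1)
    (integrable_pairing hξ hψ η.aestronglyMeasurable h2)]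
  refine integral_congr_ae (Eventually.of_forall fun x => ?_)
  simp only
  rw [← inner_sub_right]
  congr 1
  ext j
  simp [h, sub_mul]

theorem pairing_sub_right (hξ : AEStronglyMeasurable ξ μ) {φ : ℝ → ℂ}
    (hφ : D.IsMeasMultiplier φ) (a b : X →ₘ[μ] E)
    (h1 : D.absPairing S ξ φ a < ∞) (h2 : D.absPairing S ξ φ b < ∞) :
    D.pairing S ξ φ (a - b : X →ₘ[μ] E) = D.pairing S ξ φ a - D.pairing S ξ φ b := by
  rw [pairing, pairing, pairing, ← integral_sub
    (integrable_pairing hξ hφ a.aestronglyMeasurable h1)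
    (integrable_pairing hξ hφ b.aestronglyMeasurable h2)]
  refine integral_congr_ae ?_
  filter_upwards [ae_restrict_of_ae (AEEqFun.coeFn_sub a b)] with x hx
  rw [← inner_sub_right, hx]
  congr 1
  ext j
  simp [mul_sub]

theorem pairing_smul_left (c : ℂ) {φ χ : ℝ → ℂ} (h : ∀ r, χ r = c * φ r) (η : X → E) :
    D.pairing S ξ χ η = c * D.pairing S ξ φ η := by
  rw [pairing, pairing, ← integral_const_mul]
  refine integral_congr_ae (Eventually.of_forall fun x => ?_)
  simp only
  rw [← smul_eq_mul, ← inner_smul_right_eq_smul]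
  congr 1
  ext j
  simp [h, mul_assoc]

theorem pairing_smul_right (c : ℂ) (φ : ℝ → ℂ) (a : X →ₘ[μ] E) :
    D.pairing S ξ φ (c • a : X →ₘ[μ] E) = c * D.pairing S ξ φ a := by
  rw [pairing, pairing, ← integral_const_mul]
  refine integral_congr_ae ?_
  filter_upwards [ae_restrict_of_ae (AEEqFun.coeFn_smul c a)] with x hx
  rw [← smul_eq_mul, ← inner_smul_right_eq_smul, hx]
  congr 1
  ext j
  simp [mul_left_comm]

/-! #### The multipliers `r ^ (z / 2)` -/

/-- The multiplier `r ^ (z / 2)`. -/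
def powHalf (z : ℂ) (r : ℝ) : ℂ := Complex.exp (z / 2 * (Real.log r : ℂ))

theorem isMeasMultiplier_powHalf (z : ℂ) : D.IsMeasMultiplier (powHalf z) :=
  (isMeasMultiplier_cexp_log 0 (z / 2)).congr fun r _ => by simp [powHalf]

theorem norm_powHalf_sq (z : ℂ) {r : ℝ} (hr : 0 < r) : ‖powHalf z r‖ ^ 2 = r ^ z.re := by
  rw [powHalf, Complex.norm_exp, ← Real.exp_nat_mul, Real.rpow_def_of_pos hr]
  congr 1
  have : (z / 2 * (Real.log r : ℂ)).re = z.re / 2 * Real.log r := by simp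
  rw [this]
  push_cast
  ring

theorem abs_log_le {r : ℝ} (hK : 1 ≤ K) (hr : r ∈ Icc K⁻¹ K) : |Real.log r| ≤ Real.log K := by
  have hK0 : 0 < K := one_pos.trans_le hK
  have hr0 : 0 < r := (inv_pos.2 hK0).trans_le hr.1
  rw [abs_le, ← Real.log_inv]
  exact ⟨Real.log_le_log (inv_pos.2 hK0) hr.1, Real.log_le_log hr0 hr.2⟩

theorem norm_powHalf_le (hK : 1 ≤ K) (z : ℂ) {r : ℝ} (hr : r ∈ Icc K⁻¹ K) :
    ‖powHalf z r‖ ≤ Real.exp (|z.re| * Real.log K) := by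
  rw [powHalf, Complex.norm_exp]
  refine Real.exp_le_exp.2 ?_
  have : (z / 2 * (Real.log r : ℂ)).re = z.re / 2 * Real.log r := by simp
  rw [this]
  have h1 := abs_log_le hK hr
  calc z.re / 2 * Real.log r ≤ |z.re / 2 * Real.log r| := le_abs_self _
    _ = |z.re| / 2 * |Real.log r| := by rw [abs_mul, abs_div, abs_two]
    _ ≤ |z.re| / 2 * Real.log K := by gcongr
    _ ≤ _ := by nlinarith [abs_nonneg z.re, Real.log_nonneg hK]

theorem powHalf_sub (w z : ℂ) (r : ℝ) :
    powHalf w r - powHalf z r =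
      powHalf z r * (Complex.exp ((w - z) / 2 * (Real.log r : ℂ)) - 1) := by
  rw [mul_sub, mul_one, powHalf, powHalf, ← Complex.exp_add]
  congr 2
  ring

theorem norm_half_mul_log_le (hK : 1 ≤ K) (u : ℂ) {r : ℝ} (hr : r ∈ Icc K⁻¹ K) :
    ‖u / 2 * (Real.log r : ℂ)‖ ≤ ‖u‖ * Real.log K := by
  rw [norm_mul, norm_div, Complex.norm_real, Real.norm_eq_abs, Complex.norm_ofNat]
  have := abs_log_le hK hr
  calc ‖u‖ / 2 * |Real.log r| ≤ ‖u‖ / 2 * Real.log K := by gcongr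
    _ ≤ _ := by nlinarith [norm_nonneg u, Real.log_nonneg hK]

theorem norm_powHalf_sub_le (hK : 1 ≤ K) {w z : ℂ} (hw : ‖w - z‖ * Real.log K ≤ 1) {r : ℝ}
    (hr : r ∈ Icc K⁻¹ K) : ‖powHalf w r - powHalf z r‖ ≤
      Real.exp (|z.re| * Real.log K) * (2 * (‖w - z‖ * Real.log K)) := by
  have h1 := norm_half_mul_log_le hK (w - z) hr
  rw [powHalf_sub, norm_mul]
  refine mul_le_mul (norm_powHalf_le hK z hr) ((Complex.norm_exp_sub_one_le (h1.trans hw)).trans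
    (by linarith)) (norm_nonneg _) (Real.exp_pos _).le

/-- The derivative in `z` of `powHalf z r`. -/
def powHalfDeriv (z : ℂ) (r : ℝ) : ℂ := 1 / 2 * (Real.log r : ℂ) * powHalf z r

theorem isMeasMultiplier_powHalfDeriv (z : ℂ) : D.IsMeasMultiplier (powHalfDeriv z) :=
  ((isMeasMultiplier_const _).mul isMeasMultiplier_log).mul (isMeasMultiplier_powHalf z)

theorem norm_powHalfDeriv_le (hK : 1 ≤ K) (z : ℂ) {r : ℝ} (hr : r ∈ Icc K⁻¹ K) :
    ‖powHalfDeriv z r‖ ≤ Real.log K * Real.exp (|z.re| * Real.log K) := by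
  rw [powHalfDeriv, norm_mul]
  have h := norm_half_mul_log_le hK 1 hr
  rw [norm_one, one_mul] at h
  exact mul_le_mul h (norm_powHalf_le hK z hr) (norm_nonneg _) (Real.log_nonneg hK)

theorem norm_slope_powHalf_sub_le (hK : 1 ≤ K) {w z : ℂ} (hw : ‖w - z‖ * Real.log K ≤ 1)
    (hwz : w ≠ z) {r : ℝ} (hr : r ∈ Icc K⁻¹ K) :
    ‖(w - z)⁻¹ * (powHalf w r - powHalf z r) - powHalfDeriv z r‖ ≤
      Real.exp (|z.re| * Real.log K) * (‖w - z‖ * Real.log K ^ 2) := by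
  have h1 := norm_half_mul_log_le hK (w - z) hr
  have hwz' : w - z ≠ 0 := sub_ne_zero.2 hwz
  have hn : 0 < ‖w - z‖ := norm_pos_iff.2 hwz'
  have heq : (w - z)⁻¹ * (powHalf w r - powHalf z r) - powHalfDeriv z r =
      powHalf z r * ((w - z)⁻¹ * (Complex.exp ((w - z) / 2 * (Real.log r : ℂ)) - 1 -
        (w - z) / 2 * (Real.log r : ℂ))) := by
    rw [powHalf_sub, powHalfDeriv]
    field_simp
  rw [heq, norm_mul, norm_mul, norm_inv]
  refine mul_le_mul (norm_powHalf_le hK z hr) ?_ (by positivity) (Real.exp_pos _).le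
  rw [inv_mul_le_iff₀ hn]
  refine (Complex.norm_exp_sub_one_sub_id_le (h1.trans hw)).trans ?_
  calc _ ≤ (‖w - z‖ * Real.log K) ^ 2 := by gcongr
    _ = _ := by ring

end SpectralField

/-! ### Holomorphy of the pairing, the three lines argument and exhaustion by bands. -/

namespace SpectralField

variable {X : Type*} [MeasurableSpace X] {μ : Measure X} {E : Type*} [NormedAddCommGroup E]
  [NormedSpace ℂ E] {N : ℕ} {D : SpectralField μ E N} {S : Set X} {K : ℝ} {ξ : X → E}

theorem IsBand.exists_norm_pairing_le (hS : D.IsBand S K ξ) {f : ℂ → X →ₘ[μ] E}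
    (hf : IsCalderon (D.fieldNorm 0) (D.fieldNorm 1) f) :
    ∃ B : ℝ, ∀ z ∈ closedStrip, ‖D.pairing S ξ (powHalf z) (f z)‖ ≤ B := by
  obtain ⟨C, hC, hP⟩ := hS.exists_absPairing_le_sumNorm
  obtain ⟨Cf, hCf⟩ := hf.bounded
  have hlog := Real.log_nonneg hS.one_le
  have htop : C * ENNReal.ofReal (Real.exp (Real.log K)) * Cf ≠ ∞ :=
    ENNReal.mul_ne_top (ENNReal.mul_ne_top hC ENNReal.ofReal_ne_top) ENNReal.coe_ne_top
  refine ⟨(C * ENNReal.ofReal (Real.exp (Real.log K)) * Cf).toReal, fun z hz => ?_⟩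
  rw [← toReal_enorm]
  refine ENNReal.toReal_mono htop ((enorm_pairing_le _ _).trans ?_)
  refine (hP _ (isMeasMultiplier_powHalf z) _ (Real.exp_pos _).le (fun r hr =>
    (norm_powHalf_le hS.one_le z hr).trans (Real.exp_le_exp.2 ?_)) _).trans
      (mul_le_mul_right (hCf z hz) _)
  rw [abs_of_nonneg hz.1]
  nlinarith [hz.2]

theorem eventually_norm_sub_mul_le (z : ℂ) (L : ℝ) : ∀ᶠ w in 𝓝 z, ‖w - z‖ * L ≤ 1 := by
  have h : Continuous fun w : ℂ => ‖w - z‖ * L := by fun_prop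
  have := h.tendsto z
  simp only [sub_self, norm_zero, zero_mul] at this
  exact (this.eventually (gt_mem_nhds one_pos)).mono fun w hw => hw.le

theorem IsBand.continuousOn_pairing (hS : D.IsBand S K ξ) {f : ℂ → X →ₘ[μ] E}
    (hf : IsCalderon (D.fieldNorm 0) (D.fieldNorm 1) f) :
    ContinuousOn (fun z => D.pairing S ξ (powHalf z) (f z)) closedStrip := by
  obtain ⟨C, hC, hP⟩ := hS.exists_absPairing_le_sumNorm
  obtain ⟨Cf, hCf⟩ := hf.bounded
  have hK := hS.one_le
  have hlog := Real.log_nonneg hK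
  intro z hz
  have hfin : ∀ w v : ℂ, v ∈ closedStrip → D.absPairing S ξ (powHalf w) (f v) < ∞ := by
    intro w v hv
    refine (hP _ (isMeasMultiplier_powHalf w) _ (Real.exp_pos _).le
      (fun r hr => norm_powHalf_le hK w hr) _).trans_lt ?_
    exact ENNReal.mul_lt_top (ENNReal.mul_lt_top hC.lt_top ENNReal.ofReal_lt_top)
      ((hCf v hv).trans_lt ENNReal.coe_lt_top)
  have hsub : ∀ w : ℂ, D.IsMeasMultiplier fun r => powHalf w r - powHalf z r := fun w =>
    ((isMeasMultiplier_powHalf w).add ((isMeasMultiplier_const (-1)).mul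
      (isMeasMultiplier_powHalf z))).congr fun r _ => by ring
  set e := Real.exp (|z.re| * Real.log K) with he
  rw [ContinuousWithinAt, tendsto_iff_edist_tendsto_0]
  have hlim : Tendsto (fun w => C * ENNReal.ofReal (e * (2 * (‖w - z‖ * Real.log K))) * Cf +
      C * ENNReal.ofReal e * sumNorm (D.fieldNorm 0) (D.fieldNorm 1) (f w - f z))
      (𝓝[closedStrip] z) (𝓝 0) := by
    have h1 : Tendsto (fun w => ENNReal.ofReal (e * (2 * (‖w - z‖ * Real.log K))))
        (𝓝[closedStrip] z) (𝓝 0) := by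
      have : Continuous fun w => ENNReal.ofReal (e * (2 * (‖w - z‖ * Real.log K))) :=
        ENNReal.continuous_ofReal.comp (by fun_prop)
      simpa using (this.tendsto z).mono_left (nhdsWithin_le_nhds (s := closedStrip))
    have h2 := ENNReal.Tendsto.mul_const (b := Cf) (ENNReal.Tendsto.const_mul h1 (Or.inr hC))
      (Or.inr ENNReal.coe_ne_top)
    have h3 := ENNReal.Tendsto.const_mul (a := C * ENNReal.ofReal e) (hf.continuous z hz)
      (Or.inr (ENNReal.mul_ne_top hC ENNReal.ofReal_ne_top))
    simpa using h2.add h3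
  refine tendsto_of_tendsto_of_tendsto_of_le_of_le' tendsto_const_nhds hlim
    (Eventually.of_forall fun _ => bot_le) ?_
  filter_upwards [self_mem_nhdsWithin,
    nhdsWithin_le_nhds (eventually_norm_sub_mul_le z (Real.log K))] with w hw hwz
  -- Vary the multiplier first, with the field at w, and then the field. The first term uses that f
  -- is bounded, the second its continuity.
  have hdec : D.pairing S ξ (powHalf w) (f w) - D.pairing S ξ (powHalf z) (f z) =
      D.pairing S ξ (fun r => powHalf w r - powHalf z r) (f w) +
        D.pairing S ξ (powHalf z) (f w - f z : X →ₘ[μ] E) := by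
    rw [pairing_sub_left hS.meas (isMeasMultiplier_powHalf w) (isMeasMultiplier_powHalf z)
      (fun r => rfl) _ (hfin w w hw) (hfin z w hw),
      pairing_sub_right hS.meas (isMeasMultiplier_powHalf z) _ _ (hfin z w hw) (hfin z z hz)]
    ring
  rw [edist_eq_enorm_sub, hdec]
  refine (enorm_add_le _ _).trans (add_le_add ?_ ?_)
  · refine (enorm_pairing_le _ _).trans ((hP _ (hsub w) _ (by positivity)
      (fun r hr => norm_powHalf_sub_le hK hwz hr) _).trans (mul_le_mul_right (hCf w hw) _))
  · exact (enorm_pairing_le _ _).trans (hP _ (isMeasMultiplier_powHalf z) _ (Real.exp_pos _).le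
      (fun r hr => norm_powHalf_le hK z hr) _)

theorem IsBand.differentiableAt_pairing (hS : D.IsBand S K ξ) {f : ℂ → X →ₘ[μ] E}
    (hf : IsCalderon (D.fieldNorm 0) (D.fieldNorm 1) f) {z : ℂ} (hz0 : 0 < z.re)
    (hz1 : z.re < 1) : DifferentiableAt ℂ (fun z => D.pairing S ξ (powHalf z) (f z)) z := by
  obtain ⟨C, hC, hP⟩ := hS.exists_absPairing_le_sumNorm
  obtain ⟨Cf, hCf⟩ := hf.bounded
  obtain ⟨d, hd, hder⟩ := hf.holomorphic z hz0 hz1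
  have hK := hS.one_le
  have hlog := Real.log_nonneg hK
  have hz : z ∈ closedStrip := ⟨hz0.le, hz1.le⟩
  have hnhds : ∀ᶠ w in 𝓝 z, w ∈ closedStrip := by
    filter_upwards [Complex.continuous_re.continuousAt.eventually (lt_mem_nhds hz0),
      Complex.continuous_re.continuousAt.eventually (gt_mem_nhds hz1)] with w h0 h1
    exact ⟨h0.le, h1.le⟩
  have hfinη : ∀ {φ : ℝ → ℂ} (hφ : D.IsMeasMultiplier φ) {c : ℝ} (hc : 0 ≤ c)
      (h : ∀ r ∈ Icc K⁻¹ K, ‖φ r‖ ≤ c) {η : X →ₘ[μ] E},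
      sumNorm (D.fieldNorm 0) (D.fieldNorm 1) η < ∞ → D.absPairing S ξ φ η < ∞ := by
    intro φ hφ c hc h η hη
    exact (hP φ hφ c hc h η).trans_lt (ENNReal.mul_lt_top (ENNReal.mul_lt_top hC.lt_top
      ENNReal.ofReal_lt_top) hη)
  have hpow : ∀ (w : ℂ) {η : X →ₘ[μ] E}, sumNorm (D.fieldNorm 0) (D.fieldNorm 1) η < ∞ →
      D.absPairing S ξ (powHalf w) η < ∞ := fun w η =>
    hfinη (isMeasMultiplier_powHalf w) (Real.exp_pos _).le (fun r hr => norm_powHalf_le hK w hr)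
  have hpowd : ∀ (w : ℂ) {η : X →ₘ[μ] E}, sumNorm (D.fieldNorm 0) (D.fieldNorm 1) η < ∞ →
      D.absPairing S ξ (powHalfDeriv w) η < ∞ := fun w η =>
    hfinη (isMeasMultiplier_powHalfDeriv w) (mul_nonneg hlog (Real.exp_pos _).le)
      (fun r hr => norm_powHalfDeriv_le hK w hr)
  have hfw : ∀ w ∈ closedStrip, sumNorm (D.fieldNorm 0) (D.fieldNorm 1) (f w) < ∞ := fun w hw =>
    (hCf w hw).trans_lt ENNReal.coe_lt_top
  have hsub : ∀ w : ℂ, D.IsMeasMultiplier fun r => powHalf w r - powHalf z r := fun w =>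
    ((isMeasMultiplier_powHalf w).add ((isMeasMultiplier_const (-1)).mul
      (isMeasMultiplier_powHalf z))).congr fun r _ => by ring
  have hslope : ∀ w : ℂ, D.IsMeasMultiplier fun r => (w - z)⁻¹ * (powHalf w r - powHalf z r) :=
    fun w => (isMeasMultiplier_const _).mul (hsub w)
  have hrem : ∀ w : ℂ, D.IsMeasMultiplier fun r =>
      (w - z)⁻¹ * (powHalf w r - powHalf z r) - powHalfDeriv z r := fun w =>
    ((hslope w).add ((isMeasMultiplier_const (-1)).mul
      (isMeasMultiplier_powHalfDeriv z))).congr fun r _ => by ring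
  set e := Real.exp (|z.re| * Real.log K) with he
  set sN := sumNorm (D.fieldNorm 0) (D.fieldNorm 1) with hsN
  refine HasDerivAt.differentiableAt (f' := D.pairing S ξ (powHalfDeriv z) (f z) +
    D.pairing S ξ (powHalf z) d) ?_
  rw [hasDerivAt_iff_tendsto_slope, tendsto_iff_edist_tendsto_0]
  have hlim : Tendsto (fun w => C * ENNReal.ofReal (e * (‖w - z‖ * Real.log K ^ 2)) * Cf +
      C * ENNReal.ofReal (Real.log K * e) * sN (f w - f z) +
      C * ENNReal.ofReal e * sN ((w - z)⁻¹ • (f w - f z) - d)) (𝓝[≠] z) (𝓝 0) := by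
    have h1 : Tendsto (fun w => ENNReal.ofReal (e * (‖w - z‖ * Real.log K ^ 2)))
        (𝓝[≠] z) (𝓝 0) := by
      have : Continuous fun w => ENNReal.ofReal (e * (‖w - z‖ * Real.log K ^ 2)) :=
        ENNReal.continuous_ofReal.comp (by fun_prop)
      simpa using (this.tendsto z).mono_left (nhdsWithin_le_nhds (s := {z}ᶜ))
    have h2 := ENNReal.Tendsto.mul_const (b := Cf) (ENNReal.Tendsto.const_mul h1 (Or.inr hC))
      (Or.inr ENNReal.coe_ne_top)
    have h0 : Tendsto (fun w => sN (f w - f z)) (𝓝[≠] z) (𝓝 0) := by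
      refine (hf.continuous z hz).mono_left ?_
      exact nhdsWithin_le_nhds.trans (le_inf le_rfl (le_principal_iff.2 hnhds))
    have h3 := ENNReal.Tendsto.const_mul (a := C * ENNReal.ofReal (Real.log K * e)) h0
      (Or.inr (ENNReal.mul_ne_top hC ENNReal.ofReal_ne_top))
    have h4 := ENNReal.Tendsto.const_mul (a := C * ENNReal.ofReal e) hder
      (Or.inr (ENNReal.mul_ne_top hC ENNReal.ofReal_ne_top))
    simpa using (h2.add h3).add h4
  refine tendsto_of_tendsto_of_tendsto_of_le_of_le' tendsto_const_nhds hlim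
    (Eventually.of_forall fun _ => bot_le) ?_
  filter_upwards [nhdsWithin_le_nhds hnhds, self_mem_nhdsWithin,
    nhdsWithin_le_nhds (eventually_norm_sub_mul_le z (Real.log K)),
    hder.eventually (gt_mem_nhds (show (0 : ℝ≥0∞) < ∞ by simp))] with w hw hne hwz hfin
  have hne' : w ≠ z := hne
  have hA : D.absPairing S ξ (powHalf z) ((w - z)⁻¹ • (f w - f z) : X →ₘ[μ] E) < ∞ := by
    have h := absPairing_add_le (D := D) (S := S) hS.meas (isMeasMultiplier_powHalf z)
      ((w - z)⁻¹ • (f w - f z) - d) d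
    rw [sub_add_cancel] at h
    exact h.trans_lt (ENNReal.add_lt_top.2 ⟨hpow z hfin, hpow z hd⟩)
  have hq : D.absPairing S ξ (fun r => (w - z)⁻¹ * (powHalf w r - powHalf z r)) (f w) < ∞ := by
    refine hfinη (hslope w) (c := ‖(w - z)⁻¹‖ * (e * (2 * (‖w - z‖ * Real.log K))))
      (by positivity) (fun r hr => ?_) (hfw w hw)
    rw [norm_mul]
    exact mul_le_mul_of_nonneg_left (norm_powHalf_sub_le hK hwz hr) (norm_nonneg _)
  -- The product rule with its error terms written out: each is an absolute pairing that tends to 0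
  -- in w.
  have hdec : slope (fun z => D.pairing S ξ (powHalf z) (f z)) z w -
      (D.pairing S ξ (powHalfDeriv z) (f z) + D.pairing S ξ (powHalf z) d) =
      D.pairing S ξ (fun r => (w - z)⁻¹ * (powHalf w r - powHalf z r) - powHalfDeriv z r) (f w) +
      D.pairing S ξ (powHalfDeriv z) (f w - f z : X →ₘ[μ] E) +
      D.pairing S ξ (powHalf z) ((w - z)⁻¹ • (f w - f z) - d : X →ₘ[μ] E) := by
    rw [pairing_sub_left hS.meas (hslope w) (isMeasMultiplier_powHalfDeriv z) (fun r => rfl) _ hq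
        (hpowd z (hfw w hw)),
      pairing_smul_left (w - z)⁻¹ (fun r => rfl),
      pairing_sub_left hS.meas (isMeasMultiplier_powHalf w) (isMeasMultiplier_powHalf z)
        (fun r => rfl) _ (hpow w (hfw w hw)) (hpow z (hfw w hw)),
      pairing_sub_right hS.meas (isMeasMultiplier_powHalfDeriv z) _ _ (hpowd z (hfw w hw))
        (hpowd z (hfw z hz)),
      pairing_sub_right hS.meas (isMeasMultiplier_powHalf z) _ _ hA (hpow z hd),
      pairing_smul_right,
      pairing_sub_right hS.meas (isMeasMultiplier_powHalf z) _ _ (hpow z (hfw w hw))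
        (hpow z (hfw z hz)), slope_def_field, div_eq_inv_mul]
    ring
  rw [edist_eq_enorm_sub, hdec]
  refine (enorm_add_le _ _).trans (add_le_add ((enorm_add_le _ _).trans (add_le_add ?_ ?_)) ?_)
  · exact (enorm_pairing_le _ _).trans ((hP _ (hrem w) _ (by positivity)
      (fun r hr => norm_slope_powHalf_sub_le hK hwz hne' hr) _).trans
        (mul_le_mul_right (hCf w hw) _))
  · exact (enorm_pairing_le _ _).trans (hP _ (isMeasMultiplier_powHalfDeriv z) _
      (mul_nonneg hlog (Real.exp_pos _).le) (fun r hr => norm_powHalfDeriv_le hK z hr) _)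
  · exact (enorm_pairing_le _ _).trans (hP _ (isMeasMultiplier_powHalf z) _ (Real.exp_pos _).le
      (fun r hr => norm_powHalf_le hK z hr) _)

/-- On the line Re z = s the multiplier r^{z/2} has squared modulus rˢ, so Cauchy–Schwarz bounds the
pairing by ‖ξ‖ times the boundary norm of f for s = 0, 1. Phragmén–Lindelöf carries the bound into
the strip. -/
theorem IsBand.norm_pairing_le (hS : D.IsBand S K ξ) {f : ℂ → X →ₘ[μ] E}
    (hf : IsCalderon (D.fieldNorm 0) (D.fieldNorm 1) f) {M : ℝ≥0∞} (hM : M ≠ ∞)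
    (h0 : ∀ y : ℝ, D.fieldNorm 0 (f (y * Complex.I)) ≤ M)
    (h1 : ∀ y : ℝ, D.fieldNorm 1 (f (1 + y * Complex.I)) ≤ M) {z : ℂ} (hz : z ∈ closedStrip) :
    ‖D.pairing S ξ (powHalf z) (f z)‖ ≤
      ((∫⁻ x in S, ENNReal.ofReal (D.energy 0 x (ξ x)) ∂μ) ^ (1 / 2 : ℝ) * M).toReal := by
  have hK0 : 0 < K := one_pos.trans_le hS.one_le
  have htop : (∫⁻ x in S, ENNReal.ofReal (D.energy 0 x (ξ x)) ∂μ) ^ (1 / 2 : ℝ) * M ≠ ∞ :=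
    ENNReal.mul_ne_top (ENNReal.rpow_ne_top_of_nonneg (by norm_num) hS.finite.ne) hM
  have hpos : ∀ r ∈ Icc K⁻¹ K, 0 < r := fun r hr => (inv_pos.2 hK0).trans_le hr.1
  have hbd : ∀ (s : ℝ) (z : ℂ), z.re = s → D.fieldNorm s (f z) ≤ M →
      ‖D.pairing S ξ (powHalf z) (f z)‖ ≤
      ((∫⁻ x in S, ENNReal.ofReal (D.energy 0 x (ξ x)) ∂μ) ^ (1 / 2 : ℝ) * M).toReal := by
    intro s z hzs hle
    rw [← toReal_enorm]
    refine ENNReal.toReal_mono htop ((enorm_pairing_le _ _).trans ((hS.absPairing_le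
      (isMeasMultiplier_powHalf z) (s := s) zero_le_one (fun r hr => ?_) (f z)).trans ?_))
    · rw [norm_powHalf_sq z (hpos r hr), hzs, one_mul]
    · rw [ENNReal.ofReal_one, ENNReal.one_rpow, one_mul]
      exact mul_le_mul_right hle _
  obtain ⟨B, hB⟩ := hS.exists_norm_pairing_le hf
  have hstrip : closedStrip = Complex.re ⁻¹' Icc 0 1 := by
    ext z
    simp [closedStrip]
  refine PhragmenLindelof.vertical_strip (a := 0) (b := 1)
    (f := fun z => D.pairing S ξ (powHalf z) (f z)) ⟨?_, ?_⟩ ?_ ?_ ?_ hz.1 hz.2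
  · intro w hw
    exact (hS.differentiableAt_pairing hf hw.1 hw.2).differentiableWithinAt
  · rw [Complex.closure_preimage_re, closure_Ioo zero_ne_one, ← hstrip]
    exact hS.continuousOn_pairing hf
  -- The pairing is bounded in the strip, so the growth condition holds with both constants zero.
  · refine ⟨0, by positivity, 0, ?_⟩
    refine Asymptotics.IsBigO.of_bound B ?_
    filter_upwards [mem_inf_of_right (mem_principal_self _)] with w hw
    simpa using hB w ⟨hw.1.le, hw.2.le⟩
  · intro w hw
    refine hbd 0 w hw ?_
    have := h0 w.im
    rwa [show (w.im : ℂ) * Complex.I = w from Complex.ext (by simp [hw]) (by simp)] at this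
  · intro w hw
    refine hbd 1 w hw ?_
    have := h1 w.im
    rwa [show 1 + (w.im : ℂ) * Complex.I = w from Complex.ext (by simp [hw]) (by simp)] at this

theorem energy_mult_powHalf (t : ℝ) (x : X) (ω : E) :
    D.energy 0 x (D.mult (powHalf t) x ω) = D.energy t x ω := by
  rw [energy_mult, energy]
  refine Finset.sum_congr rfl fun j _ => ?_
  rw [norm_powHalf_sq _ (D.eig_pos x j), Complex.ofReal_re, Real.rpow_zero, one_mul]

/-- Choose ξ to be ω multiplied by r^{t/2}. The pairing at z = t is then the energy R of ω on S, and
‖ξ‖² is R too, so R ≤ √R · M. -/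
theorem setLIntegral_energy_le {t : ℝ} (ht : t ∈ Icc (0 : ℝ) 1) {ω : X →ₘ[μ] E} (hK : 1 ≤ K)
    (hS : ∀ᵐ x ∂μ.restrict S, ∀ j, D.eig x j ∈ Icc K⁻¹ K)
    (hfin : ∫⁻ x in S, ENNReal.ofReal (D.energy t x (ω x)) ∂μ < ∞) {f : ℂ → X →ₘ[μ] E}
    (hf : IsCalderon (D.fieldNorm 0) (D.fieldNorm 1) f) (hft : f t = ω) {M : ℝ≥0∞} (hM : M ≠ ∞)
    (h0 : ∀ y : ℝ, D.fieldNorm 0 (f (y * Complex.I)) ≤ M)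
    (h1 : ∀ y : ℝ, D.fieldNorm 1 (f (1 + y * Complex.I)) ≤ M) :
    ∫⁻ x in S, ENNReal.ofReal (D.energy t x (ω x)) ∂μ ≤ M ^ 2 := by
  have hω := ω.aestronglyMeasurable
  have hband : D.IsBand S K fun x => D.mult (powHalf t) x (ω x) :=
    ⟨hK, hS, isMeasMultiplier_powHalf _ _ hω, by simpa only [energy_mult_powHalf] using hfin⟩
  have h := hband.norm_pairing_le hf hM h0 h1 (z := t) (by simpa [closedStrip] using ht)
  simp only [energy_mult_powHalf] at h
  set R := ∫⁻ x in S, ENNReal.ofReal (D.energy t x (ω x)) ∂μ with hR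
  have hpair : D.pairing S (fun x => D.mult (powHalf t) x (ω x)) (powHalf t) (f t) =
      (R.toReal : ℂ) := by
    have hpt : ∀ x, inner ℂ (D.coord x (D.mult (powHalf t) x (ω x)))
        (D.coord x (D.mult (powHalf t) x (ω x))) = ((D.energy t x (ω x) : ℝ) : ℂ) := by
      intro x
      rw [inner_self_eq_norm_sq_to_K, ← energy_mult_powHalf, energy_zero_exp]
      simp
    rw [hft, pairing]
    simp only [hpt]
    rw [integral_complex_ofReal, integral_eq_lintegral_of_nonneg_ae
      (Eventually.of_forall fun x => D.energy_nonneg _ _ _)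
      ((D.aemeasurable_energy t hω).mono_measure Measure.restrict_le_self).aestronglyMeasurable]
  rw [hpair, Complex.norm_real, Real.norm_eq_abs, abs_of_nonneg ENNReal.toReal_nonneg,
    ENNReal.toReal_mul, ← ENNReal.toReal_rpow, ← Real.sqrt_eq_rpow] at h
  rw [← ENNReal.toReal_le_toReal hfin.ne (ENNReal.pow_ne_top hM), ENNReal.toReal_pow]
  have hs := Real.sq_sqrt (ENNReal.toReal_nonneg (a := R))
  have hs0 := Real.sqrt_nonneg R.toReal
  have hm : 0 ≤ M.toReal := ENNReal.toReal_nonneg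
  rw [← hs] at h ⊢
  rw [Real.sqrt_sq hs0] at h
  refine pow_le_pow_left₀ hs0 ?_ 2
  rcases hs0.eq_or_lt with h' | h'
  · rw [← h']; exact hm
  · exact le_of_mul_le_mul_left (by rw [← sq]; exact h) h'

variable [FiniteDimensional ℂ E] [Nontrivial E]

/-- Evaluate both optimal inequalities on a coordinate vector. Unlike the weights, these bounds are
known to be measurable, so they can define the bands. -/
theorem eig_le (x : X) (j : Fin N) : D.eig x j ≤ D.upper 1 x * D.lower 0 x := by
  have hj : ∀ s : ℝ, D.energy s x ((D.coord x).symm (EuclideanSpace.single j 1)) =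
      D.eig x j ^ s := by
    intro s
    simp [energy, Finset.sum_ite_eq, apply_ite]
  have h1 := D.energy_le_upper 1 x ((D.coord x).symm (EuclideanSpace.single j 1))
  have h2 := D.norm_sq_le_lower 0 x ((D.coord x).symm (EuclideanSpace.single j 1))
  rw [hj, Real.rpow_one] at h1
  rw [hj, Real.rpow_zero, mul_one] at h2
  exact h1.trans (mul_le_mul_of_nonneg_left h2 (D.upper_nonneg 1 x))

theorem inv_eig_le (x : X) (j : Fin N) : (D.eig x j)⁻¹ ≤ D.upper 0 x * D.lower 1 x := by
  have hj : ∀ s : ℝ, D.energy s x ((D.coord x).symm (EuclideanSpace.single j 1)) =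
      D.eig x j ^ s := by
    intro s
    simp [energy, Finset.sum_ite_eq, apply_ite]
  have h1 := D.energy_le_upper 0 x ((D.coord x).symm (EuclideanSpace.single j 1))
  have h2 := D.norm_sq_le_lower 1 x ((D.coord x).symm (EuclideanSpace.single j 1))
  rw [hj, Real.rpow_zero] at h1
  rw [hj, Real.rpow_one] at h2
  rw [inv_le_iff_one_le_mul₀ (D.eig_pos x j), mul_assoc]
  exact h1.trans (mul_le_mul_of_nonneg_left h2 (D.upper_nonneg 0 x))

theorem le_interpNorm [IsFiniteMeasure μ] {t : ℝ} (ht : t ∈ Icc (0 : ℝ) 1) (ω : X →ₘ[μ] E) :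
    D.fieldNorm t ω ≤ interpNorm (D.fieldNorm 0) (D.fieldNorm 1) t ω := by
  refine le_iInf fun f => le_iInf fun hf => le_iInf fun hft => ?_
  set M := max (⨆ y : ℝ, D.fieldNorm 0 (f (y * Complex.I)))
    (⨆ y : ℝ, D.fieldNorm 1 (f (1 + y * Complex.I))) with hMdef
  rcases eq_or_ne M ∞ with hM | hM
  · rw [hM]; exact le_top
  have h0 : ∀ y : ℝ, D.fieldNorm 0 (f (y * Complex.I)) ≤ M := fun y =>
    le_max_of_le_left (le_iSup (fun y : ℝ => D.fieldNorm 0 (f (y * Complex.I))) y)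
  have h1 : ∀ y : ℝ, D.fieldNorm 1 (f (1 + y * Complex.I)) ≤ M := fun y =>
    le_max_of_le_right (le_iSup (fun y : ℝ => D.fieldNorm 1 (f (1 + y * Complex.I))) y)
  have hu : AEMeasurable (fun x => D.upper 1 x * D.lower 0 x) μ :=
    (D.aemeasurable_upper 1).mul (D.aemeasurable_lower 0)
  have hv : AEMeasurable (fun x => D.upper 0 x * D.lower 1 x) μ :=
    (D.aemeasurable_upper 0).mul (D.aemeasurable_lower 1)
  have hw := D.aemeasurable_energy t ω.aestronglyMeasurable
  -- A measurable function dominating, almost everywhere, the weights, their inverses and the energy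
  -- density. Its sublevel sets are bands of finite energy that exhaust X.
  set b : X → ℝ := fun x => max (max (hu.mk _ x) (hv.mk _ x)) (hw.mk _ x) with hb
  have hbm : Measurable b := (hu.measurable_mk.max hv.measurable_mk).max hw.measurable_mk
  set T : ℕ → Set X := fun m => {x | b x ≤ m + 1} with hT
  have hTm : ∀ m, MeasurableSet (T m) := fun m => measurableSet_le hbm measurable_const
  have hmono : Monotone T := fun m m' h x (hx : b x ≤ m + 1) => by
    have : (m : ℝ) ≤ m' := by exact_mod_cast h
    exact hx.trans (by linarith)
  have hunion : ⋃ m, T m = univ := by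
    refine eq_univ_of_forall fun x => mem_iUnion.2 ?_
    obtain ⟨m, hm⟩ := exists_nat_ge (b x)
    exact ⟨m, hm.trans (by linarith)⟩
  have key : ∀ m, ∫⁻ x in T m, ENNReal.ofReal (D.energy t x (ω x)) ∂μ ≤ M ^ 2 := by
    intro m
    have hm0 : (0 : ℝ) ≤ m := m.cast_nonneg
    have hae : ∀ᵐ x ∂μ.restrict (T m), D.upper 1 x * D.lower 0 x ≤ m + 1 ∧
        D.upper 0 x * D.lower 1 x ≤ m + 1 ∧ D.energy t x (ω x) ≤ m + 1 := by
      filter_upwards [ae_restrict_mem (hTm m), ae_restrict_of_ae hu.ae_eq_mk,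
        ae_restrict_of_ae hv.ae_eq_mk, ae_restrict_of_ae hw.ae_eq_mk] with x hx h1 h2 h3
      rw [h1, h2, h3]
      exact ⟨((le_max_left _ _).trans (le_max_left _ _)).trans hx,
        ((le_max_right _ _).trans (le_max_left _ _)).trans hx, (le_max_right _ _).trans hx⟩
    refine setLIntegral_energy_le ht (K := m + 1) (by linarith) ?_ ?_ hf hft hM h0 h1
    · filter_upwards [hae] with x hx j
      refine ⟨?_, (eig_le x j).trans hx.1⟩
      exact inv_le_of_inv_le₀ (D.eig_pos x j) ((inv_eig_le x j).trans hx.2.1)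
    · refine (lintegral_mono_ae (g := fun _ => ENNReal.ofReal (m + 1)) ?_).trans_lt ?_
      · filter_upwards [hae] with x hx using ENNReal.ofReal_le_ofReal hx.2.2
      · rw [lintegral_const]
        exact ENNReal.mul_lt_top ENNReal.ofReal_lt_top (measure_lt_top _ _)
  have htot : ∫⁻ x, ENNReal.ofReal (D.energy t x (ω x)) ∂μ ≤ M ^ 2 := by
    rw [← setLIntegral_univ, ← hunion, setLIntegral_iUnion_of_directed _ hmono.directed_le]
    exact iSup_le key
  calc D.fieldNorm t ω ≤ (M ^ 2) ^ (1 / 2 : ℝ) := ENNReal.rpow_le_rpow htot (by norm_num)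
    _ = M := by
      rw [← ENNReal.rpow_natCast, ← ENNReal.rpow_mul]
      norm_num

theorem interpNorm_eq [IsFiniteMeasure μ] {t : ℝ} (ht : t ∈ Icc (0 : ℝ) 1) (ω : X →ₘ[μ] E) :
    interpNorm (D.fieldNorm 0) (D.fieldNorm 1) t ω = D.fieldNorm t ω :=
  le_antisymm (interpNorm_le t ω) (le_interpNorm ht ω)

end SpectralField

/-! ### Measurable fields of forms -/

section Measurability

variable {X : Type*} [MeasurableSpace X] {μ : Measure X} {n k : ℕ}

theorem aestronglyMeasurable_mat_inv {A : X → Mat n} (hA : AEStronglyMeasurable A μ) :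
    AEStronglyMeasurable (fun x => (A x)⁻¹) μ := by
  have h1 : AEStronglyMeasurable (fun x => (A x).det⁻¹) μ :=
    ((continuous_id.matrix_det.comp_aestronglyMeasurable hA).aemeasurable.inv).aestronglyMeasurable
  have h2 : AEStronglyMeasurable (fun x => (A x).adjugate) μ :=
    continuous_id.matrix_adjugate.comp_aestronglyMeasurable hA
  have h3 : AEStronglyMeasurable (fun x => (A x).det⁻¹ • (A x).adjugate) μ :=
    (continuous_fst.smul continuous_snd).comp_aestronglyMeasurable (h1.prodMk h2)
  simpa only [Matrix.inv_def, Ring.inverse_eq_inv'] using h3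

theorem aestronglyMeasurable_formCoord_apply {R : X → Mat n} (hR : AEStronglyMeasurable R μ)
    {η : X → Form n k} (hη : AEStronglyMeasurable η μ) (v : Fin k → Fin n) :
    AEStronglyMeasurable (fun x => formCoord (R x) (η x) v) μ := by
  have h1 : ∀ u : Fin k → Fin n, AEStronglyMeasurable (fun x => formCoord 1 (η x) u) μ := by
    intro u
    have hc : Continuous (formCoord (n := n) (k := k) 1) := LinearMap.continuous_of_finiteDimensional _
    exact ((EuclideanSpace.proj u : EuclideanSpace ℂ (Fin k → Fin n) →L[ℂ] ℂ).continuous.comp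
      hc).comp_aestronglyMeasurable hη
  have h2 : ∀ u : Fin k → Fin n,
      AEStronglyMeasurable (fun x => ((∏ j, R x (u j) (v j) : ℝ) : ℂ)) μ := by
    intro u
    have hc : Continuous fun M : Mat n => ((∏ j, M (u j) (v j) : ℝ) : ℂ) :=
      Complex.continuous_ofReal.comp (continuous_finsetProd _ fun j _ =>
        continuous_id.matrix_elem _ _)
    exact hc.comp_aestronglyMeasurable hR
  have h3 : (fun x => formCoord (R x) (η x) v) = fun x =>
      ∑ u : Fin k → Fin n, ((∏ j, R x (u j) (v j) : ℝ) : ℂ) * formCoord 1 (η x) u := by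
    funext x
    rw [← formCoord_mul, one_mul]
  rw [h3]
  exact Finset.aestronglyMeasurable_fun_sum _ fun u _ => (h2 u).mul (h1 u)

/-- A linear left inverse of the coordinate map recovers a form from its coordinates, which are
polynomial in the matrix. -/
theorem aestronglyMeasurable_pullForm {R : X → Mat n} (hR : AEStronglyMeasurable R μ)
    {η : X → Form n k} (hη : AEStronglyMeasurable η μ) :
    AEStronglyMeasurable (fun x => pullForm (R x) (η x)) μ := by
  obtain ⟨L, hL⟩ := (formCoord (n := n) (k := k) 1).exists_leftInverse_of_injective
    (LinearMap.ker_eq_bot.2 (formCoord_injective (by simp)))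
  have hLc : Continuous L := LinearMap.continuous_of_finiteDimensional _
  have h : (fun x => pullForm (R x) (η x)) =
      fun x => L (WithLp.toLp 2 fun v => formCoord (R x) (η x) v) := by
    funext x
    have := LinearMap.congr_fun hL (pullForm (R x) (η x))
    simp only [LinearMap.comp_apply, LinearMap.id_apply, formCoord_pullForm, mul_one] at this
    exact this.symm
  rw [h]
  refine (hLc.comp (PiLp.continuous_toLp 2 _)).comp_aestronglyMeasurable ?_
  exact (aemeasurable_pi_lambda _ fun v =>
    (aestronglyMeasurable_formCoord_apply hR hη v).aemeasurable).aestronglyMeasurable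

theorem formNormSq_nonneg (A : Mat n) (ω : Form n k) : 0 ≤ formNormSq A ω :=
  mul_nonneg (by positivity) (Finset.sum_nonneg fun _ _ => sq_nonneg _)

theorem aemeasurable_formDensity {A : X → Mat n} (hA : AEStronglyMeasurable A μ)
    (hpos : ∀ᵐ x ∂μ, (A x).PosDef) {η : X → Form n k} (hη : AEStronglyMeasurable η μ) :
    AEMeasurable (fun x => formDensity (A x) (η x)) μ := by
  unfold formDensity
  simp only [formNormSq_eq]
  refine AEMeasurable.mul (AEMeasurable.const_mul (Finset.aemeasurable_fun_sum _ fun v _ => ?_) _)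
    ((Real.continuous_sqrt.comp continuous_id.matrix_det).comp_aestronglyMeasurable hA).aemeasurable
  exact (aestronglyMeasurable_formCoord_apply (aestronglyMeasurable_matPow hA hpos _)
    hη v).norm.aemeasurable.pow_const 2

/-- The multiplier is an explicit expression in the two matrices, so no measurable choice of a
diagonalizing basis is needed. -/
theorem aestronglyMeasurable_formMultiplier {A B : X → Mat n} (hA : AEStronglyMeasurable A μ)
    (hB : AEStronglyMeasurable B μ) (hApos : ∀ᵐ x ∂μ, (A x).PosDef)
    (hBpos : ∀ᵐ x ∂μ, (B x).PosDef) (s : ℝ) {η : X → Form n k}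
    (hη : AEStronglyMeasurable η μ) :
    AEStronglyMeasurable (fun x => formMultiplier (A x) (B x) s (η x)) μ := by
  have hdet : ∀ {M : X → Mat n}, AEStronglyMeasurable M μ → AEMeasurable (fun x => (M x).det) μ :=
    fun hM => (continuous_id.matrix_det.comp_aestronglyMeasurable hM).aemeasurable
  have h1 : AEStronglyMeasurable
      (fun x => ((((B x).det / (A x).det) ^ (s / 2) : ℝ) : ℂ)) μ :=
    Complex.continuous_ofReal.comp_aestronglyMeasurable
      (((hdet hB).div (hdet hA)).pow_const _).aestronglyMeasurable
  exact h1.smul (aestronglyMeasurable_pullForm (aestronglyMeasurable_mat_mul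
    (aestronglyMeasurable_mat_inv (aestronglyMeasurable_geomMean hA hB hApos hBpos s)) hA) hη)

/-- The spectral field of two measurable Euclidean structures. -/
theorem exists_spectralField (k : ℕ) {A B : X → Mat n} (hA : AEStronglyMeasurable A μ)
    (hB : AEStronglyMeasurable B μ) (hApos : ∀ᵐ x ∂μ, (A x).PosDef)
    (hBpos : ∀ᵐ x ∂μ, (B x).PosDef) :
    ∃ D : SpectralField μ (Form n k) (Module.finrank ℂ (Form n k)), ∀ᵐ x ∂μ, ∀ t ω,
      formDensity (geomMean (A x) (B x) t) ω = D.energy t x ω := by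
  classical
  have hex : ∀ x, ∃ (b : Form n k ≃ₗ[ℂ] EuclideanSpace ℂ (Fin (Module.finrank ℂ (Form n k))))
      (f : Fin (Module.finrank ℂ (Form n k)) → ℝ), (∀ j, 0 < f j) ∧
      ((A x).PosDef → (B x).PosDef →
        (∀ s ω j, b (formMultiplier (A x) (B x) s ω) j = ((f j ^ s : ℝ) : ℂ) * b ω j) ∧
        ∀ t ω, formDensity (geomMean (A x) (B x) t) ω = ∑ j, f j ^ t * ‖b ω j‖ ^ 2) := by
    intro x
    by_cases h : (A x).PosDef ∧ (B x).PosDef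
    · obtain ⟨b, f, h1, h2, h3⟩ := exists_coord_formDensity (k := k) h.1 h.2
      exact ⟨b, f, h1, fun _ _ => ⟨h2, h3⟩⟩
    -- On the null set where positivity fails any coordinates with unit weights will do.
    · exact ⟨LinearEquiv.ofFinrankEq _ _ (by simp), fun _ => 1, fun _ => one_pos,
        fun h1 h2 => absurd ⟨h1, h2⟩ h⟩
  choose b f hf hbf using hex
  have hpos : ∀ᵐ x ∂μ, (A x).PosDef ∧ (B x).PosDef := hApos.and hBpos
  refine ⟨⟨b, f, hf, fun s η hη => ?_, fun η hη => ?_⟩, ?_⟩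
  · refine (aestronglyMeasurable_formMultiplier hA hB hApos hBpos s hη).congr ?_
    filter_upwards [hpos] with x hx
    refine (b x).injective ?_
    ext j
    rw [(hbf x hx.1 hx.2).1]
    simp
  · refine (aemeasurable_formDensity hA hApos hη).congr ?_
    filter_upwards [hpos] with x hx
    have := (hbf x hx.1 hx.2).2 0 (η x)
    rw [geomMean_zero hx.1 hx.2] at this
    rw [this, EuclideanSpace.norm_sq_eq]
    simp
  · filter_upwards [hpos] with x hx
    exact (hbf x hx.1 hx.2).2

end Measurability

/-! ### The spaces `Ωᵏ` in terms of spectral fields -/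

section Omega

variable {n k : ℕ} {U : Set (Model n)} {A : Model n → Mat n} {N : ℕ}
  {D : SpectralField (volume.restrict U) (Form n k) N} {t : ℝ}

theorem normSq_eq_lintegral_formDensity (A : Model n → Mat n) (ω : Model n → Form n k) :
    normSq k U A ω = ∫⁻ x in U, ENNReal.ofReal (formDensity (A x) (ω x)) := by
  unfold normSq formDensity
  simp only [ENNReal.ofReal_mul (formNormSq_nonneg _ _)]

theorem normSq_congr {A A' : Model n → Mat n} {ω ω' : Model n → Form n k}
    (hA : A =ᵐ[volume.restrict U] A') (hω : ω =ᵐ[volume.restrict U] ω') :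
    normSq k U A ω = normSq k U A' ω' := by
  refine lintegral_congr_ae ?_
  filter_upwards [hA, hω] with x h1 h2
  rw [h1, h2]

theorem normSq_eq_lintegral_energy
    (h : ∀ᵐ x ∂volume.restrict U, ∀ ω, formDensity (A x) ω = D.energy t x ω)
    (ω : Model n → Form n k) :
    normSq k U A ω = ∫⁻ x in U, ENNReal.ofReal (D.energy t x (ω x)) := by
  rw [normSq_eq_lintegral_formDensity]
  refine lintegral_congr_ae ?_
  filter_upwards [h] with x hx
  rw [hx]

theorem memOmega_iff (h : ∀ᵐ x ∂volume.restrict U, ∀ ω, formDensity (A x) ω = D.energy t x ω)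
    (ω : Model n → Form n k) : MemOmega k U A ω ↔ D.FiniteEnergy t ω := by
  rw [MemOmega, normSq_eq_lintegral_energy h]
  rfl

theorem lpSubOmega_iff (h : ∀ᵐ x ∂volume.restrict U, ∀ ω, formDensity (A x) ω = D.energy t x ω)
    (p : ℝ≥0∞) : LpSubOmega k U A p ↔ D.LpSub t p := by
  simp only [LpSubOmega, SpectralField.LpSub, memOmega_iff h]

theorem omegaSubLp_iff (h : ∀ᵐ x ∂volume.restrict U, ∀ ω, formDensity (A x) ω = D.energy t x ω)
    (q : ℝ≥0∞) : OmegaSubLp k U A q ↔ D.SubLp t q := by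
  simp only [OmegaSubLp, SpectralField.SubLp, memOmega_iff h]

theorem pExp_eq (h : ∀ᵐ x ∂volume.restrict U, ∀ ω, formDensity (A x) ω = D.energy t x ω) :
    pExp k U A = sInf {p | 2 ≤ p ∧ D.LpSub t p} := by
  simp only [pExp, lpSubOmega_iff h]

theorem qExp_eq (h : ∀ᵐ x ∂volume.restrict U, ∀ ω, formDensity (A x) ω = D.energy t x ω) :
    qExp k U A = sSup {q | 1 ≤ q ∧ q ≤ 2 ∧ D.SubLp t q} := by
  simp only [qExp, omegaSubLp_iff h]

theorem omegaNorm_eq (h : ∀ᵐ x ∂volume.restrict U, ∀ ω, formDensity (A x) ω = D.energy t x ω) :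
    omegaNorm k U A = D.fieldNorm t := by
  funext ω
  rw [omegaNorm, normSq_eq_lintegral_energy h, SpectralField.fieldNorm]

end Omega

/-! ### Forms given by minors, and nontriviality of the spaces of forms. -/

/-- The `k`-form whose value is the minor of the coordinates of index `w`. -/
def minorForm {n k : ℕ} (w : Fin k → Fin n) : Form n k :=
  let L : Model n →L[ℝ] (Fin k → ℝ) := ContinuousLinearMap.pi fun i => EuclideanSpace.proj (w i)
  let M : (Fin k → ℝ) [⋀^Fin k]→L[ℝ] ℝ :=
    { Matrix.detRowAlternating with
      cont := by
        change Continuous fun M : Matrix (Fin k) (Fin k) ℝ => M.det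
        exact continuous_id.matrix_det }
  Complex.ofRealCLM.compContinuousAlternatingMap (M.compContinuousLinearMap L)

theorem minorForm_apply {n k : ℕ} (w : Fin k → Fin n) (u : Fin k → Model n) :
    minorForm w u = ((Matrix.of fun i j => u i (w j)).det : ℂ) := by
  rfl

theorem minorForm_single {n k : ℕ} {w : Fin k → Fin n} (hw : Function.Injective w) :
    minorForm w (fun i => EuclideanSpace.single (w i) 1) = 1 := by
  rw [minorForm_apply]
  have : (Matrix.of fun i j => (EuclideanSpace.single (w i) 1 : Model n) (w j)) =
      (1 : Matrix (Fin k) (Fin k) ℝ) := by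
    ext i j
    simp [Matrix.one_apply, hw.eq_iff, eq_comm]
  rw [this, Matrix.det_one, Complex.ofReal_one]

theorem nontrivial_form {n k : ℕ} (h : k ≤ n) : Nontrivial (Form n k) := by
  refine ⟨⟨minorForm (Fin.castLE h), 0, fun h0 => ?_⟩⟩
  have := minorForm_single (Fin.castLE_injective h)
  rw [h0] at this
  simp at this

/-! ### Lower bounds of geometric means -/

section LowerBound

open Matrix

variable {n : ℕ} {P : Mat n}

theorem dotProduct_transpose_diagonal (c : Fin n → ℝ) (x : Fin n → ℝ) :
    x ⬝ᵥ ((Pᵀ * diagonal c * P) *ᵥ x) = ∑ i, c i * (P *ᵥ x) i ^ 2 := by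
  rw [← mulVec_mulVec, ← mulVec_mulVec, dotProduct_mulVec, vecMul_transpose, dotProduct]
  refine Finset.sum_congr rfl fun i _ => ?_
  rw [mulVec_diagonal]
  ring

theorem mulVec_dotProduct_inv (hP : IsUnit P.det) (x z : Fin n → ℝ) :
    (P *ᵥ z) ⬝ᵥ ((P⁻¹)ᵀ *ᵥ x) = z ⬝ᵥ x := by
  rw [dotProduct_mulVec, vecMul_transpose, mulVec_mulVec, Matrix.nonsing_inv_mul _ hP, one_mulVec]

/-- For M = Pᵀ C P the sum is xᵀ M⁻¹ x, so this is the passage from M ≥ b to M⁻¹ ≤ 1/b. Test the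
hypothesis on z = M⁻¹ x and use Cauchy–Schwarz. -/
theorem sum_inv_mul_sq_le (hP : IsUnit P.det) {c : Fin n → ℝ} (hc : ∀ i, 0 < c i) {b : ℝ}
    (hb : 0 < b) (h : ∀ z : Fin n → ℝ, b * (z ⬝ᵥ z) ≤ z ⬝ᵥ ((Pᵀ * diagonal c * P) *ᵥ z))
    (x : Fin n → ℝ) :
    ∑ i, (c i)⁻¹ * ((P⁻¹)ᵀ *ᵥ x) i ^ 2 ≤ (x ⬝ᵥ x) / b := by
  set w := (P⁻¹)ᵀ *ᵥ x with hw
  set S := ∑ i, (c i)⁻¹ * w i ^ 2 with hS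
  set z := P⁻¹ *ᵥ fun i => (c i)⁻¹ * w i with hz
  have hPz : P *ᵥ z = fun i => (c i)⁻¹ * w i := by
    rw [hz, mulVec_mulVec, Matrix.mul_nonsing_inv _ hP, one_mulVec]
  have hS0 : 0 ≤ S := Finset.sum_nonneg fun i _ =>
    mul_nonneg (inv_nonneg.2 (hc i).le) (sq_nonneg _)
  have h1 := h z
  rw [dotProduct_transpose_diagonal, hPz] at h1
  have h2 : ∑ i, c i * ((c i)⁻¹ * w i) ^ 2 = S := by
    refine Finset.sum_congr rfl fun i _ => ?_
    have := (hc i).ne'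
    field_simp
  rw [h2] at h1
  have h3 : z ⬝ᵥ x = S := by
    rw [← mulVec_dotProduct_inv hP, hPz, ← hw, dotProduct]
    exact Finset.sum_congr rfl fun i _ => by ring
  have h4 : (z ⬝ᵥ x) ^ 2 ≤ (z ⬝ᵥ z) * (x ⬝ᵥ x) := by
    have := Finset.sum_mul_sq_le_sq_mul_sq Finset.univ z x
    simpa [dotProduct, sq] using this
  have hx0 : 0 ≤ x ⬝ᵥ x := Finset.sum_nonneg fun i _ => mul_self_nonneg _
  rw [h3] at h4
  rw [le_div_iff₀ hb]
  rcases hS0.eq_or_lt with h' | h'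
  · rw [← h']; simpa using hx0
  · refine le_of_mul_le_mul_left ?_ h'
    nlinarith

/-- Hölder bounds geometric means from above only. It is applied to the inverse matrices, and
Cauchy–Schwarz returns to the lower bound. -/
theorem le_dotProduct_geomMean {A B : Mat n} (hA : A.PosDef) (hB : B.PosDef) {b : ℝ} (hb : 0 < b)
    (hA' : ∀ z : Fin n → ℝ, b * (z ⬝ᵥ z) ≤ z ⬝ᵥ (A *ᵥ z))
    (hB' : ∀ z : Fin n → ℝ, b * (z ⬝ᵥ z) ≤ z ⬝ᵥ (B *ᵥ z)) {t : ℝ} (h0 : 0 ≤ t) (h1 : t ≤ 1)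
    (x : Fin n → ℝ) : b * (x ⬝ᵥ x) ≤ x ⬝ᵥ (geomMean A B t *ᵥ x) := by
  obtain ⟨P, d, hP, hd, rfl, rfl, h⟩ := exists_simultaneous_diag hA hB
  rw [h, dotProduct_transpose_diagonal]
  have hx0 : 0 ≤ x ⬝ᵥ x := Finset.sum_nonneg fun i _ => mul_self_nonneg _
  set w := (P⁻¹)ᵀ *ᵥ x with hw
  have hA1 := sum_inv_mul_sq_le hP (c := fun _ => 1) (fun _ => one_pos) hb
    (by simpa using hA') x
  have hB1 := sum_inv_mul_sq_le hP hd hb hB' x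
  simp only [inv_one, one_mul] at hA1
  rw [← hw] at hA1 hB1
  have h2 : ∑ i, (d i ^ t)⁻¹ * w i ^ 2 ≤ (x ⬝ᵥ x) / b := by
    have h3 := sum_rpow_mul_rpow_le Finset.univ (u := fun i => w i ^ 2)
      (v := fun i => (d i)⁻¹ * w i ^ 2) (fun i _ => sq_nonneg _)
      (fun i _ => mul_nonneg (inv_nonneg.2 (hd i).le) (sq_nonneg _)) h0 h1
    have hA0 : 0 ≤ ∑ i, w i ^ 2 := Finset.sum_nonneg fun i _ => sq_nonneg _
    have hB0 : 0 ≤ ∑ i, (d i)⁻¹ * w i ^ 2 := Finset.sum_nonneg fun i _ =>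
      mul_nonneg (inv_nonneg.2 (hd i).le) (sq_nonneg _)
    have hq0 : 0 ≤ (x ⬝ᵥ x) / b := hA0.trans hA1
    calc ∑ i, (d i ^ t)⁻¹ * w i ^ 2
        = ∑ i, (w i ^ 2) ^ (1 - t) * ((d i)⁻¹ * w i ^ 2) ^ t := by
          refine Finset.sum_congr rfl fun i _ => ?_
          rw [Real.mul_rpow (inv_nonneg.2 (hd i).le) (sq_nonneg _), Real.inv_rpow (hd i).le,
            mul_left_comm, ← Real.rpow_add_of_nonneg (sq_nonneg _) (by linarith) h0]
          simp
      _ ≤ _ := h3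
      _ ≤ ((x ⬝ᵥ x) / b) ^ (1 - t) * ((x ⬝ᵥ x) / b) ^ t := by
          gcongr
      _ = (x ⬝ᵥ x) / b := by
          rw [← Real.rpow_add_of_nonneg hq0 (by linarith) h0]
          simp
  have h4 : (x ⬝ᵥ x) ^ 2 ≤ (∑ i, d i ^ t * (P *ᵥ x) i ^ 2) * ∑ i, (d i ^ t)⁻¹ * w i ^ 2 := by
    have h5 := Finset.sum_mul_sq_le_sq_mul_sq Finset.univ
      (fun i => Real.sqrt (d i ^ t) * (P *ᵥ x) i) (fun i => (Real.sqrt (d i ^ t))⁻¹ * w i)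
    have hs : ∀ i, 0 < d i ^ t := fun i => Real.rpow_pos_of_pos (hd i) t
    have h6 : ∑ i, Real.sqrt (d i ^ t) * (P *ᵥ x) i * ((Real.sqrt (d i ^ t))⁻¹ * w i) =
        x ⬝ᵥ x := by
      rw [← mulVec_dotProduct_inv hP, ← hw, dotProduct]
      refine Finset.sum_congr rfl fun i _ => ?_
      have := (Real.sqrt_pos.2 (hs i)).ne'
      field_simp
    simp only [h6, mul_pow, inv_pow, Real.sq_sqrt (hs _).le] at h5
    exact h5
  have hG0 : 0 ≤ ∑ i, d i ^ t * (P *ᵥ x) i ^ 2 := Finset.sum_nonneg fun i _ =>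
    mul_nonneg (Real.rpow_nonneg (hd i).le _) (sq_nonneg _)
  rcases hx0.eq_or_lt with h' | h'
  · rw [← h']; simpa using hG0
  · have h7 := h4.trans (mul_le_mul_of_nonneg_left h2 hG0)
    rw [mul_div_assoc', le_div_iff₀ hb] at h7
    refine le_of_mul_le_mul_right ?_ h'
    linarith

theorem PosDef_sub_smul_one_iff {A : Mat n} (hA : A.PosDef) (b : ℝ) :
    (A - b • (1 : Mat n)).PosDef ↔
      ∀ x : Fin n → ℝ, x ≠ 0 → b * (x ⬝ᵥ x) < x ⬝ᵥ (A *ᵥ x) := by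
  have hherm : (A - b • (1 : Mat n)).IsHermitian :=
    hA.1.sub (by simp [Matrix.IsHermitian])
  have hdot : ∀ x : Fin n → ℝ, x ⬝ᵥ ((A - b • (1 : Mat n)) *ᵥ x) =
      x ⬝ᵥ (A *ᵥ x) - b * (x ⬝ᵥ x) := by
    intro x
    rw [sub_mulVec, dotProduct_sub, smul_mulVec, one_mulVec, dotProduct_smul, smul_eq_mul]
  constructor
  · intro h x hx
    have := h.dotProduct_mulVec_pos hx
    rw [star_trivial, hdot] at this
    linarith
  · intro h
    refine PosDef.of_dotProduct_mulVec_pos hherm fun x hx => ?_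
    rw [star_trivial, hdot]
    linarith [h x hx]

theorem posDef_geomMean_sub {A B : Mat n} (hA : A.PosDef) (hB : B.PosDef) {b : ℝ} (hb : 0 < b)
    (hA' : (A - b • (1 : Mat n)).PosDef) (hB' : (B - b • (1 : Mat n)).PosDef) {t : ℝ}
    (h0 : 0 ≤ t) (h1 : t ≤ 1) {c : ℝ} (hc : c < b) :
    (geomMean A B t - c • (1 : Mat n)).PosDef := by
  have hle : ∀ {M : Mat n}, M.PosDef → (M - b • (1 : Mat n)).PosDef →
      ∀ z : Fin n → ℝ, b * (z ⬝ᵥ z) ≤ z ⬝ᵥ (M *ᵥ z) := by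
    intro M hM hM' z
    rcases eq_or_ne z 0 with rfl | hz
    · simp
    · exact ((PosDef_sub_smul_one_iff hM b).1 hM' z hz).le
  rw [PosDef_sub_smul_one_iff (geomMean_posDef hA hB t)]
  intro x hx
  refine lt_of_lt_of_le ?_ (le_dotProduct_geomMean hA hB hb (hle hA hA') (hle hB hB') h0 h1 x)
  have : 0 < x ⬝ᵥ x := by
    have := dotProduct_star_self_pos_iff.2 hx
    rwa [star_trivial] at this
  exact mul_lt_mul_of_pos_right hc this

theorem PosDef.sub_smul_one_mono {A : Mat n} {b c : ℝ} (h : (A - b • (1 : Mat n)).PosDef)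
    (hc : c ≤ b) : (A - c • (1 : Mat n)).PosDef := by
  have : A - c • (1 : Mat n) = (A - b • (1 : Mat n)) + (b - c) • (1 : Mat n) := by
    rw [sub_smul]; abel
  rw [this]
  exact h.add_posSemidef (Matrix.PosSemidef.one.smul (sub_nonneg.2 hc))

end LowerBound

/-! ### Geodesics of admissible structures -/

section Admissible

variable {n : ℕ} {U : Set (Model n)} {A B : Model n → Mat n}

theorem IsAdmissible.congr (h : IsAdmissible U A) (hAB : A =ᵐ[volume.restrict U] B) :
    IsAdmissible U B := by
  have hmem : ∀ k (ω : Model n → Form n k), MemOmega k U A ω ↔ MemOmega k U B ω := by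
    intro k ω
    rw [MemOmega, MemOmega, normSq_congr hAB (ae_eq_refl ω)]
  obtain ⟨p, q, h1, h2, b, hb, h3⟩ := h
  refine ⟨p, q, fun k hk => ?_, h2, b, hb, ?_⟩
  · obtain ⟨hq1, hq2, hp2, hp, hq⟩ := h1 k hk
    refine ⟨hq1, hq2, hp2, fun ω hω => (hmem k ω).1 (hp ω hω), fun ω hω => hq ω ((hmem k ω).2 hω)⟩
  · filter_upwards [h3, hAB] with x hx hx'
    rwa [← hx']

theorem middle_degree_le (hn : 1 ≤ n) {k : ℕ} (hk : k = n / 2 ∨ k = n / 2 + 1) : k ≤ n := by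
  omega

theorem toReal_inv_le_of_le {p : ℝ≥0∞} {a : ℝ} (ha : 0 < a) (hp : ENNReal.ofReal a ≤ p) :
    (p⁻¹).toReal ≤ a⁻¹ := by
  have h := ENNReal.inv_le_inv.2 hp
  rw [← ENNReal.ofReal_inv_of_pos ha] at h
  have := ENNReal.toReal_mono ENNReal.ofReal_ne_top h
  rwa [ENNReal.toReal_ofReal (inv_nonneg.2 ha.le)] at this

theorem le_toReal_inv_of_le {p : ℝ≥0∞} {a : ℝ} (ha : 0 < a) (hp0 : p ≠ 0)
    (hp : p ≤ ENNReal.ofReal a) : a⁻¹ ≤ (p⁻¹).toReal := by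
  have h := ENNReal.inv_le_inv.2 hp
  rw [← ENNReal.ofReal_inv_of_pos ha] at h
  have := ENNReal.toReal_mono (ENNReal.inv_ne_top.2 hp0) h
  rwa [ENNReal.toReal_ofReal (inv_nonneg.2 ha.le)] at this

/-- The reciprocals of the exponents interpolate affinely in t, and the inequality 1/q_{m+1} < 1/p_m
+ 1/n is affine in them, so it survives. -/
theorem IsAdmissible.geomMean [IsFiniteMeasure (volume.restrict U)] (hn : 1 ≤ n)
    (hAm : AEStronglyMeasurable A (volume.restrict U))
    (hBm : AEStronglyMeasurable B (volume.restrict U))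
    (hApos : ∀ᵐ x ∂volume.restrict U, (A x).PosDef)
    (hBpos : ∀ᵐ x ∂volume.restrict U, (B x).PosDef)
    (hA : IsAdmissible U A) (hB : IsAdmissible U B) {t : ℝ} (ht0 : 0 ≤ t) (ht1 : t ≤ 1) :
    IsAdmissible U fun x => geomMean (A x) (B x) t := by
  obtain ⟨p, q, h1, h2, b, hb, h3⟩ := hA
  obtain ⟨p', q', h1', h2', b', hb', h3'⟩ := hB
  have ht1' : 0 ≤ 1 - t := by linarith
  have htwo : ENNReal.ofReal 2 = 2 := by simp
  have hpr : ∀ {p : ℝ≥0∞}, 2 ≤ p → p ≠ 0 ∧ 0 ≤ (p⁻¹).toReal ∧ (p⁻¹).toReal ≤ 1 / 2 := by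
    intro p hp
    refine ⟨(zero_lt_two.trans_le hp).ne', ENNReal.toReal_nonneg, ?_⟩
    rw [one_div]
    exact toReal_inv_le_of_le two_pos (htwo ▸ hp)
  have hqr : ∀ {q : ℝ≥0∞}, 1 ≤ q → q ≤ 2 → q ≠ 0 ∧ 1 / 2 ≤ (q⁻¹).toReal ∧ (q⁻¹).toReal ≤ 1 := by
    intro q hq hq'
    have hq0 : q ≠ 0 := (zero_lt_one.trans_le hq).ne'
    refine ⟨hq0, ?_, ?_⟩
    · rw [one_div]
      exact le_toReal_inv_of_le two_pos hq0 (htwo ▸ hq')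
    · have := toReal_inv_le_of_le one_pos (by simpa using hq)
      simpa using this
  have hcomb : ∀ {a c lo hi : ℝ}, lo ≤ a → a ≤ hi → lo ≤ c → c ≤ hi →
      lo ≤ (1 - t) * a + t * c ∧ (1 - t) * a + t * c ≤ hi := by
    intro a c lo hi h1 h2 h3 h4
    constructor <;> nlinarith
  -- The lower bound (1 + min b b')/2 lies strictly between 1 and min b b': the weak inequality for
  -- geometric means becomes strict at the price of a smaller constant.
  refine ⟨fun k => (ENNReal.ofReal ((1 - t) * ((p k)⁻¹).toReal + t * ((p' k)⁻¹).toReal))⁻¹,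
    fun k => (ENNReal.ofReal ((1 - t) * ((q k)⁻¹).toReal + t * ((q' k)⁻¹).toReal))⁻¹,
    fun k hk => ?_, ?_, (1 + min b b') / 2, ?_, ?_⟩
  · obtain ⟨hq1, hq2, hp2, hp, hq⟩ := h1 k hk
    obtain ⟨hq1', hq2', hp2', hp', hq'⟩ := h1' k hk
    obtain ⟨hp0, hpl, hph⟩ := hpr hp2
    obtain ⟨hp0', hpl', hph'⟩ := hpr hp2'
    obtain ⟨hq0, hql, hqh⟩ := hqr hq1 hq2
    obtain ⟨hq0', hql', hqh'⟩ := hqr hq1' hq2'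
    obtain ⟨hpc, hpc'⟩ := hcomb hpl hph hpl' hph'
    obtain ⟨hqc, hqc'⟩ := hcomb hql hqh hql' hqh'
    have : Nontrivial (Form n k) := nontrivial_form (middle_degree_le hn hk)
    obtain ⟨D, hD⟩ := exists_spectralField k hAm hBm hApos hBpos
    have hD0 : ∀ᵐ x ∂volume.restrict U, ∀ ω, formDensity (A x) ω = D.energy 0 x ω := by
      filter_upwards [hD, hApos, hBpos] with x hx hx1 hx2 ω
      rw [← hx, geomMean_zero hx1 hx2]
    have hD1 : ∀ᵐ x ∂volume.restrict U, ∀ ω, formDensity (B x) ω = D.energy 1 x ω := by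
      filter_upwards [hD, hApos, hBpos] with x hx hx1 hx2 ω
      rw [← hx, geomMean_one hx1 hx2]
    have hDt : ∀ᵐ x ∂volume.restrict U, ∀ ω,
        formDensity (LpRiemann.geomMean (A x) (B x) t) ω = D.energy t x ω := by
      filter_upwards [hD] with x hx ω using hx t ω
    have hst : (1 - t) * 0 + t * 1 = t := by ring
    rw [lpSubOmega_iff hD0, eq_ofReal_inv_toReal hp0] at hp
    rw [lpSubOmega_iff hD1, eq_ofReal_inv_toReal hp0'] at hp'
    rw [omegaSubLp_iff hD0, eq_ofReal_inv_toReal hq0] at hq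
    rw [omegaSubLp_iff hD1, eq_ofReal_inv_toReal hq0'] at hq'
    have hP := SpectralField.LpSub.interp D ht0 ht1 hpl hpl' hp hp'
    have hQ := SpectralField.SubLp.interp D ht0 ht1 (by linarith : 0 < ((q k)⁻¹).toReal)
      (by linarith : 0 < ((q' k)⁻¹).toReal) hq hq'
    rw [hst] at hP hQ
    refine ⟨?_, ?_, ?_, (lpSubOmega_iff hDt _).2 hP, (omegaSubLp_iff hDt _).2 hQ⟩
    · rw [ENNReal.one_le_inv]
      simpa using hqc'
    · rw [← inv_inv (2 : ℝ≥0∞), ENNReal.inv_le_inv, ← htwo, ← ENNReal.ofReal_inv_of_pos two_pos]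
      exact ENNReal.ofReal_le_ofReal (le_trans (by norm_num) hqc)
    · rw [← inv_inv (2 : ℝ≥0∞), ENNReal.inv_le_inv, ← htwo, ← ENNReal.ofReal_inv_of_pos two_pos]
      exact ENNReal.ofReal_le_ofReal (hpc'.trans (by norm_num))
  · obtain ⟨hp0, hpl, -⟩ := hpr (h1 _ (Or.inl rfl)).2.2.1
    obtain ⟨hp0', hpl', -⟩ := hpr (h1' _ (Or.inl rfl)).2.2.1
    obtain ⟨hq0, hql, -⟩ := hqr (h1 _ (Or.inr rfl)).1 (h1 _ (Or.inr rfl)).2.1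
    obtain ⟨hq0', hql', -⟩ := hqr (h1' _ (Or.inr rfl)).1 (h1' _ (Or.inr rfl)).2.1
    have hn0 : (n : ℝ≥0∞)⁻¹ ≠ ∞ := ENNReal.inv_ne_top.2 (by exact_mod_cast (by omega : n ≠ 0))
    have hreal : ∀ {p q : ℝ≥0∞}, p ≠ 0 → q ≠ 0 → q⁻¹ < p⁻¹ + (n : ℝ≥0∞)⁻¹ →
        (q⁻¹).toReal < (p⁻¹).toReal + ((n : ℝ≥0∞)⁻¹).toReal := by
      intro p q hp hq h
      have hp' := ENNReal.inv_ne_top.2 hp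
      rw [← ENNReal.toReal_add hp' hn0]
      exact (ENNReal.toReal_lt_toReal (ENNReal.inv_ne_top.2 hq)
        (ENNReal.add_ne_top.2 ⟨hp', hn0⟩)).2 h
    have e1 := hreal hp0 hq0 h2
    have e2 := hreal hp0' hq0' h2'
    simp only [inv_inv]
    rw [← ENNReal.ofReal_toReal hn0, ← ENNReal.ofReal_add (by positivity) ENNReal.toReal_nonneg,
      ENNReal.ofReal_lt_ofReal_iff_of_nonneg (by positivity)]
    rcases ht0.eq_or_lt with rfl | ht0
    · linarith
    · nlinarith
  · have := lt_min hb hb'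
    linarith
  · have hm := lt_min hb hb'
    filter_upwards [hApos, hBpos, h3, h3'] with x hx1 hx2 hx3 hx4
    exact posDef_geomMean_sub hx1 hx2 (b := min b b') (by linarith)
      (PosDef.sub_smul_one_mono hx3 (min_le_left _ _))
      (PosDef.sub_smul_one_mono hx4 (min_le_right _ _)) ht0 ht1 (by linarith)

end Admissible

/-! ### Continuity along geodesics -/

section Continuity

variable {n k : ℕ} {U : Set (Model n)} {N : ℕ}
  {D : SpectralField (volume.restrict U) (Form n k) N}

theorem SpectralField.energy_le_add {X : Type*} [MeasurableSpace X] {μ : Measure X} {E : Type*}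
    [NormedAddCommGroup E] [NormedSpace ℂ E] {N : ℕ} (D : SpectralField μ E N) {t : ℝ}
    (h0 : 0 ≤ t) (h1 : t ≤ 1) (x : X) (ω : E) :
    D.energy t x ω ≤ D.energy 0 x ω + D.energy 1 x ω := by
  have h := D.energy_le_rpow_mul_rpow h0 h1 0 1 x ω
  rw [show (1 - t) * 0 + t * 1 = t by ring] at h
  exact h.trans (rpow_mul_rpow_le_add (D.energy_nonneg _ _ _) (D.energy_nonneg _ _ _)
    (by linarith) h0 (by ring))

theorem SpectralField.continuous_energy_exp {X : Type*} [MeasurableSpace X] {μ : Measure X}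
    {E : Type*} [NormedAddCommGroup E] [NormedSpace ℂ E] {N : ℕ} (D : SpectralField μ E N)
    (x : X) (ω : E) : Continuous fun t => D.energy t x ω := by
  unfold SpectralField.energy
  exact continuous_finsetSum _ fun j _ =>
    (Real.continuous_const_rpow (D.eig_pos x j).ne').mul continuous_const

/-- Dominated convergence: on [0, 1] all the energies are bounded by the sum of those at the two
endpoints. -/
theorem SpectralField.continuous_lintegral_energy {X : Type*} [MeasurableSpace X] {μ : Measure X}
    {E : Type*} [NormedAddCommGroup E] [NormedSpace ℂ E] {N : ℕ} (D : SpectralField μ E N)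
    {ω : X → E} (h0 : D.FiniteEnergy 0 ω) (h1 : D.FiniteEnergy 1 ω) :
    Continuous fun t : unitInterval => ∫⁻ x, ENNReal.ofReal (D.energy t x (ω x)) ∂μ := by
  refine continuous_iff_continuousAt.2 fun t => ?_
  refine tendsto_lintegral_filter_of_dominated_convergence'
    (fun x => ENNReal.ofReal (D.energy 0 x (ω x) + D.energy 1 x (ω x)))
    (Eventually.of_forall fun s => (D.aemeasurable_energy s h0.1).ennreal_ofReal)
    (Eventually.of_forall fun s => Eventually.of_forall fun x =>
      ENNReal.ofReal_le_ofReal (D.energy_le_add s.2.1 s.2.2 x _))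
    (h0.2.add h1.2 (D.aemeasurable_energy 0 h0.1)).ne
    (Eventually.of_forall fun x => ?_)
  exact ((ENNReal.continuous_ofReal.comp (D.continuous_energy_exp x (ω x))).comp
    continuous_subtype_val).tendsto t

theorem memLp_top_of_mem_testC0 (hU : Bornology.IsBounded U) {ω : Model n → Form n k}
    (hω : ω ∈ testC0 k U) : MemLp ω ∞ (volume.restrict U) := by
  have hc : HasCompactSupport ω := by
    refine HasCompactSupport.intro (K := closure U) hU.isCompact_closure fun x hx => ?_
    exact hω.2 x fun h => hx (subset_closure h)
  obtain ⟨C, hC⟩ := hω.1.bounded_above_of_compact_support hc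
  have : SecondCountableTopology (Form n k) := by
    have : ProperSpace (Form n k) := FiniteDimensional.proper ℂ _
    infer_instance
  exact memLp_top_of_bound hω.1.aestronglyMeasurable C (Eventually.of_forall hC)

end Continuity

/-! ### Geodesics in the space of measurable Riemannian structures -/

namespace RiemStructure

variable {n : ℕ} {V : Type*} [TopologicalSpace V] {ι : Type*}
  {θ : ι → OpenPartialHomeomorph V (Model n)}

theorem ext_field {g g' : RiemStructure θ} (h : g.field = g'.field) : g = g' := by
  cases g
  cases g'
  congr

theorem aestronglyMeasurable_field (g : RiemStructure θ) (i : ι) :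
    AEStronglyMeasurable (g.field i) (volume.restrict (θ i).target) :=
  (g.field i).aestronglyMeasurable

variable (hn : 1 ≤ n) (hθ : ∀ i, Bornology.IsBounded (θ i).target)

theorem isFiniteMeasure_restrict {U : Set (Model n)} (hU : Bornology.IsBounded U) :
    IsFiniteMeasure (volume.restrict U) :=
  ⟨by rw [Measure.restrict_apply_univ]; exact hU.measure_lt_top⟩

/-- The matrix field of the geodesic in the chart `i`. -/
def geodesicField (g₀ g₁ : RiemStructure θ) (t : ℝ) (i : ι) :
    Model n →ₘ[volume.restrict (θ i).target] Mat n :=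
  AEEqFun.mk (fun x => geomMean (g₀.field i x) (g₁.field i x) t)
    (aestronglyMeasurable_geomMean (g₀.aestronglyMeasurable_field i)
      (g₁.aestronglyMeasurable_field i) (g₀.posDef i) (g₁.posDef i) t)

theorem coeFn_geodesicField (g₀ g₁ : RiemStructure θ) (t : ℝ) (i : ι) :
    geodesicField g₀ g₁ t i =ᵐ[volume.restrict (θ i).target]
      fun x => geomMean (g₀.field i x) (g₁.field i x) t := AEEqFun.coeFn_mk _ _

theorem geodesic_admissible (hn : 1 ≤ n) (hθ : ∀ i, Bornology.IsBounded (θ i).target) (g₀ g₁ : RiemStructure θ) (t : unitInterval) (i : ι) :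
    IsAdmissible (θ i).target (geodesicField g₀ g₁ t i) := by
  have := isFiniteMeasure_restrict (hθ i)
  exact (IsAdmissible.geomMean hn (g₀.aestronglyMeasurable_field i)
    (g₁.aestronglyMeasurable_field i) (g₀.posDef i) (g₁.posDef i) (g₀.admissible i)
    (g₁.admissible i) t.2.1 t.2.2).congr (coeFn_geodesicField g₀ g₁ t i).symm

theorem isUnit_det_of_posDef_congr {A B J : Mat n} (hA : A.PosDef)
    (h : A = J.transpose * B * J) : IsUnit J.det := by
  rw [isUnit_iff_ne_zero]
  intro hJ
  have := hA.det_pos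
  rw [h, Matrix.det_mul, hJ, mul_zero] at this
  exact lt_irrefl _ this

/-- Positivity at the image point of a chart change is read off from the congruence itself.
Transporting an almost everywhere statement would require control of null sets under chart changes.
-/
theorem posDef_of_posDef_congr {A B J : Mat n} (hA : A.PosDef)
    (h : A = J.transpose * B * J) : B.PosDef := by
  have hJ := isUnit_det_of_posDef_congr hA h
  have h2 : B = (J⁻¹).transpose * A * J⁻¹ := by
    have h3 : (J⁻¹).transpose * J.transpose = 1 := by
      rw [← Matrix.transpose_mul, Matrix.mul_nonsing_inv _ hJ, Matrix.transpose_one]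
    rw [h]
    calc B = 1 * B * 1 := by simp
      _ = ((J⁻¹).transpose * J.transpose) * B * (J * J⁻¹) := by
        rw [h3, Matrix.mul_nonsing_inv _ hJ]
      _ = _ := by simp only [Matrix.mul_assoc]
  have := hA.conjTranspose_mul_mul_same (B := J⁻¹) (Matrix.mulVec_injective_iff_isUnit.2
    ((Matrix.isUnit_iff_isUnit_det _).2 (by simpa using hJ)))
  rw [h2]
  simpa using this

/-- The point of parameter `t` of the geodesic from `g₀` to `g₁`. -/
def geodesic (g₀ g₁ : RiemStructure θ) (t : unitInterval) : RiemStructure θ where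
  field := geodesicField g₀ g₁ t
  posDef i := by
    filter_upwards [coeFn_geodesicField g₀ g₁ t i, g₀.posDef i, g₁.posDef i] with x h h0 h1
    rw [h]
    exact geomMean_posDef h0 h1 t
  compat := by
    obtain ⟨A, hA, hA'⟩ := g₀.compat
    obtain ⟨B, hB, hB'⟩ := g₁.compat
    refine ⟨fun i x => geomMean (A i x) (B i x) t, fun i => ?_, fun i j => ?_⟩
    · filter_upwards [coeFn_geodesicField g₀ g₁ t i, hA i, hB i] with x h h0 h1
      rw [h, h0, h1]
    · have hsub : ((θ i).symm.trans (θ j)).source ⊆ (θ i).target := by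
        rw [OpenPartialHomeomorph.trans_source]
        exact inter_subset_left
      have hposA : ∀ᵐ x ∂volume.restrict ((θ i).symm.trans (θ j)).source, (A i x).PosDef := by
        refine ae_restrict_of_ae_restrict_of_subset hsub ?_
        filter_upwards [hA i, g₀.posDef i] with x h h'
        rwa [← h]
      have hposB : ∀ᵐ x ∂volume.restrict ((θ i).symm.trans (θ j)).source, (B i x).PosDef := by
        refine ae_restrict_of_ae_restrict_of_subset hsub ?_
        filter_upwards [hB i, g₁.posDef i] with x h h'
        rwa [← h]
      filter_upwards [hA' i j, hB' i j, hposA, hposB] with x h0 h1 h2 h3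
      rw [← geomMean_congr (posDef_of_posDef_congr h2 h0) (posDef_of_posDef_congr h3 h1)
        (isUnit_det_of_posDef_congr h2 h0), ← h0, ← h1]
  admissible := geodesic_admissible hn hθ g₀ g₁ t

theorem geodesic_zero (g₀ g₁ : RiemStructure θ) : geodesic hn hθ g₀ g₁ 0 = g₀ := by
  refine ext_field (funext fun i => AEEqFun.ext ?_)
  filter_upwards [coeFn_geodesicField g₀ g₁ 0 i, g₀.posDef i, g₁.posDef i] with x h h0 h1
  exact h.trans (geomMean_zero h0 h1)

theorem geodesic_one (g₀ g₁ : RiemStructure θ) : geodesic hn hθ g₀ g₁ 1 = g₁ := by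
  refine ext_field (funext fun i => AEEqFun.ext ?_)
  filter_upwards [coeFn_geodesicField g₀ g₁ 1 i, g₀.posDef i, g₁.posDef i] with x h h0 h1
  exact h.trans (geomMean_one h0 h1)

/-- The spectral field of the geodesic from `g₀` to `g₁` in the chart `i`. -/
theorem exists_spectralField_geodesic (g₀ g₁ : RiemStructure θ) (i : ι) (k : ℕ) :
    ∃ D : SpectralField (volume.restrict (θ i).target) (Form n k)
      (Module.finrank ℂ (Form n k)),
      (∀ᵐ x ∂volume.restrict (θ i).target, ∀ ω,
        formDensity (g₀.field i x) ω = D.energy 0 x ω) ∧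
      (∀ᵐ x ∂volume.restrict (θ i).target, ∀ ω,
        formDensity (g₁.field i x) ω = D.energy 1 x ω) ∧
      ∀ t : unitInterval, ∀ᵐ x ∂volume.restrict (θ i).target, ∀ ω,
        formDensity ((geodesic hn hθ g₀ g₁ t).field i x) ω = D.energy t x ω := by
  obtain ⟨D, hD⟩ := exists_spectralField k (g₀.aestronglyMeasurable_field i)
    (g₁.aestronglyMeasurable_field i) (g₀.posDef i) (g₁.posDef i)
  refine ⟨D, ?_, ?_, fun t => ?_⟩
  · filter_upwards [hD, g₀.posDef i, g₁.posDef i] with x hx hx1 hx2 ω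
    rw [← hx, geomMean_zero hx1 hx2]
  · filter_upwards [hD, g₀.posDef i, g₁.posDef i] with x hx hx1 hx2 ω
    rw [← hx, geomMean_one hx1 hx2]
  · filter_upwards [hD, coeFn_geodesicField g₀ g₁ t i] with x hx hx' ω
    rw [← hx]
    exact congrArg (fun M => formDensity M ω) hx'

theorem lpSubOmega_top (g : RiemStructure θ) (hU : ∀ i, Bornology.IsBounded (θ i).target)
    (i : ι) {k : ℕ} (hk : k = n / 2 ∨ k = n / 2 + 1) :
    LpSubOmega k (θ i).target (g.field i) ∞ := by
  have := isFiniteMeasure_restrict (hU i)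
  obtain ⟨p, q, h, -⟩ := g.admissible i
  exact fun ω hω => (h k hk).2.2.2.1 ω (hω.mono_exponent le_top)

theorem omegaSubLp_one (g : RiemStructure θ) (hU : ∀ i, Bornology.IsBounded (θ i).target)
    (i : ι) {k : ℕ} (hk : k = n / 2 ∨ k = n / 2 + 1) :
    OmegaSubLp k (θ i).target (g.field i) 1 := by
  have := isFiniteMeasure_restrict (hU i)
  obtain ⟨p, q, h, -⟩ := g.admissible i
  exact fun ω hω => ((h k hk).2.2.2.2 ω hω).mono_exponent (h k hk).1

/-- The topology is initial, so each defining function is checked along the geodesic. The spectral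
field in a given chart and degree handles all t at once. -/
theorem continuous_geodesic (g₀ g₁ : RiemStructure θ) : Continuous (geodesic hn hθ g₀ g₁) := by
  have key : ∀ (i : ι) (k : ℕ), (k = n / 2 ∨ k = n / 2 + 1) →
      (∀ ω ∈ testC0 k (θ i).target, Continuous fun t : unitInterval =>
        normSq k (θ i).target ((geodesic hn hθ g₀ g₁ t).field i) ω) ∧
      (Continuous fun t : unitInterval =>
        pExp k (θ i).target ((geodesic hn hθ g₀ g₁ t).field i)) ∧
      Continuous fun t : unitInterval =>
        qExp k (θ i).target ((geodesic hn hθ g₀ g₁ t).field i) := by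
    intro i k hk
    have := isFiniteMeasure_restrict (hθ i)
    have : Nontrivial (Form n k) := nontrivial_form (middle_degree_le hn hk)
    obtain ⟨D, hD0, hD1, hDt⟩ := exists_spectralField_geodesic hn hθ g₀ g₁ i k
    have h0 := (lpSubOmega_iff hD0 ∞).1 (g₀.lpSubOmega_top hθ i hk)
    have h1 := (lpSubOmega_iff hD1 ∞).1 (g₁.lpSubOmega_top hθ i hk)
    have h0' := (omegaSubLp_iff hD0 1).1 (g₀.omegaSubLp_one hθ i hk)
    have h1' := (omegaSubLp_iff hD1 1).1 (g₁.omegaSubLp_one hθ i hk)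
    refine ⟨fun ω hω => ?_, ?_, ?_⟩
    · have hmem := memLp_top_of_mem_testC0 (hθ i) hω
      have := D.continuous_lintegral_energy (h0 ω hmem) (h1 ω hmem)
      simpa only [normSq_eq_lintegral_energy (hDt _)] using this
    · have := continuousOn_iff_continuous_domRestrict.1 (D.continuousOn_sInf_lpSub h0 h1 h0' h1')
      simp only [pExp_eq (hDt _)]
      exact this
    · have := continuousOn_iff_continuous_domRestrict.1 (D.continuousOn_sSup_subLp h0 h1 h0' h1')
      simp only [qExp_eq (hDt _)]
      exact this
  refine continuous_iInf_rng.2 fun i => continuous_iInf_rng.2 fun k =>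
    continuous_iInf_rng.2 fun hk => ?_
  rw [continuous_iff_coinduced_le]
  refine le_inf (le_iInf₂ fun ω hω => ?_) (le_inf ?_ ?_)
  · exact continuous_iff_coinduced_le.1 (continuous_induced_rng.2 ((key i k hk).1 ω hω))
  · exact continuous_iff_coinduced_le.1 (continuous_induced_rng.2 (key i k hk).2.1)
  · exact continuous_iff_coinduced_le.1 (continuous_induced_rng.2 (key i k hk).2.2)

/-- The geodesic as a path. -/
def geodesicPath (g₀ g₁ : RiemStructure θ) : Path g₀ g₁ where
  toFun := geodesic hn hθ g₀ g₁
  continuous_toFun := continuous_geodesic hn hθ g₀ g₁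
  source' := geodesic_zero hn hθ g₀ g₁
  target' := geodesic_one hn hθ g₀ g₁

theorem interpNorm_omegaNorm (g₀ g₁ : RiemStructure θ) (t : unitInterval) (i : ι) (k : ℕ)
    (ω : Model n →ₘ[volume.restrict (θ i).target] Form n k) :
    interpNorm (omegaNorm k (θ i).target (g₀.field i)) (omegaNorm k (θ i).target (g₁.field i)) t
      ω = omegaNorm k (θ i).target ((geodesic hn hθ g₀ g₁ t).field i) ω := by
  have := isFiniteMeasure_restrict (hθ i)
  obtain ⟨D, hD0, hD1, hDt⟩ := exists_spectralField_geodesic hn hθ g₀ g₁ i k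
  rw [omegaNorm_eq hD0, omegaNorm_eq hD1, omegaNorm_eq (hDt t)]
  -- Every degree k is allowed, so the space of forms may be zero; then the right-hand norm
  -- vanishes.
  rcases subsingleton_or_nontrivial (Form n k) with h | h
  · refine le_antisymm (SpectralField.interpNorm_le _ _) ?_
    have hz : D.fieldNorm t ω = 0 := by
      have hx : ∀ x, D.energy t x (ω x) = 0 := by
        intro x
        rw [Subsingleton.elim (ω x) 0]
        simp [SpectralField.energy]
      simp [SpectralField.fieldNorm, hx]
    rw [hz]
    exact bot_le
  · exact SpectralField.interpNorm_eq t.2 ω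

end RiemStructure

/-! ### The densities as squares of Euclidean norms -/

section Density

variable {n k : ℕ}

theorem exists_formDensity_eq_norm_sq (A : Mat n) :
    ∃ L : Form n k →ₗ[ℂ] EuclideanSpace ℂ (Fin k → Fin n), ∀ ω, formDensity A ω = ‖L ω‖ ^ 2 := by
  refine ⟨((Real.sqrt (((k.factorial : ℝ))⁻¹ * Real.sqrt A.det) : ℝ) : ℂ) •
    formCoord (matPow A (-1 / 2)), fun ω => ?_⟩
  rw [LinearMap.smul_apply, norm_smul, mul_pow, Complex.norm_real, Real.norm_eq_abs, sq_abs,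
    Real.sq_sqrt (by positivity), EuclideanSpace.norm_sq_eq, formDensity, formNormSq_eq]
  ring

theorem formDensity_nonneg (A : Mat n) (ω : Form n k) : 0 ≤ formDensity A ω :=
  mul_nonneg (formNormSq_nonneg A ω) (Real.sqrt_nonneg _)

theorem continuous_formDensity (A : Mat n) : Continuous fun ω : Form n k => formDensity A ω := by
  obtain ⟨L, hL⟩ := exists_formDensity_eq_norm_sq (k := k) A
  simp only [hL]
  exact (LinearMap.continuous_of_finiteDimensional L).norm.pow 2

theorem formDensity_smul (A : Mat n) (c : ℂ) (ω : Form n k) :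
    formDensity A (c • ω) = ‖c‖ ^ 2 * formDensity A ω := by
  obtain ⟨L, hL⟩ := exists_formDensity_eq_norm_sq (k := k) A
  rw [hL, hL, map_smul, norm_smul, mul_pow]

/-- A multiple of the largest value of `formDensity A` on the unit ball. -/
def densityBound (k : ℕ) (A : Mat n) : ℝ :=
  (SpectralField.exists_basis_bound (Form n k)).choose *
    ∑ i, formDensity A (Module.finBasis ℂ (Form n k) i)

/-- The density is ‖L ω‖² for a linear L, and the difference of two squares factors. -/
theorem abs_formDensity_sub_le (A : Mat n) (a b : Form n k) :
    |formDensity A a - formDensity A b| ≤ densityBound k A * (‖a - b‖ * (‖a‖ + ‖b‖)) := by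
  obtain ⟨L, hL⟩ := exists_formDensity_eq_norm_sq (k := k) A
  have hT0 : 0 ≤ densityBound k A := mul_nonneg
    (SpectralField.exists_basis_bound (Form n k)).choose_spec.1.le
    (Finset.sum_nonneg fun i _ => formDensity_nonneg _ _)
  have hb : ∀ ω, ‖L ω‖ ≤ Real.sqrt (densityBound k A) * ‖ω‖ := by
    intro ω
    refine abs_le_of_sq_le_sq' ?_ (by positivity) |>.2
    rw [mul_pow, Real.sq_sqrt hT0, densityBound]
    simp only [hL]
    exact (SpectralField.exists_basis_bound (Form n k)).choose_spec.2 L ω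
  rw [hL, hL, sq_sub_sq, abs_mul, abs_of_nonneg (by positivity), mul_comm]
  have h1 : |‖L a‖ - ‖L b‖| ≤ Real.sqrt (densityBound k A) * ‖a - b‖ :=
    (abs_norm_sub_norm_le _ _).trans (by rw [← map_sub]; exact hb _)
  have h2 : ‖L a‖ + ‖L b‖ ≤ Real.sqrt (densityBound k A) * (‖a‖ + ‖b‖) := by
    rw [mul_add]; exact add_le_add (hb a) (hb b)
  calc _ ≤ (Real.sqrt (densityBound k A) * ‖a - b‖) *
        (Real.sqrt (densityBound k A) * (‖a‖ + ‖b‖)) :=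
        mul_le_mul h1 h2 (by positivity) (by positivity)
    _ = _ := by
      rw [mul_mul_mul_comm, Real.mul_self_sqrt hT0]

/-! ### A structure is determined by its densities in two consecutive degrees -/

/-- The coordinate is the determinant of a 0-1 matrix. If it is nonzero, no row vanishes and no two
rows coincide, so v lists the entries of w in another order. -/
theorem formCoord_one_minorForm {w v : Fin k → Fin n} (h : formCoord 1 (minorForm w) v ≠ 0) :
    ∃ σ : Equiv.Perm (Fin k), v = w ∘ σ := by
  rw [formCoord_apply, minorForm_apply] at h
  set M : Matrix (Fin k) (Fin k) ℝ := Matrix.of fun i j =>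
    (WithLp.toLp 2 fun a => (1 : Mat n) a (v i) : Model n) (w j) with hM
  have hMij : ∀ i j, M i j = if w j = v i then 1 else 0 := fun i j => by
    simp [hM, Matrix.one_apply]
  have hdet : M.det ≠ 0 := fun h0 => h (by rw [h0]; simp)
  have hrow : ∀ i, ∃ j, w j = v i := by
    intro i
    by_contra! hi
    exact hdet (Matrix.det_eq_zero_of_row_eq_zero i fun j => by rw [hMij, if_neg (hi j)])
  choose σ hσ using hrow
  have hinj : Function.Injective σ := by
    intro i i' hii
    by_contra hne
    refine hdet (Matrix.det_zero_of_row_eq hne ?_)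
    funext j
    rw [hMij, hMij, ← hσ i, ← hσ i', hii]
  exact ⟨Equiv.ofBijective σ (Finite.injective_iff_bijective.1 hinj), funext fun i => (hσ i).symm⟩

/-- Test on the minor of index w, expressed in the diagonalizing frame. Its coordinates are
supported on permutations of w, where the weight is constant, so equal densities force that weight
to be 1. -/
theorem prod_eq_of_formDensity_eq {P : Mat n} {d : Fin n → ℝ} (hP : IsUnit P.det)
    (hd : ∀ i, 0 < d i)
    (h : ∀ ω : Form n k, formDensity (P.transpose * P) ω =
      formDensity (P.transpose * Matrix.diagonal d * P) ω) {w : Fin k → Fin n}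
    (hw : Function.Injective w) : ∏ j, d (w j) = (∏ i, d i) ^ (1 / 2 : ℝ) := by
  have h0 := formDensity_transpose_diagonal (k := k) hP hd 0
    (pullForm P (minorForm w))
  have h1 := formDensity_transpose_diagonal (k := k) hP hd 1
    (pullForm P (minorForm w))
  simp only [Real.rpow_zero, Real.rpow_one, Matrix.diagonal_one, mul_one, one_mul] at h0 h1
  rw [← h, h0, formCoord_pullForm, Matrix.mul_nonsing_inv _ hP] at h1
  set c : ℂ := (Real.sqrt (((k.factorial : ℝ))⁻¹ * |P.det|) : ℂ) with hc
  have hc0 : c ≠ 0 := by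
    rw [hc]
    have : 0 < ((k.factorial : ℝ))⁻¹ * |P.det| :=
      mul_pos (by positivity) (abs_pos.2 hP.ne_zero)
    exact_mod_cast (Real.sqrt_pos.2 this).ne'
  have hterm : ∀ v : Fin k → Fin n, ((∏ j, d (v j))⁻¹ * (∏ i, d i) ^ (1 / 2 : ℝ)) *
      ‖c * formCoord 1 (minorForm w) v‖ ^ 2 =
      ((∏ j, d (w j))⁻¹ * (∏ i, d i) ^ (1 / 2 : ℝ)) *
        ‖c * formCoord 1 (minorForm w) v‖ ^ 2 := by
    intro v
    by_cases hv : formCoord 1 (minorForm w) v = 0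
    · simp [hv]
    · obtain ⟨σ, rfl⟩ := formCoord_one_minorForm hv
      rw [show ∏ j, d ((w ∘ σ) j) = ∏ j, d (w j) from Equiv.prod_comp σ fun j => d (w j)]
  simp only [hterm, ← Finset.mul_sum] at h1
  have hpos : 0 < ∑ v : Fin k → Fin n, ‖c * formCoord 1 (minorForm w) v‖ ^ 2 := by
    refine Finset.sum_pos' (fun _ _ => sq_nonneg _) ⟨w, Finset.mem_univ _, ?_⟩
    have hw1 : formCoord 1 (minorForm w) w = 1 := by
      rw [formCoord_apply, ← minorForm_single hw]
      congr 1
      funext j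
      ext a
      simp [Matrix.one_apply]
    rw [hw1, mul_one]
    have := norm_pos_iff.2 hc0
    positivity
  have h2 : (∏ j, d (w j))⁻¹ * (∏ i, d i) ^ (1 / 2 : ℝ) = 1 := by
    have := mul_right_cancel₀ hpos.ne' ((one_mul _).trans h1)
    exact this.symm
  have hp : 0 < ∏ j, d (w j) := Finset.prod_pos fun j _ => hd _
  field_simp at h2
  exact h2.symm

/-- Products of m and of m + 1 distinct eigenvalues have the same value, the square root of the
total product; dividing isolates each eigenvalue, which is 1. One degree alone is not enough: in the
middle degree of an even dimension the density is conformally invariant. -/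
theorem eq_of_formDensity_eq {A B : Mat n} (hA : A.PosDef) (hB : B.PosDef) {m : ℕ} (hm : m < n)
    (h : ∀ ω : Form n m, formDensity A ω = formDensity B ω)
    (h' : ∀ ω : Form n (m + 1), formDensity A ω = formDensity B ω) : A = B := by
  obtain ⟨P, d, hP, hd, rfl, rfl, -⟩ := exists_simultaneous_diag hA hB
  have hone : ∀ i, d i = 1 := by
    intro i
    obtain ⟨w, hw, hwi⟩ : ∃ w : Fin (m + 1) → Fin n, Function.Injective w ∧ w 0 = i := by
      refine ⟨fun j => Equiv.swap (⟨0, by omega⟩ : Fin n) i (Fin.castLE hm j),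
        fun j j' hj => Fin.castLE_injective hm ((Equiv.injective _) hj), ?_⟩
      exact Equiv.swap_apply_left _ _
    have h1 := prod_eq_of_formDensity_eq hP hd h' hw
    have h2 := prod_eq_of_formDensity_eq hP hd h (hw.comp (Fin.succ_injective m))
    rw [Fin.prod_univ_succ, hwi] at h1
    have hp : 0 < ∏ j : Fin m, d (w (Fin.succ j)) := Finset.prod_pos fun j _ => hd _
    exact mul_right_cancel₀ hp.ne' (by rw [one_mul]; exact h1.trans h2.symm)
  have : Matrix.diagonal d = 1 := by
    rw [← Matrix.diagonal_one]
    exact congrArg _ (funext hone)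
  rw [this, mul_one]

end Density

/-! ### Densities integrated against test forms -/

section Integrals

variable {n k : ℕ} {U : Set (Model n)} {A B : Model n → Mat n}

theorem integrable_formDensity (hA : AEStronglyMeasurable A (volume.restrict U))
    (hpos : ∀ᵐ x ∂volume.restrict U, (A x).PosDef) {ω : Model n → Form n k}
    (h : MemOmega k U A ω) :
    Integrable (fun x => formDensity (A x) (ω x)) (volume.restrict U) := by
  refine ⟨(aemeasurable_formDensity hA hpos h.1).aestronglyMeasurable, ?_⟩
  rw [hasFiniteIntegral_iff_ofReal (Eventually.of_forall fun x => formDensity_nonneg _ _),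
    ← normSq_eq_lintegral_formDensity]
  exact h.2

theorem toReal_normSq (hA : AEStronglyMeasurable A (volume.restrict U))
    (hpos : ∀ᵐ x ∂volume.restrict U, (A x).PosDef) {ω : Model n → Form n k}
    (h : MemOmega k U A ω) :
    (normSq k U A ω).toReal = ∫ x in U, formDensity (A x) (ω x) := by
  rw [normSq_eq_lintegral_formDensity, integral_eq_lintegral_of_nonneg_ae
    (Eventually.of_forall fun x => formDensity_nonneg _ _)
    (aemeasurable_formDensity hA hpos h.1).aestronglyMeasurable]

theorem secondCountableTopology_form : SecondCountableTopology (Form n k) := by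
  have : ProperSpace (Form n k) := FiniteDimensional.proper ℂ _
  infer_instance

theorem testCc_subset_testC0 : testCc k U ⊆ testC0 k U := fun _ hω =>
  ⟨hω.1, fun _ hx => image_eq_zero_of_notMem_tsupport fun h => hx (hω.2.2 h)⟩

theorem smul_const_mem_testCc {φ : Model n → ℝ} (hφ : Continuous φ) (hc : HasCompactSupport φ)
    (hU : tsupport φ ⊆ U) {η : Model n → Form n k} (hη : Continuous η) :
    (fun x => (φ x : ℂ) • η x) ∈ testCc k U := by
  have hsub : ∀ x, φ x = 0 → (φ x : ℂ) • η x = 0 := fun x hx => by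
    rw [hx, Complex.ofReal_zero]
    exact zero_smul ℂ (η x)
  have hts : tsupport (fun x => (φ x : ℂ) • η x) ⊆ tsupport φ :=
    closure_mono fun x hx h0 => hx (hsub x h0)
  exact ⟨(Complex.continuous_ofReal.comp hφ).smul hη,
    hc.mono fun x hx h0 => hx (hsub x h0), hts.trans hU⟩

/-- Two measurable structures with the same norms of test forms have the same densities. -/
theorem ae_formDensity_eq (hUo : IsOpen U) (hU : Bornology.IsBounded U)
    (hA : AEStronglyMeasurable A (volume.restrict U))
    (hB : AEStronglyMeasurable B (volume.restrict U))
    (hApos : ∀ᵐ x ∂volume.restrict U, (A x).PosDef)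
    (hBpos : ∀ᵐ x ∂volume.restrict U, (B x).PosDef)
    (hAtop : LpSubOmega k U A ∞) (hBtop : LpSubOmega k U B ∞)
    (h : ∀ ω ∈ testCc k U, normSq k U A ω = normSq k U B ω) :
    ∀ᵐ x ∂volume.restrict U, ∀ ω : Form n k, formDensity (A x) ω = formDensity (B x) ω := by
  have := secondCountableTopology_form (n := n) (k := k)
  have hconst : ∀ ω₀ : Form n k, ∀ᵐ x ∂volume.restrict U,
      formDensity (A x) ω₀ = formDensity (B x) ω₀ := by
    intro ω₀
    have hfin : IsFiniteMeasure (volume.restrict U) := RiemStructure.isFiniteMeasure_restrict hU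
    have hcA := integrable_formDensity hA hApos (hAtop (fun _ => ω₀) (memLp_const ω₀))
    have hcB := integrable_formDensity hB hBpos (hBtop (fun _ => ω₀) (memLp_const ω₀))
    have hloc : LocallyIntegrableOn (fun x => formDensity (A x) ω₀ - formDensity (B x) ω₀) U :=
      IntegrableOn.locallyIntegrableOn (hcA.sub hcB)
    -- The norm of φ ω₀ is quadratic in φ, so test forms give the integrals of the densities against
    -- squares only.
    have hsq : ∀ φ : Model n → ℝ, Continuous φ → HasCompactSupport φ → tsupport φ ⊆ U →
        Integrable (fun x => φ x ^ 2 * formDensity (A x) ω₀) (volume.restrict U) ∧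
        Integrable (fun x => φ x ^ 2 * formDensity (B x) ω₀) (volume.restrict U) ∧
        ∫ x in U, φ x ^ 2 * formDensity (A x) ω₀ = ∫ x in U, φ x ^ 2 * formDensity (B x) ω₀ := by
      intro φ hφ hc hs
      have hmem := smul_const_mem_testCc hφ hc hs (continuous_const (y := ω₀))
      have hLp := memLp_top_of_mem_testC0 hU (testCc_subset_testC0 hmem)
      have hpt : ∀ M : Mat n, ∀ x, formDensity M ((φ x : ℂ) • ω₀) =
          φ x ^ 2 * formDensity M ω₀ := fun M x => by
        rw [formDensity_smul, Complex.norm_real, Real.norm_eq_abs, sq_abs]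
      have e1 := integrable_formDensity hA hApos (hAtop _ hLp)
      have e2 := integrable_formDensity hB hBpos (hBtop _ hLp)
      have e3 := toReal_normSq hA hApos (hAtop _ hLp)
      rw [h _ hmem, toReal_normSq hB hBpos (hBtop _ hLp)] at e3
      simp only [hpt] at e1 e2 e3
      exact ⟨e1, e2, e3.symm⟩
    have hzero := hUo.ae_eq_zero_of_integral_contDiff_smul_eq_zero (μ := volume) hloc ?_
    · rw [ae_restrict_iff' hUo.measurableSet]
      filter_upwards [hzero] with x hx hxU using sub_eq_zero.1 (hx hxU)
    · intro g hg hgc hgU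
      -- Write g as the difference of its positive and negative parts, each the square of a
      -- continuous function with compact support in U.
      have hpart : ∀ s : ℝ, Continuous (fun x => Real.sqrt (max (s * g x) 0)) ∧
          HasCompactSupport (fun x => Real.sqrt (max (s * g x) 0)) ∧
          tsupport (fun x => Real.sqrt (max (s * g x) 0)) ⊆ U := by
        intro s
        have hsub : Function.support (fun x => Real.sqrt (max (s * g x) 0)) ⊆
            Function.support g := fun x hx h0 => hx (by simp [h0])
        have hg' := hg.continuous
        exact ⟨by fun_prop, hgc.mono hsub, (closure_mono hsub).trans hgU⟩
      obtain ⟨c1, c2, c3⟩ := hpart 1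
      obtain ⟨d1, d2, d3⟩ := hpart (-1)
      obtain ⟨i1, i2, i3⟩ := hsq _ c1 c2 c3
      obtain ⟨j1, j2, j3⟩ := hsq _ d1 d2 d3
      have hgU' : ∀ x, x ∉ U → g x • (formDensity (A x) ω₀ - formDensity (B x) ω₀) = 0 := by
        intro x hx
        rw [image_eq_zero_of_notMem_tsupport fun hx' => hx (hgU hx'), zero_smul]
      rw [← setIntegral_eq_integral_of_forall_compl_eq_zero hgU']
      have hsplit : ∀ x, g x • (formDensity (A x) ω₀ - formDensity (B x) ω₀) =
          (Real.sqrt (max (1 * g x) 0) ^ 2 * formDensity (A x) ω₀ -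
            Real.sqrt (max (1 * g x) 0) ^ 2 * formDensity (B x) ω₀) -
          (Real.sqrt (max (-1 * g x) 0) ^ 2 * formDensity (A x) ω₀ -
            Real.sqrt (max (-1 * g x) 0) ^ 2 * formDensity (B x) ω₀) := by
        intro x
        rw [Real.sq_sqrt (le_max_right _ _), Real.sq_sqrt (le_max_right _ _), smul_eq_mul]
        have : max (1 * g x) 0 - max (-1 * g x) 0 = g x := by
          rcases le_total 0 (g x) with h | h
          · rw [max_eq_left (by linarith), max_eq_right (by linarith)]; ring
          · rw [max_eq_right (by linarith), max_eq_left (by linarith)]; ring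
        nth_rewrite 1 [← this]
        ring
      simp only [hsplit]
      have hsub := integral_sub (i1.sub i2) (j1.sub j2)
      simp only [Pi.sub_apply] at hsub
      rw [hsub, integral_sub i1 i2, integral_sub j1 j2, i3, j3]
      ring
  -- The null set found so far depends on ω₀; a countable dense set of forms and continuity give a
  -- common one.
  have hdense : ∀ᵐ x ∂volume.restrict U, ∀ m : ℕ,
      formDensity (A x) (TopologicalSpace.denseSeq (Form n k) m) =
        formDensity (B x) (TopologicalSpace.denseSeq (Form n k) m) :=
    ae_all_iff.2 fun m => hconst _
  filter_upwards [hdense] with x hx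
  exact congrFun (Continuous.ext_on (TopologicalSpace.denseRange_denseSeq (Form n k))
    (continuous_formDensity (A x)) (continuous_formDensity (B x)) (by rintro _ ⟨m, rfl⟩; exact hx m))

end Integrals

/-! ### A countable family of test forms -/

section Cutoff

variable {n k : ℕ} {U : Set (Model n)}

/-- A continuous function with compact support in `U` when `U` is bounded, equal to `1` far from
the complement of `U`. -/
def cutoff (U : Set (Model n)) (j : ℕ) (x : Model n) : ℝ :=
  min 1 (max 0 (j * Metric.infDist x Uᶜ - 1))

theorem continuous_cutoff (U : Set (Model n)) (j : ℕ) : Continuous (cutoff U j) := by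
  unfold cutoff
  have := Metric.continuous_infDist_pt Uᶜ
  fun_prop

theorem cutoff_nonneg (U : Set (Model n)) (j : ℕ) (x : Model n) : 0 ≤ cutoff U j x :=
  le_min zero_le_one (le_max_left _ _)

theorem cutoff_le_one (U : Set (Model n)) (j : ℕ) (x : Model n) : cutoff U j x ≤ 1 :=
  min_le_left _ _

theorem tsupport_cutoff_subset (U : Set (Model n)) (j : ℕ) : tsupport (cutoff U j) ⊆ U := by
  have hc : IsClosed {x : Model n | 1 ≤ j * Metric.infDist x Uᶜ} :=
    isClosed_le continuous_const (continuous_const.mul (Metric.continuous_infDist_pt Uᶜ))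
  refine (closure_minimal (fun x hx => ?_) hc).trans fun x hx => ?_
  · by_contra h
    have h1 : (j : ℝ) * Metric.infDist x Uᶜ < 1 := not_le.1 h
    exact hx (by rw [cutoff, max_eq_left (by linarith)]; simp)
  · by_contra h
    have h1 : (1 : ℝ) ≤ j * Metric.infDist x Uᶜ := hx
    rw [Metric.infDist_zero_of_mem (mem_compl h), mul_zero] at h1
    linarith

theorem hasCompactSupport_cutoff (hU : Bornology.IsBounded U) (j : ℕ) :
    HasCompactSupport (cutoff U j) :=
  Metric.isCompact_of_isClosed_isBounded (isClosed_tsupport _)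
    (hU.subset (tsupport_cutoff_subset U j))

theorem exists_cutoff_eq_one (hUo : IsOpen U) (hne : (Uᶜ).Nonempty) {K : Set (Model n)}
    (hK : IsCompact K) (hKU : K ⊆ U) : ∃ j, ∀ x ∈ K, cutoff U j x = 1 := by
  rcases K.eq_empty_or_nonempty with rfl | hKne
  · exact ⟨0, by simp⟩
  obtain ⟨x₀, hx₀, hmin⟩ := hK.exists_isMinOn hKne (Metric.continuous_infDist_pt Uᶜ).continuousOn
  have hpos : 0 < Metric.infDist x₀ Uᶜ := by
    rw [← hUo.isClosed_compl.notMem_iff_infDist_pos hne]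
    exact fun h => h (hKU hx₀)
  -- The numerator is 2 because the cutoff subtracts 1 from j times the distance before truncating
  -- at 1.
  obtain ⟨j, hj⟩ := exists_nat_ge (2 / Metric.infDist x₀ Uᶜ)
  refine ⟨j, fun x hx => ?_⟩
  have h1 : Metric.infDist x₀ Uᶜ ≤ Metric.infDist x Uᶜ := hmin hx
  rw [div_le_iff₀ hpos] at hj
  have h2 : (j : ℝ) * Metric.infDist x₀ Uᶜ ≤ j * Metric.infDist x Uᶜ := by gcongr
  rw [cutoff, max_eq_right (by linarith), min_eq_left (by linarith)]

/-- Countably many test forms that determine the topology of all test forms. -/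
def testFamily (k : ℕ) (U : Set (Model n)) : Set (Model n → Form n k) :=
  haveI := secondCountableTopology_form (n := n) (k := k)
  (range fun jd : ℕ × ℕ => fun x =>
    (cutoff U jd.1 x : ℂ) • TopologicalSpace.denseSeq C(Model n, Form n k) jd.2 x) ∪
  range fun ji : ℕ × Fin (Module.finrank ℂ (Form n k)) => fun x =>
    (cutoff U ji.1 x : ℂ) • Module.finBasis ℂ (Form n k) ji.2

theorem countable_testFamily (k : ℕ) (U : Set (Model n)) : (testFamily k U).Countable :=
  (countable_range _).union (countable_range _)

theorem testFamily_subset (hU : Bornology.IsBounded U) : testFamily k U ⊆ testCc k U := by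
  have := secondCountableTopology_form (n := n) (k := k)
  rintro _ (⟨jd, rfl⟩ | ⟨ji, rfl⟩)
  · exact smul_const_mem_testCc (continuous_cutoff U _) (hasCompactSupport_cutoff hU _)
      (tsupport_cutoff_subset U _) (ContinuousMap.continuous _)
  · exact smul_const_mem_testCc (continuous_cutoff U _) (hasCompactSupport_cutoff hU _)
      (tsupport_cutoff_subset U _) continuous_const

theorem exists_denseSeq_near [SecondCountableTopology (Form n k)] {K : Set (Model n)}
    (hK : IsCompact K) (ω : C(Model n, Form n k)) {δ : ℝ} (hδ : 0 < δ) :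
    ∃ d : ℕ, ∀ x ∈ K, ‖TopologicalSpace.denseSeq C(Model n, Form n k) d x - ω x‖ < δ := by
  have h := ContinuousMap.tendsto_iff_forall_isCompact_tendstoUniformlyOn.1
    (tendsto_id (x := 𝓝 ω)) K hK
  have h1 := Metric.tendstoUniformlyOn_iff.1 h δ hδ
  have h2 := (TopologicalSpace.denseRange_denseSeq C(Model n, Form n k)).mem_nhds h1
  obtain ⟨d, hd⟩ := h2
  refine ⟨d, fun x hx => ?_⟩
  have := hd x hx
  rwa [dist_comm, dist_eq_norm] at this

/-- A test form is a uniform limit of members of the family with supports in one compact set. The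
error in the squared norm is small relative to the total mass of the structure near that set, and
this mass is bounded by norms of the family, hence locally bounded in z. So the squared norm is a
locally uniform limit of continuous functions. -/
theorem continuous_normSq_of_testFamily (hUo : IsOpen U) (hU : Bornology.IsBounded U)
    (hne : (Uᶜ).Nonempty) {Z : Type*} [TopologicalSpace Z] {F : Z → Model n → Mat n}
    (hF : ∀ z, AEStronglyMeasurable (F z) (volume.restrict U))
    (hpos : ∀ z, ∀ᵐ x ∂volume.restrict U, (F z x).PosDef)
    (htop : ∀ z, LpSubOmega k U (F z) ∞)
    (h : ∀ η ∈ testFamily k U, Continuous fun z => normSq k U (F z) η)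
    {ω : Model n → Form n k} (hω : ω ∈ testCc k U) :
    Continuous fun z => normSq k U (F z) ω := by
  have := secondCountableTopology_form (n := n) (k := k)
  have hmem : ∀ z, ∀ η ∈ testCc k U, MemOmega k U (F z) η := fun z η hη =>
    htop z η (memLp_top_of_mem_testC0 hU (testCc_subset_testC0 hη))
  have hfin : ∀ z, ∀ η ∈ testCc k U, normSq k U (F z) η ≠ ∞ := fun z η hη => (hmem z η hη).2.ne
  set R : (Model n → Form n k) → Z → ℝ := fun η z => (normSq k U (F z) η).toReal with hR
  have hRint : ∀ z, ∀ η ∈ testCc k U, R η z = ∫ x in U, formDensity (F z x) (η x) := fun z η hη =>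
    toReal_normSq (hF z) (hpos z) (hmem z η hη)
  have hint : ∀ z, ∀ η ∈ testCc k U,
      Integrable (fun x => formDensity (F z x) (η x)) (volume.restrict U) := fun z η hη =>
    integrable_formDensity (hF z) (hpos z) (hmem z η hη)
  have hRc : ∀ η ∈ testFamily k U, Continuous (R η) := fun η hη =>
    continuous_iff_continuousAt.2 fun z =>
      (ENNReal.tendsto_toReal (hfin z η (testFamily_subset hU hη))).comp ((h η hη).tendsto z)
  suffices hmain : Continuous (R ω) by
    refine (ENNReal.continuous_ofReal.comp hmain).congr fun z => ?_
    exact ENNReal.ofReal_toReal (hfin z ω hω)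
  obtain ⟨j, hj⟩ := exists_cutoff_eq_one hUo hne hω.2.1 hω.2.2
  obtain ⟨l, hl⟩ := exists_cutoff_eq_one hUo hne (hasCompactSupport_cutoff hU j)
    (tsupport_cutoff_subset U j)
  obtain ⟨M, hM⟩ := hω.1.bounded_above_of_compact_support hω.2.1
  have hM0 : 0 ≤ M := (norm_nonneg _).trans (hM 0)
  set C := (SpectralField.exists_basis_bound (Form n k)).choose with hC
  have hC0 : 0 < C := (SpectralField.exists_basis_bound (Form n k)).choose_spec.1
  set e : Fin (Module.finrank ℂ (Form n k)) → Model n → Form n k := fun i x =>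
    (cutoff U l x : ℂ) • Module.finBasis ℂ (Form n k) i with he
  have he' : ∀ i, e i ∈ testFamily k U := fun i => Or.inr ⟨(l, i), rfl⟩
  -- τ dominates the integral of `densityBound` over the support of the cutoff of index j, since the
  -- cutoff of index l is 1 there. It is continuous because the forms e i belong to the family.
  set τ : Z → ℝ := fun z => C * ∑ i, R (e i) z with hτ
  have hτc : Continuous τ := continuous_const.mul (continuous_finsetSum _ fun i _ => hRc _ (he' i))
  have hτ0 : ∀ z, 0 ≤ τ z := fun z => mul_nonneg hC0.le
    (Finset.sum_nonneg fun i _ => ENNReal.toReal_nonneg)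
  -- The factor 2M + 1 bounds ‖a‖ + ‖ω‖ ≤ 2M + δ, whence the restriction δ ≤ 1.
  have key : ∀ δ : ℝ, 0 < δ → δ ≤ 1 → ∃ η ∈ testFamily k U, ∀ z,
      |R η z - R ω z| ≤ δ * (2 * M + 1) * τ z := by
    intro δ hδ hδ1
    obtain ⟨d, hd⟩ := exists_denseSeq_near (hasCompactSupport_cutoff hU j)
      (⟨ω, hω.1⟩ : C(Model n, Form n k)) hδ
    set a : Model n → Form n k := fun x =>
      (cutoff U j x : ℂ) • TopologicalSpace.denseSeq C(Model n, Form n k) d x with ha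
    have ha' : a ∈ testFamily k U := Or.inl ⟨(j, d), rfl⟩
    have hac := testFamily_subset hU ha'
    have hec : ∀ i, e i ∈ testCc k U := fun i => testFamily_subset hU (he' i)
    refine ⟨a, ha', fun z => ?_⟩
    have hωj : ∀ x, ω x = (cutoff U j x : ℂ) • ω x := by
      intro x
      by_cases hx : x ∈ tsupport ω
      · rw [hj x hx, Complex.ofReal_one]
        exact (one_smul ℂ (ω x)).symm
      · rw [image_eq_zero_of_notMem_tsupport hx]
        exact (smul_zero (A := Form n k) (cutoff U j x : ℂ)).symm
    have hsum : ∀ x, C * ∑ i, formDensity (F z x) (e i x) =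
        ‖(cutoff U l x : ℂ)‖ ^ 2 * densityBound k (F z x) := by
      intro x
      simp only [he, formDensity_smul, densityBound, ← Finset.mul_sum]
      ring
    have hpt : ∀ x, |formDensity (F z x) (a x) - formDensity (F z x) (ω x)| ≤
        δ * (2 * M + 1) * (C * ∑ i, formDensity (F z x) (e i x)) := by
      intro x
      have hD0 : 0 ≤ C * ∑ i, formDensity (F z x) (e i x) := mul_nonneg hC0.le
        (Finset.sum_nonneg fun i _ => formDensity_nonneg _ _)
      by_cases hx : x ∈ tsupport (cutoff U j)
      · have h1 := abs_formDensity_sub_le (F z x) (a x) (ω x)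
        have h2 : C * ∑ i, formDensity (F z x) (e i x) = densityBound k (F z x) := by
          rw [hsum, hl x hx, Complex.ofReal_one, norm_one, one_pow, one_mul]
        rw [h2] at hD0 ⊢
        have h3 : ‖a x - ω x‖ ≤ δ := by
          have h4 : a x - ω x = (cutoff U j x : ℂ) •
              (TopologicalSpace.denseSeq C(Model n, Form n k) d x - ω x) := by
            rw [ha]
            nth_rewrite 1 [hωj x]
            exact (smul_sub (cutoff U j x : ℂ) _ _).symm
          rw [h4, norm_smul, Complex.norm_real, Real.norm_eq_abs,
            abs_of_nonneg (cutoff_nonneg U j x)]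
          have h5 : ‖TopologicalSpace.denseSeq C(Model n, Form n k) d x - ω x‖ < δ := hd x hx
          nlinarith [cutoff_nonneg U j x, cutoff_le_one U j x,
            norm_nonneg (TopologicalSpace.denseSeq C(Model n, Form n k) d x - ω x)]
        have h6 : ‖a x‖ ≤ M + δ := by
          have := norm_add_le (a x - ω x) (ω x)
          rw [sub_add_cancel] at this
          linarith [hM x]
        refine h1.trans ?_
        rw [mul_comm]
        refine mul_le_mul_of_nonneg_right ?_ hD0
        exact mul_le_mul h3 (by linarith [hM x]) (by positivity) hδ.le
      · have h0 := image_eq_zero_of_notMem_tsupport hx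
        have h1 : a x = ω x := by
          rw [ha, hωj x]
          simp only [h0, Complex.ofReal_zero]
          exact (zero_smul ℂ (TopologicalSpace.denseSeq C(Model n, Form n k) d x)).trans
            (zero_smul ℂ (ω x)).symm
        rw [h1, sub_self, abs_zero]
        exact mul_nonneg (by positivity) hD0
    have hbound : Integrable (fun x => δ * (2 * M + 1) * (C * ∑ i, formDensity (F z x) (e i x)))
        (volume.restrict U) :=
      ((integrable_finsetSum _ fun i _ => hint z _ (hec i)).const_mul _).const_mul _
    rw [hRint z a hac, hRint z ω hω, ← integral_sub (hint z a hac) (hint z ω hω)]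
    refine (abs_integral_le_integral_abs).trans ((integral_mono
      ((hint z a hac).sub (hint z ω hω)).abs hbound hpt).trans (le_of_eq ?_))
    rw [integral_const_mul, integral_const_mul, integral_finsetSum _ fun i _ => hint z _ (hec i)]
    simp only [hτ, hRint z _ (hec _)]
  refine continuous_iff_continuousAt.2 fun z₀ => Metric.tendsto_nhds.2 fun ε hε => ?_
  -- T bounds τ near z₀. With δ adapted to it, the error is at most ε/3 at both points, which leaves
  -- ε/3 for the continuity of the approximating norm.
  set T := τ z₀ + 1 with hT
  have hT0 : 0 < T := by linarith [hτ0 z₀]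
  set δ := min 1 (ε / (3 * ((2 * M + 1) * T))) with hδ
  have hδ0 : 0 < δ := lt_min one_pos (by positivity)
  obtain ⟨η, hη, hηz⟩ := key δ hδ0 (min_le_left _ _)
  have hδε : δ * (2 * M + 1) * T ≤ ε / 3 := by
    have h1 := min_le_right 1 (ε / (3 * ((2 * M + 1) * T)))
    rw [← hδ, le_div_iff₀ (by positivity)] at h1
    linarith
  filter_upwards [hτc.continuousAt.eventually (gt_mem_nhds (show τ z₀ < T by linarith)),
    Metric.tendsto_nhds.1 ((hRc η hη).tendsto z₀) (ε / 3) (by positivity)] with z hz1 hz2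
  have hb : ∀ z, τ z ≤ T → |R η z - R ω z| ≤ ε / 3 := fun z hz =>
    (hηz z).trans ((mul_le_mul_of_nonneg_left hz (by positivity)).trans hδε)
  have b1 := abs_le.1 (hb z hz1.le)
  have b2 := abs_le.1 (hb z₀ (by linarith))
  rw [Real.dist_eq, abs_lt] at hz2 ⊢
  constructor <;> linarith

end Cutoff

/-! ### Metrizability -/

namespace RiemStructure

variable {n : ℕ} {V : Type*} [TopologicalSpace V] {ι : Type*}
  {θ : ι → OpenPartialHomeomorph V (Model n)}

/-- The cutoffs use the distance to the complement, which is 0 by convention when the complement is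
empty. -/
theorem compl_nonempty_of_isBounded (hn : 1 ≤ n) {U : Set (Model n)} (hU : Bornology.IsBounded U) :
    (Uᶜ).Nonempty := by
  rw [nonempty_compl]
  rintro rfl
  have : Nontrivial (Model n) := by
    have : Nonempty (Fin n) := ⟨⟨0, hn⟩⟩
    infer_instance
  exact NormedSpace.unbounded_univ ℝ (Model n) hU

/-- The index set of the countable family of functions that defines the topology. -/
abbrev FunctionIndex (θ : ι → OpenPartialHomeomorph V (Model n)) : Type _ :=
  Σ (i : ι) (k : {k : ℕ // k = n / 2 ∨ k = n / 2 + 1}), (testFamily (k : ℕ) (θ i).target) ⊕ Bool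

/-- The countable family of functions that defines the topology. -/
def functionFamily (g : RiemStructure θ) : FunctionIndex θ → ℝ≥0∞
  | ⟨i, k, Sum.inl ω⟩ => normSq k (θ i).target (g.field i) ω
  | ⟨i, k, Sum.inr true⟩ => pExp k (θ i).target (g.field i)
  | ⟨i, k, Sum.inr false⟩ => qExp k (θ i).target (g.field i)

theorem structTopology_le {T : ∀ k : ℕ, Set (Model n) → Set (Model n → Form n k)} (i : ι) {k : ℕ}
    (hk : k = n / 2 ∨ k = n / 2 + 1) : structTopology T θ ≤
      (⨅ ω ∈ T k (θ i).target, TopologicalSpace.induced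
        (fun g : RiemStructure θ => normSq k (θ i).target (g.field i) ω) inferInstance) ⊓
      (TopologicalSpace.induced (fun g : RiemStructure θ => pExp k (θ i).target (g.field i))
          inferInstance ⊓
        TopologicalSpace.induced (fun g : RiemStructure θ => qExp k (θ i).target (g.field i))
          inferInstance) :=
  (iInf_le _ i).trans ((iInf_le _ k).trans (iInf_le _ hk))

theorem structTopology_le_induced_normSq
    {T : ∀ k : ℕ, Set (Model n) → Set (Model n → Form n k)} (i : ι) {k : ℕ}
    (hk : k = n / 2 ∨ k = n / 2 + 1) {ω : Model n → Form n k} (hω : ω ∈ T k (θ i).target) :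
    structTopology T θ ≤ TopologicalSpace.induced
      (fun g : RiemStructure θ => normSq k (θ i).target (g.field i) ω) inferInstance :=
  (structTopology_le i hk).trans (inf_le_left.trans (iInf₂_le ω hω))

/-- The countable family consists of compactly supported forms, which gives one comparison. The
other is `continuous_normSq_of_testFamily`, applied with the space of structures itself as parameter
space. -/
theorem structTopology_testCc_eq (hn : 1 ≤ n) (hθ : ∀ i, Bornology.IsBounded (θ i).target) :
    structTopology (fun k U => testCc k U) θ =
      TopologicalSpace.induced (functionFamily (θ := θ)) inferInstance := by
  refine le_antisymm ?_ ?_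
  · rw [induced_to_pi]
    refine le_iInf ?_
    rintro ⟨i, ⟨k, hk⟩, ω | (_ | _)⟩
    · exact structTopology_le_induced_normSq i hk (testFamily_subset (hθ i) ω.2)
    · exact (structTopology_le i hk).trans (inf_le_right.trans inf_le_right)
    · exact (structTopology_le i hk).trans (inf_le_right.trans inf_le_left)
  · have hle : ∀ a : FunctionIndex θ,
        TopologicalSpace.induced (functionFamily (θ := θ)) inferInstance ≤
          TopologicalSpace.induced (fun g : RiemStructure θ => functionFamily g a)
            inferInstance := fun a => by
      rw [induced_to_pi]
      exact iInf_le _ a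
    refine le_iInf fun i => le_iInf fun k => le_iInf fun hk =>
      le_inf (le_iInf₂ fun ω hω => ?_) (le_inf ?_ ?_)
    · refine continuous_iff_le_induced.1 ?_
      exact @continuous_normSq_of_testFamily n k _ (θ i).open_target (hθ i)
        (compl_nonempty_of_isBounded hn (hθ i)) (RiemStructure θ)
        (TopologicalSpace.induced functionFamily inferInstance) (fun g => g.field i)
        (fun g => g.aestronglyMeasurable_field i)
        (fun g => g.posDef i) (fun g => g.lpSubOmega_top hθ i hk)
        (fun η hη => continuous_iff_le_induced.2 (hle ⟨i, ⟨k, hk⟩, Sum.inl ⟨η, hη⟩⟩)) ω hω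
    · exact hle ⟨i, ⟨k, hk⟩, Sum.inr true⟩
    · exact hle ⟨i, ⟨k, hk⟩, Sum.inr false⟩

/-- Norms of test forms determine the densities almost everywhere, and the densities in two
consecutive degrees determine the matrix. -/
theorem eq_of_normSq_eq (hn : 1 ≤ n) (hθ : ∀ i, Bornology.IsBounded (θ i).target)
    {g g' : RiemStructure θ} (h : ∀ i k, (k = n / 2 ∨ k = n / 2 + 1) →
      ∀ ω ∈ testCc k (θ i).target,
        normSq k (θ i).target (g.field i) ω = normSq k (θ i).target (g'.field i) ω) : g = g' := by
  refine ext_field (funext fun i => AEEqFun.ext ?_)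
  have hdens : ∀ k, (k = n / 2 ∨ k = n / 2 + 1) → ∀ᵐ x ∂volume.restrict (θ i).target,
      ∀ ω : Form n k, formDensity (g.field i x) ω = formDensity (g'.field i x) ω := fun k hk =>
    ae_formDensity_eq (θ i).open_target (hθ i) (g.aestronglyMeasurable_field i)
      (g'.aestronglyMeasurable_field i) (g.posDef i) (g'.posDef i) (g.lpSubOmega_top hθ i hk)
      (g'.lpSubOmega_top hθ i hk) (h i k hk)
  filter_upwards [hdens _ (Or.inl rfl), hdens _ (Or.inr rfl), g.posDef i, g'.posDef i]
    with x h1 h2 h3 h4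
  exact eq_of_formDensity_eq h3 h4 (by omega) h1 h2

/-- The topology is induced by a map to a countable product of copies of [0, ∞], so it is
pseudometrizable; the norms of test forms separate points. -/
theorem metrizableSpace_structTopology_testCc [Countable ι] (hn : 1 ≤ n)
    (hθ : ∀ i, Bornology.IsBounded (θ i).target) :
    @TopologicalSpace.MetrizableSpace (RiemStructure θ)
      (structTopology (fun k U => testCc k U) θ) := by
  letI T : TopologicalSpace (RiemStructure θ) := structTopology (fun k U => testCc k U) θ
  have hcount : ∀ (i : ι) (k : ℕ), Countable (testFamily k (θ i).target) := fun i k =>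
    (countable_testFamily k (θ i).target).to_subtype
  have hind : Topology.IsInducing (functionFamily (θ := θ)) :=
    ⟨structTopology_testCc_eq hn hθ⟩
  have hpm : TopologicalSpace.PseudoMetrizableSpace (RiemStructure θ) := hind.pseudoMetrizableSpace
  have hT0 : T0Space (RiemStructure θ) := by
    refine ⟨fun g g' hgg => eq_of_normSq_eq hn hθ fun i k hk ω hω => ?_⟩
    have hc : Continuous fun g : RiemStructure θ => normSq k (θ i).target (g.field i) ω :=
      continuous_iff_le_induced.2 (structTopology_le_induced_normSq i hk hω)
    exact (hgg.map hc).eq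
  infer_instance

end RiemStructure

end LpRiemann

end

theorem proposition2p2 (n : ℕ) (hn : 1 ≤ n) (p : ℝ≥0∞) (hp : 1 ≤ p)
    (V : Type*) [TopologicalSpace V] [CompactSpace V] [T2Space V]
    [ChartedSpace (LpRiemann.Model n) V] (hV : LpRiemann.IsDerivableManifold n p V)
    (ι : Type*) (θ : ι → OpenPartialHomeomorph V (LpRiemann.Model n))
    (hθ : LpRiemann.IsChartCover θ) :
    (Nonempty (LpRiemann.RiemStructure θ) → PathConnectedSpace (LpRiemann.RiemStructure θ)) ∧
    (∀ g₀ g₁ : LpRiemann.RiemStructure θ, ∃ γ : Path g₀ g₁,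
      (∀ (t : unitInterval) (i : ι), ∀ᵐ x ∂volume.restrict (θ i).target,
        (γ t).field i x = LpRiemann.geomMean (g₀.field i x) (g₁.field i x) t) ∧
      (∀ t : unitInterval, 0 < (t : ℝ) → (t : ℝ) < 1 → ∀ (i : ι) (k : ℕ)
        (ω : LpRiemann.Model n →ₘ[volume.restrict (θ i).target] LpRiemann.Form n k),
        LpRiemann.interpNorm
            (LpRiemann.omegaNorm k (θ i).target (g₀.field i))
            (LpRiemann.omegaNorm k (θ i).target (g₁.field i)) t ω =
          LpRiemann.omegaNorm k (θ i).target ((γ t).field i) ω)) ∧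
    (Countable ι →
      @TopologicalSpace.MetrizableSpace (LpRiemann.RiemStructure θ)
        (LpRiemann.structTopology (fun k U => LpRiemann.testCc k U) θ)) := by
  exact ⟨fun hne => ⟨hne, fun g₀ g₁ =>
      ⟨LpRiemann.RiemStructure.geodesicPath hn hθ.bounded g₀ g₁⟩⟩,
    fun g₀ g₁ => ⟨LpRiemann.RiemStructure.geodesicPath hn hθ.bounded g₀ g₁,
      fun t i => LpRiemann.RiemStructure.coeFn_geodesicField g₀ g₁ t i,
      fun t _ _ i k ω =>
        LpRiemann.RiemStructure.interpNorm_omegaNorm hn hθ.bounded g₀ g₁ t i k ω⟩,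
    fun hι => LpRiemann.RiemStructure.metrizableSpace_structTopology_testCc hn hθ.bounded⟩
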